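/- Work in units $8\pi G=c=1$. A \emph{type I solution} with parameter $\gamma$ on an open time interval $I$ consists of a metric $ds^2=-dt^2+h_{ij}(t)\,dx^i dx^j$ on $I\times\mathbb R^3$ ($h$ of class $C^2$ and positive definite), a one-form $J=J_\mu(t)\,dx^\mu$ and a density $\rho(t)\ge 0$ (both $C^1$) such that $$R_{\mu\nu}-\tfrac12Rg_{\mu\nu}=T^{\rm pf}_{\mu\nu}+J_\mu J_\nu-\tfrac12 g_{\mu\nu}J_\lambda J^\lambda,\qquad dJ=0,\qquad d{\star J}=0,\qquad \nabla^\mu T^{\rm pf}_{\mu\nu}=0,$$ where $T^{\rm pf}$ is the stress tensor of a perfect fluid with four-velocity $u=\partial_t$, density $\rho$ and pressure $(\gamma-1)\rho$. Let $\theta_{ij}=\frac12\dot h_{ij}$, $H=\frac13h^{ij}\theta_{ij}$, and let $q$ be defined by $\dot H=-(1+q)H^2$. In a spatial orthonormal frame $(e_a)$ the \emph{Hubble-normalized state} is $(S_{ab},V_a,\Theta,\Omega)=\big(\theta_{ab}/H-\delta_{ab},\,J_a/(\sqrt6H),\,J_0/(\sqrt6H),\,\rho/(3H^2)\big)$; it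 is determined up to the choice of the frame. The state space with spatial $j$-form is the set of $(S,V,0,\Omega)$ with $S$ symmetric and trace-free, $\Omega\ge0$ and $\frac16\sum_{a,b}S_{ab}^2+\sum_aV_a^2+\Omega=1$. A state is \emph{rotating} if $\Omega>0$, $V\ne0$ and $V$ is not an eigenvector of $S$; a solution is \emph{rotating} if at some time it has $H>0$ and a rotating state. A solution is an \emph{equilibrium} if at all times $H>0$ and its state is constant, up to the choice of the orthonormal frame at each time. \textbf{Theorem (the Rope).} (1) For $\gamma\in[0,2]$, a type I equilibrium solution (on some nonempty open time interval) with a rotating state exists if and only if $\gamma\in(6/5,4/3)$. (2) Let $\gamma\in(6/5,4/3)$. The Rope $$ds^2=-dt^2+t^2\Big(dx+\sqrt{\tfrac{2(5\gamma-6)}{2-\gamma}}\;t^{1-\frac2\gamma}dz\Big)^2+t^{\frac{2(4-3\gamma)}{\gamma}}dy^2+t^{\frac{4(\gamma-1)}{\gamma}}dz^2,\qquad J=\tfrac{2-\gamma}{\gamma}\,dx,\qquad \rho=\frac{2(4-3\gamma)}{\gamma^2t^2}$$ is a type I solution on $t>0$. It is self-similar (there is a vector field $X$ with $\mathcal L_Xg=2g$);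 it is not locally rotationally symmetric at any point (no local Killing field that preserves $u$ vanishes at a point with nonzero first derivative there); its deceleration parameter is $q=\frac{3\gamma}2-1$; and it is an equilibrium with a state $s$ that is rotating and lies in the state space with spatial $j$-form. (3) Let $\gamma\in(6/5,4/3)$. The Rope is the global attractor of the type I state space, in the following sense. Every rotating type I solution on an interval $(a,b)$ extends to a solution on $(a,\infty)$, and for every rotating type I solution on an interval $(a,\infty)$ the Hubble-normalized state, in suitable orthonormal frames, converges to $s$ as $t\to\infty$. Moreover $s$ is stable: for every neighbourhood $N$ of $s$ there is a neighbourhood $N'$ of $s$ such that every type I solution on an interval $(a,\infty)$ that at some time has $H>0$ and, in some orthonormal frame, a state in $N'$ has at each later time, in a suitable orthonormal frame, a state in $N$. The set of rotating states is open, and its intersection with the state space with spatial $j$-form is dense there. (4) The Rope interpolates between Wonderland and the Edge: for each $t>0$ its spatial metric, $j$-form and density converge, as $\gamma\downarrow6/5$, to those of Wonderland at $\gamma=6/5$, and, as $\gamma\uparrow4/3$, to those of the Edge. Here Wonderland is $-dt^2+t^2dx^2+t^{\frac{2-\gamma}\gamma}(dy^2+dz^2)$ with $J=\frac1\gamma\sqrt{\frac{(3\gamma-2)(2-\gamma)}2}\,dx$,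 $\rho=\frac{2-\gamma}{\gamma^2t^2}$, and the Edge is $-dt^2+t^2(dx+\sqrt2\,t^{-1/2}dz)^2+dy^2+t\,dz^2$ with $J=\frac12dx$, $\rho=0$; they are type I solutions on $t>0$, the former for $\gamma=6/5$ and the latter for $\gamma=4/3$. -/

import Mathlib

open Set Filter Topology Matrix
open scoped ContDiff

noncomputable section

namespace JFormCosmology

/-! ### Lorentzian geometry in a coordinate chart `(x⁰, x¹, x², x³)`

Tensor fields are given by their components.  They are assumed continuously differentiable
wherever they are differentiated, so that `pd` is the usual partial derivative. -/

abbrev Pt := Fin 4 → ℝ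

abbrev MetricField := Pt → Matrix (Fin 4) (Fin 4) ℝ

/-- The partial derivative `∂_μ f` at `p`. -/
def pd (μ : Fin 4) (f : Pt → ℝ) (p : Pt) : ℝ :=
  lineDeriv ℝ f p (Pi.single μ 1)

/-- The Christoffel symbol `Γ^l_{μν}`. -/
def christoffel (g : MetricField) (l μ ν : Fin 4) (p : Pt) : ℝ :=
  (1 / 2) * ∑ s, (g p)⁻¹ l s *
    (pd μ (fun x => g x s ν) p + pd ν (fun x => g x s μ) p - pd s (fun x => g x μ ν) p)

/-- The Ricci tensor `R_{μν}`. -/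
def ricci (g : MetricField) (μ ν : Fin 4) (p : Pt) : ℝ :=
  ∑ l, (pd l (christoffel g l μ ν) p - pd ν (christoffel g l μ l) p)
    + ∑ l, ∑ s, (christoffel g l l s p * christoffel g s μ ν p
        - christoffel g l ν s p * christoffel g s μ l p)

/-- The Ricci scalar. -/
def scalarCurvature (g : MetricField) (p : Pt) : ℝ :=
  ∑ μ, ∑ ν, (g p)⁻¹ μ ν * ricci g μ ν p

/-- The Einstein tensor `R_{μν} - R g_{μν} / 2`. -/
def einstein (g : MetricField) (μ ν : Fin 4) (p : Pt) : ℝ :=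
  ricci g μ ν p - (1 / 2) * scalarCurvature g p * g p μ ν

/-- The divergence `∇^μ J_μ` of a one-form. -/
def divOneForm (g : MetricField) (J : Pt → Fin 4 → ℝ) (p : Pt) : ℝ :=
  ∑ μ, ∑ ν, (g p)⁻¹ μ ν *
    (pd μ (fun x => J x ν) p - ∑ l, christoffel g l μ ν p * J p l)

/-- The divergence `∇^μ T_{μν}` of a two-tensor. -/
def divTwoTensor (g : MetricField) (T : Pt → Matrix (Fin 4) (Fin 4) ℝ) (ν : Fin 4) (p : Pt) : ℝ :=
  ∑ μ, ∑ l, (g p)⁻¹ μ l *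
    (pd l (fun x => T x μ ν) p
      - ∑ s, (christoffel g s l μ p * T p s ν + christoffel g s l ν p * T p μ s))

/-- The Lie derivative `(L_X g)_{μν}`. -/
def lieMetric (g : MetricField) (X : Pt → Fin 4 → ℝ) (μ ν : Fin 4) (p : Pt) : ℝ :=
  ∑ l, (X p l * pd l (fun x => g x μ ν) p
    + g p l ν * pd μ (fun x => X x l) p + g p μ l * pd ν (fun x => X x l) p)

/-- The Lie derivative `(L_X u)_μ` of a one-form. -/
def lieOneForm (u : Pt → Fin 4 → ℝ) (X : Pt → Fin 4 → ℝ) (μ : Fin 4) (p : Pt) : ℝ :=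
  ∑ l, (X p l * pd l (fun x => u x μ) p + u p l * pd μ (fun x => X x l) p)

/-- The metric is self-similar on `U`: it admits a proper homothetic vector field. -/
def IsSelfSimilar (U : Set Pt) (g : MetricField) : Prop :=
  ∃ X : Pt → Fin 4 → ℝ, ContDiffOn ℝ ∞ X U ∧
    ∀ p ∈ U, ∀ μ ν, lieMetric g X μ ν p = 2 * g p μ ν

/-- Local rotational symmetry at `p`: near `p` there is a Killing vector field that preserves the
four-velocity, vanishes at `p` and does not vanish to first order, i.e. it generates a nontrivial
one-parameter group of rotations of the rest space of the observer at `p`. -/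
def IsLRSAt (g : MetricField) (u : Pt → Fin 4 → ℝ) (p : Pt) : Prop :=
  ∃ N : Set Pt, IsOpen N ∧ p ∈ N ∧ ∃ X : Pt → Fin 4 → ℝ, ContDiffOn ℝ ∞ X N ∧
    (∀ x ∈ N, ∀ μ ν, lieMetric g X μ ν x = 0) ∧ (∀ x ∈ N, ∀ μ, lieOneForm u X μ x = 0) ∧
    X p = 0 ∧ ∃ μ ν, pd μ (fun x => X x ν) p ≠ 0

/-! ### Einstein gravity with a `γ`-law perfect fluid and a `j`-form (units `8πG = c = 1`) -/

/-- `T_{μν} = (ρ + P) u_μ u_ν + P g_{μν}` with `P = (γ - 1) ρ`. -/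
def fluidTensor (γ : ℝ) (g : MetricField) (u : Pt → Fin 4 → ℝ) (ρ : Pt → ℝ) :
    Pt → Matrix (Fin 4) (Fin 4) ℝ :=
  fun p => Matrix.of fun μ ν =>
    (ρ p + (γ - 1) * ρ p) * u p μ * u p ν + (γ - 1) * ρ p * g p μ ν

/-- `T_{μν} = J_μ J_ν - g_{μν} J_λ J^λ / 2`. -/
def jFormTensor (g : MetricField) (J : Pt → Fin 4 → ℝ) : Pt → Matrix (Fin 4) (Fin 4) ℝ :=
  fun p => Matrix.of fun μ ν =>
    J p μ * J p ν - (1 / 2) * g p μ ν * ∑ a, ∑ b, (g p)⁻¹ a b * J p a * J p b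

/-- The field equations on `U`: the Einstein equations, `dJ = 0` and `d⋆J = 0` for the `j`-form,
and separate conservation of the fluid. -/
structure IsFieldSolution (γ : ℝ) (U : Set Pt) (g : MetricField) (u J : Pt → Fin 4 → ℝ)
    (ρ : Pt → ℝ) : Prop where
  g_smooth : ∀ μ ν, ContDiffOn ℝ 2 (fun p => g p μ ν) U
  J_smooth : ∀ μ, ContDiffOn ℝ 1 (fun p => J p μ) U
  ρ_smooth : ContDiffOn ℝ 1 ρ U
  ρ_nonneg : ∀ p ∈ U, 0 ≤ ρ p
  einstein_eq : ∀ p ∈ U, ∀ μ ν,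
    einstein g μ ν p = fluidTensor γ g u ρ p μ ν + jFormTensor g J p μ ν
  J_closed : ∀ p ∈ U, ∀ μ ν, pd μ (fun x => J x ν) p = pd ν (fun x => J x μ) p
  J_coclosed : ∀ p ∈ U, divOneForm g J p = 0
  fluid_conserved : ∀ p ∈ U, ∀ ν, divTwoTensor g (fluidTensor γ g u ρ) ν p = 0

/-! ### Bianchi type I -/

abbrev SpatialMetric := ℝ → Matrix (Fin 3) (Fin 3) ℝ

/-- `-dt² + h_{ij}(t) dx^i dx^j`. -/
def typeIMetric (h : SpatialMetric) : MetricField := fun p =>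
  Matrix.of fun μ ν =>
    Fin.cases (Fin.cases (-1) (fun _ => 0) ν)
      (fun i => Fin.cases 0 (fun j => h (p 0) i j) ν) μ

/-- The four-velocity `u = ∂_t` of the fundamental observers, as the one-form `-dt`. -/
def comoving : Pt → Fin 4 → ℝ := fun _ => ![-1, 0, 0, 0]

/-- The points whose time coordinate lies in `I`. -/
def slab (I : Set ℝ) : Set Pt := {p | p 0 ∈ I}

/-- A Bianchi type I solution over the time interval `I`: spatial metric `h`, homogeneous
`j`-form `J` (component `0` temporal, components `1, 2, 3` spatial), and a comoving `γ`-law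
perfect fluid of energy density `ρ`. -/
structure IsTypeISolution (γ : ℝ) (I : Set ℝ) (h : SpatialMetric) (J : ℝ → Fin 4 → ℝ)
    (ρ : ℝ → ℝ) : Prop where
  posDef : ∀ t ∈ I, (h t).PosDef
  field_eqs : IsFieldSolution γ (slab I) (typeIMetric h) comoving
    (fun p => J (p 0)) (fun p => ρ (p 0))

/-- The time derivative of the spatial metric. -/
def metricDot (h : SpatialMetric) (t : ℝ) : Matrix (Fin 3) (Fin 3) ℝ :=
  Matrix.of fun i j => deriv (fun s => h s i j) t

/-- The Hubble parameter: one third of the trace `h^{ij} (∂_t h_{ij}) / 2` of the expansion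
tensor. -/
def hubble (h : SpatialMetric) (t : ℝ) : ℝ :=
  (1 / 6) * ((h t)⁻¹ * metricDot h t).trace

/-- The deceleration parameter `q`, defined by `dH/dt = -(1 + q) H²`. -/
def deceleration (h : SpatialMetric) (t : ℝ) : ℝ :=
  -1 - deriv (hubble h) t / hubble h t ^ 2

/-! ### The Hubble-normalized state space -/

/-- Hubble-normalized states `(S, V, Θ, Ω)`: shear, spatial part and temporal part of the
`j`-form, and density parameter of the fluid, all in an orthonormal frame. -/
abbrev HState := Matrix (Fin 3) (Fin 3) ℝ × (Fin 3 → ℝ) × ℝ × ℝ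

/-- The columns of `E` form an orthonormal frame of the spatial metric at time `t`. -/
def IsOrthonormalFrame (h : SpatialMetric) (t : ℝ) (E : Matrix (Fin 3) (Fin 3) ℝ) : Prop :=
  Eᵀ * h t * E = 1

/-- The state at time `t` in the frame `E`: `S_{ab} = θ_{ab} / H - δ_{ab}` with `θ` the expansion
tensor, `V_a = J_a / (√6 H)`, `Θ = J_0 / (√6 H)` and `Ω = ρ / (3 H²)`. -/
def hState (h : SpatialMetric) (J : ℝ → Fin 4 → ℝ) (ρ : ℝ → ℝ) (t : ℝ)
    (E : Matrix (Fin 3) (Fin 3) ℝ) : HState :=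
  ((hubble h t)⁻¹ • ((1 / 2 : ℝ) • (Eᵀ * metricDot h t * E)) - 1,
    fun a => (∑ i : Fin 3, E i a * J t i.succ) / (Real.sqrt 6 * hubble h t),
    J t 0 / (Real.sqrt 6 * hubble h t),
    ρ t / (3 * hubble h t ^ 2))

/-- The type I state space with purely spatial `j`-form: `S` symmetric and trace-free, `Θ = 0`,
`Ω ≥ 0`, and the Hamiltonian constraint. -/
def spatialStates : Set HState :=
  {s | s.1.IsSymm ∧ s.1.trace = 0 ∧ s.2.2.1 = 0 ∧ 0 ≤ s.2.2.2 ∧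
    (1 / 6) * ∑ a, ∑ b, s.1 a b ^ 2 + ∑ a, s.2.1 a ^ 2 + s.2.2.2 = 1}

/-- The fluid is present, the spatial part of the `j`-form does not vanish, and it is not an
eigenvector of the shear.  As the components `J_i` are constant in time by `dJ = 0`, the last
condition says that the direction of the vector rotates with respect to a frame that is
Fermi-propagated along `u`. -/
def IsRotating (s : HState) : Prop :=
  0 < s.2.2.2 ∧ s.2.1 ≠ 0 ∧ ∀ c : ℝ, s.1 *ᵥ s.2.1 ≠ c • s.2.1

/-- An expanding type I solution over `I` with a fluid and a rotating vector. -/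
structure IsRotatingSolution (γ : ℝ) (I : Set ℝ) (h : SpatialMetric) (J : ℝ → Fin 4 → ℝ)
    (ρ : ℝ → ℝ) : Prop where
  solution : IsTypeISolution γ I h J ρ
  rotating : ∃ t ∈ I, 0 < hubble h t ∧ ∃ E, IsOrthonormalFrame h t E ∧
    IsRotating (hState h J ρ t E)

/-- The Hubble-normalized state is constant and equal to `s`, up to the choice of the orthonormal
frame at each time. -/
def IsEquilibrium (I : Set ℝ) (h : SpatialMetric) (J : ℝ → Fin 4 → ℝ) (ρ : ℝ → ℝ)
    (s : HState) : Prop :=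
  ∀ t ∈ I, 0 < hubble h t ∧ ∃ E, IsOrthonormalFrame h t E ∧ hState h J ρ t E = s

/-- `s` attracts every expanding type I solution with a fluid and a rotating vector: each such
solution extends to all later times, and its state converges to `s`, up to the choice of the
orthonormal frame at each time. -/
def AttractsRotating (γ : ℝ) (s : HState) : Prop :=
  (∀ (a b : ℝ) (h : SpatialMetric) (J : ℝ → Fin 4 → ℝ) (ρ : ℝ → ℝ),
    IsRotatingSolution γ (Ioo a b) h J ρ →
      ∃ h' J' ρ', IsRotatingSolution γ (Ioi a) h' J' ρ' ∧
        ∀ t ∈ Ioo a b, h' t = h t ∧ J' t = J t ∧ ρ' t = ρ t) ∧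
  (∀ (a : ℝ) (h : SpatialMetric) (J : ℝ → Fin 4 → ℝ) (ρ : ℝ → ℝ),
    IsRotatingSolution γ (Ioi a) h J ρ →
      ∃ E : ℝ → Matrix (Fin 3) (Fin 3) ℝ, (∀ t > a, IsOrthonormalFrame h t (E t)) ∧
        Tendsto (fun t => hState h J ρ t (E t)) atTop (𝓝 s))

/-- Stability of `s`: type I solutions that start close to `s` remain close to `s`, up to the
choice of the orthonormal frame at each time. -/
def IsStableState (γ : ℝ) (s : HState) : Prop :=
  ∀ N ∈ 𝓝 s, ∃ N' ∈ 𝓝 s, ∀ (a : ℝ) (h : SpatialMetric) (J : ℝ → Fin 4 → ℝ) (ρ : ℝ → ℝ),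
    IsTypeISolution γ (Ioi a) h J ρ →
      ∀ t₀ > a, 0 < hubble h t₀ → ∀ E₀, IsOrthonormalFrame h t₀ E₀ → hState h J ρ t₀ E₀ ∈ N' →
        ∀ t ≥ t₀, ∃ E, IsOrthonormalFrame h t E ∧ hState h J ρ t E ∈ N

/-! ### The Rope, Wonderland and the Edge -/

/-- The square of a constant-coefficient one-form `w`, as a quadratic form. -/
def sqForm (w : Fin 3 → ℝ) : Matrix (Fin 3) (Fin 3) ℝ := vecMulVec w w

/-- `t² (dx + √(2(5γ-6)/(2-γ)) t^(1-2/γ) dz)² + t^(2(4-3γ)/γ) dy² + t^(4(γ-1)/γ) dz²`. -/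
def ropeMetric (γ : ℝ) : SpatialMetric := fun t =>
  t ^ 2 • sqForm ![1, 0, Real.sqrt (2 * (5 * γ - 6) / (2 - γ)) * t ^ (1 - 2 / γ)]
    + t ^ (2 * (4 - 3 * γ) / γ) • sqForm ![0, 1, 0]
    + t ^ (4 * (γ - 1) / γ) • sqForm ![0, 0, 1]

/-- `J = ((2 - γ)/γ) dx`. -/
def ropeForm (γ : ℝ) : ℝ → Fin 4 → ℝ := fun _ => ![0, (2 - γ) / γ, 0, 0]

def ropeDensity (γ : ℝ) : ℝ → ℝ := fun t => 2 * (4 - 3 * γ) / (γ ^ 2 * t ^ 2)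

/-- `t² dx² + t^((2-γ)/γ) (dy² + dz²)`. -/
def wonderlandMetric (γ : ℝ) : SpatialMetric := fun t =>
  t ^ 2 • sqForm ![1, 0, 0]
    + t ^ ((2 - γ) / γ) • (sqForm ![0, 1, 0] + sqForm ![0, 0, 1])

def wonderlandForm (γ : ℝ) : ℝ → Fin 4 → ℝ :=
  fun _ => ![0, Real.sqrt ((3 * γ - 2) * (2 - γ) / 2) / γ, 0, 0]

def wonderlandDensity (γ : ℝ) : ℝ → ℝ := fun t => (2 - γ) / (γ ^ 2 * t ^ 2)

/-- `t² (dx + √2 t^(-1/2) dz)² + dy² + t dz²`. -/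
def edgeMetric : SpatialMetric := fun t =>
  t ^ 2 • sqForm ![1, 0, Real.sqrt 2 * t ^ (-1 / 2 : ℝ)]
    + sqForm ![0, 1, 0] + t • sqForm ![0, 0, 1]

/-- `J = (1/2) dx`. -/
def edgeForm : ℝ → Fin 4 → ℝ := fun _ => ![0, 1 / 2, 0, 0]

end JFormCosmology

end

open JFormCosmology

set_option linter.unusedSimpArgs false

/-! Put Q = 3γ/2 - 1, which lies in (4/5, 1) exactly when γ lies in (6/5, 4/3). Let K = h⁻¹θ be the
mixed expansion tensor.

Reduction. For a type I metric the field equations at time t are ordinary differential equations for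
h and ρ, with J_i constant, together with the Hamiltonian constraint and J_0 J_i = 0
(`isTypeISolution_iff`). Rotation persists: the components of J ∧ θ(J♯) solve y' = -(tr K) y, and ρ
solves an equation of the same type, so neither can start to vanish. The momentum constraint then
gives J_0 = 0, and the Hamiltonian constraint keeps H away from zero
(`IsRotatingSolution.rotatingOn`). In the frame with first axis along J and third axis in the plane
of J and θ(J♯), the state is a `canonState` with entries s, b, v, w, r, Ω. Frames are not
differentiated: s, b, v², w², r² are rational functions of H, ρ and the moments J(KⁿJ♯), whose
derivatives come straight from the field equations. The outcome is the autonomous system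
`ReducedFlow`, whose x, w, r are the squares v², w², r² and whose m is Ω.

Attraction. The core is the function `lyapunov`, a combination of log x, log w, log m and log(1 -
⟨S, S*⟩), where S* is the diagonal part of the shear of the Rope. The first three weights are
proportional to the contributions of x, w, m to the constraint at the Rope; the last makes the total
homogeneous of degree zero, so that rescaling by H plays no role. Its derivative is a positive
multiple of a nonnegative combination of r and the defect in the reverse Cauchy-Schwarz inequality
(1 - |S|²)(1 - |S*|²) ≤ (1 - ⟨S, S*⟩)² (`lyapunovRate_eq`). Gibbs' inequality and the same reverse
Cauchy-Schwarz inequality show that the Rope is its unique maximum (`lyapunov_le`). Along a solution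
it increases and is bounded, so it converges, and a Barbalat argument in the time variable log(scale
factor) makes its rate tend to zero. This fixes the limits of s, b and r. A second Barbalat argument
makes the derivatives of s and b tend to zero; together with the constraint these are three linear
equations for the limits of x, w, m (`ReducedFlow.tendsto_rope`). Stability follows since the
superlevel sets of a strict maximum on a compact state space shrink to the Rope
(`exists_lt_ropeLyapunov`).

Range of γ. At a rotating equilibrium the right-hand sides of the reduced system vanish, and the
sign conditions w > 0, m > 0, r ≥ 0 leave only Q in (4/5, 1) (`deceleration_mem_of_equilibrium`).

Extension to all later times. In a Fermi-propagated frame the equations are polynomial and preserve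
their constraints. The constraints bound the frame expansion and the density by the trace of the
expansion, which decreases, and the frame and coframe grow at most exponentially. So nothing blows
up in finite time (`exists_fermi_solution`).

The Rope itself is of the form h_ij = t^(a_i + a_j) M_ij, for which the field equations become
algebraic (`evolutionAt_scaling`). They hold on the closed interval [6/5, 4/3], and the end points
are Wonderland and the Edge. An infinitesimal rotation would give a constant matrix B with h(t)B
antisymmetric for all nearby t; the distinct powers of t in h force B = 0. -/

namespace JFormCosmology

/-! ### Curvature of type I metrics -/

/-- The expansion tensor `θ = ḣ / 2`. -/
noncomputable def expansion (h : SpatialMetric) (t : ℝ) : Matrix (Fin 3) (Fin 3) ℝ :=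
  (1 / 2 : ℝ) • metricDot h t

/-- The mixed expansion tensor `K = h⁻¹ θ`. -/
noncomputable def mixedExpansion (h : SpatialMetric) (t : ℝ) : Matrix (Fin 3) (Fin 3) ℝ :=
  (h t)⁻¹ * expansion h t

lemma trace_mixedExpansion (h : SpatialMetric) (t : ℝ) :
    (mixedExpansion h t).trace = 3 * hubble h t := by
  simp only [mixedExpansion, expansion, hubble, Matrix.mul_smul, Matrix.trace_smul, smul_eq_mul]
  ring

lemma pd_time (f : ℝ → ℝ) (p : Pt) : pd 0 (fun x => f (x 0)) p = deriv f (p 0) := by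
  simp only [pd, lineDeriv, Pi.add_apply, Pi.smul_apply, Pi.single_eq_same, smul_eq_mul, mul_one]
  rw [deriv_comp_const_add, add_zero]

lemma pd_space (i : Fin 3) (f : ℝ → ℝ) (p : Pt) : pd i.succ (fun x => f (x 0)) p = 0 := by
  simp [pd, lineDeriv]

@[simp] lemma typeIMetric_zero_zero (h : SpatialMetric) (p : Pt) : typeIMetric h p 0 0 = -1 := rfl
@[simp] lemma typeIMetric_zero_succ (h : SpatialMetric) (p : Pt) (j : Fin 3) :
    typeIMetric h p 0 j.succ = 0 := rfl
@[simp] lemma typeIMetric_succ_zero (h : SpatialMetric) (p : Pt) (i : Fin 3) :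
    typeIMetric h p i.succ 0 = 0 := rfl
@[simp] lemma typeIMetric_succ_succ (h : SpatialMetric) (p : Pt) (i j : Fin 3) :
    typeIMetric h p i.succ j.succ = h (p 0) i j := rfl

lemma inv_typeIMetric {h : SpatialMetric} {p : Pt} (hp : IsUnit (h (p 0))) :
    (typeIMetric h p)⁻¹ = typeIMetric (fun t => (h t)⁻¹) p := by
  apply Matrix.inv_eq_right_inv
  have hm := Matrix.mul_nonsing_inv _ ((Matrix.isUnit_iff_isUnit_det _).1 hp)
  ext μ ν
  refine Fin.cases ?_ (fun i => ?_) μ <;> refine Fin.cases ?_ (fun j => ?_) ν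
  · simp [Matrix.mul_apply, Fin.sum_univ_succ (n := 3)]
  · simp [Matrix.mul_apply, Fin.sum_univ_succ (n := 3), Matrix.one_apply, (Fin.succ_ne_zero j).symm]
  · simp [Matrix.mul_apply, Fin.sum_univ_succ (n := 3)]
  · have := congrFun (congrFun hm i) j
    rw [Matrix.mul_apply] at this
    simp [Matrix.mul_apply, Fin.sum_univ_succ (n := 3), Matrix.one_apply] at this ⊢
    exact this

lemma pd_typeIMetric_time (h : SpatialMetric) (i j : Fin 3) (p : Pt) :
    pd 0 (fun x => typeIMetric h x i.succ j.succ) p = metricDot h (p 0) i j :=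
  pd_time (fun s => h s i j) p

lemma pd_typeIMetric_space (h : SpatialMetric) (i : Fin 3) (μ ν : Fin 4) (p : Pt) :
    pd i.succ (fun x => typeIMetric h x μ ν) p = 0 :=
  pd_space i (fun s => typeIMetric h (fun _ => s) μ ν) p

lemma pd_const (μ : Fin 4) (c : ℝ) (p : Pt) : pd μ (fun _ => c) p = 0 := by
  simp [pd, lineDeriv]

lemma pd_typeIMetric_zero_left (h : SpatialMetric) (μ ν : Fin 4) (p : Pt) :
    pd μ (fun x => typeIMetric h x 0 ν) p = 0 := by
  refine Fin.cases ?_ (fun j => ?_) ν <;> exact pd_const _ _ _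

lemma pd_typeIMetric_zero_right (h : SpatialMetric) (μ ν : Fin 4) (p : Pt) :
    pd μ (fun x => typeIMetric h x ν 0) p = 0 := by
  refine Fin.cases ?_ (fun j => ?_) ν <;> exact pd_const _ _ _

section Christoffel

variable {h : SpatialMetric} {p : Pt}

lemma christoffel_typeI_time (hp : IsUnit (h (p 0))) (i j : Fin 3) :
    christoffel (typeIMetric h) 0 i.succ j.succ p = expansion h (p 0) i j := by
  simp only [christoffel, inv_typeIMetric hp, Fin.sum_univ_succ (n := 3), pd_typeIMetric_space,
    pd_typeIMetric_time, pd_typeIMetric_zero_left, pd_typeIMetric_zero_right]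
  simp [expansion]

lemma christoffel_typeI_time_zero_right (hp : IsUnit (h (p 0))) (μ : Fin 4) :
    christoffel (typeIMetric h) 0 μ 0 p = 0 := by
  simp only [christoffel, inv_typeIMetric hp, Fin.sum_univ_succ (n := 3), pd_typeIMetric_space,
    pd_typeIMetric_time, pd_typeIMetric_zero_left, pd_typeIMetric_zero_right]
  simp

lemma christoffel_typeI_time_zero_left (hp : IsUnit (h (p 0))) (μ : Fin 4) :
    christoffel (typeIMetric h) 0 0 μ p = 0 := by
  simp only [christoffel, inv_typeIMetric hp, Fin.sum_univ_succ (n := 3), pd_typeIMetric_space,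
    pd_typeIMetric_time, pd_typeIMetric_zero_left, pd_typeIMetric_zero_right]
  simp

lemma christoffel_typeI_space_zero_zero (hp : IsUnit (h (p 0))) (i : Fin 3) :
    christoffel (typeIMetric h) i.succ 0 0 p = 0 := by
  simp only [christoffel, inv_typeIMetric hp, Fin.sum_univ_succ (n := 3), pd_typeIMetric_space,
    pd_typeIMetric_time, pd_typeIMetric_zero_left, pd_typeIMetric_zero_right]
  simp

lemma christoffel_typeI_space (hp : IsUnit (h (p 0))) (i j k : Fin 3) :
    christoffel (typeIMetric h) i.succ j.succ k.succ p = 0 := by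
  simp only [christoffel, inv_typeIMetric hp, Fin.sum_univ_succ (n := 3), pd_typeIMetric_space,
    pd_typeIMetric_time, pd_typeIMetric_zero_left, pd_typeIMetric_zero_right]
  simp

lemma christoffel_typeI_mixed_left (hp : IsUnit (h (p 0))) (i j : Fin 3) :
    christoffel (typeIMetric h) i.succ 0 j.succ p = mixedExpansion h (p 0) i j := by
  simp only [christoffel, inv_typeIMetric hp]
  rw [Fin.sum_univ_succ]
  simp only [pd_typeIMetric_space, pd_typeIMetric_time, pd_typeIMetric_zero_left,
    pd_typeIMetric_zero_right]
  simp only [typeIMetric_succ_zero, typeIMetric_succ_succ, zero_mul, zero_add,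
    add_zero, sub_zero, mixedExpansion, expansion, Matrix.mul_apply, Matrix.smul_apply,
    smul_eq_mul, Finset.mul_sum]
  refine Finset.sum_congr rfl fun k _ => by ring

lemma christoffel_typeI_mixed_right (hp : IsUnit (h (p 0))) (i j : Fin 3) :
    christoffel (typeIMetric h) i.succ j.succ 0 p = mixedExpansion h (p 0) i j := by
  rw [← christoffel_typeI_mixed_left hp]
  simp only [christoffel, pd_typeIMetric_zero_left, pd_typeIMetric_zero_right]
  congr 1
  refine Finset.sum_congr rfl fun k _ => by ring

end Christoffel

/-- By homogeneity only the time coordinate matters. Evaluating at the point all of whose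
coordinates are `x 0` exhibits the symbol as a function of one real variable, to which `pd_time` and
`pd_space` apply. -/
lemma christoffel_typeI_eq (h : SpatialMetric) (l μ ν : Fin 4) (x : Pt) :
    christoffel (typeIMetric h) l μ ν x = christoffel (typeIMetric h) l μ ν (fun _ => x 0) := by
  have hpd : ∀ (a b c : Fin 4), pd a (fun y => typeIMetric h y b c) x =
      pd a (fun y => typeIMetric h y b c) (fun _ => x 0) := by
    intro a b c
    refine Fin.cases ?_ (fun i => ?_) a
    · exact (pd_time (fun s => typeIMetric h (fun _ => s) b c) x).trans
        (pd_time (fun s => typeIMetric h (fun _ => s) b c) (fun _ => x 0)).symm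
    · rw [pd_typeIMetric_space, pd_typeIMetric_space]
  simp only [christoffel, hpd]
  rfl

/-- Only a germ of `f` is required, because the closed forms of the Christoffel symbols hold where
`h` is invertible, which is known just near `p 0`. -/
lemma pd_christoffel_time (h : SpatialMetric) (l μ ν : Fin 4) (p : Pt) {f : ℝ → ℝ}
    (hf : (fun s : ℝ => christoffel (typeIMetric h) l μ ν (fun _ => s)) =ᶠ[𝓝 (p 0)] f) :
    pd 0 (christoffel (typeIMetric h) l μ ν) p = deriv f (p 0) := by
  rw [← hf.deriv_eq, ← pd_time]
  exact congrArg (fun f => pd _ f p) (funext fun x => christoffel_typeI_eq h l μ ν x)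

lemma pd_christoffel_space (h : SpatialMetric) (l μ ν : Fin 4) (i : Fin 3) (p : Pt) :
    pd i.succ (christoffel (typeIMetric h) l μ ν) p = 0 := by
  rw [← pd_space i (fun s => christoffel (typeIMetric h) l μ ν (fun _ => s)) p]
  exact congrArg (fun f => pd _ f p) (funext fun x => christoffel_typeI_eq h l μ ν x)

section Ricci

variable {h : SpatialMetric} {p : Pt}

lemma ricci_typeI_zero_zero (hp : ∀ᶠ s in 𝓝 (p 0), IsUnit (h s)) :
    ricci (typeIMetric h) 0 0 p = -∑ i, deriv (fun s => mixedExpansion h s i i) (p 0)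
      - (mixedExpansion h (p 0) * mixedExpansion h (p 0)).trace := by
  have hu := hp.self_of_nhds
  have h1 : ∀ i : Fin 3, pd 0 (christoffel (typeIMetric h) i.succ 0 i.succ) p =
      deriv (fun s => mixedExpansion h s i i) (p 0) := fun i =>
    pd_christoffel_time h _ _ _ p (hp.mono fun s hs =>
      christoffel_typeI_mixed_left (p := fun _ => s) hs i i)
  have h2 : pd 0 (christoffel (typeIMetric h) 0 0 0) p = 0 := by
    rw [pd_christoffel_time h _ _ _ p (f := fun _ => 0) (hp.mono fun s hs =>
      christoffel_typeI_time_zero_left (p := fun _ => s) hs 0), deriv_const]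
  simp only [ricci, Fin.sum_univ_succ (n := 3), pd_christoffel_space, h1, h2,
    christoffel_typeI_time_zero_left hu, christoffel_typeI_space_zero_zero hu,
    christoffel_typeI_mixed_left hu, Matrix.trace, Matrix.diag_apply, Matrix.mul_apply,
    christoffel_typeI_time_zero_right hu]
  simp [Finset.sum_neg_distrib, Finset.sum_add_distrib, sub_eq_add_neg]

lemma ricci_typeI_zero_succ (hp : ∀ᶠ s in 𝓝 (p 0), IsUnit (h s)) (j : Fin 3) :
    ricci (typeIMetric h) 0 j.succ p = 0 := by
  have hu := hp.self_of_nhds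
  have h2 : pd 0 (christoffel (typeIMetric h) 0 0 j.succ) p = 0 := by
    rw [pd_christoffel_time h _ _ _ p (f := fun _ => 0) (hp.mono fun s hs =>
      christoffel_typeI_time_zero_left (p := fun _ => s) hs _), deriv_const]
  simp only [ricci, Fin.sum_univ_succ (n := 3), pd_christoffel_space, h2,
    christoffel_typeI_time_zero_left hu, christoffel_typeI_space_zero_zero hu,
    christoffel_typeI_mixed_left hu, christoffel_typeI_mixed_right hu, christoffel_typeI_space hu,
    christoffel_typeI_time_zero_right hu, christoffel_typeI_time hu]
  simp

lemma ricci_typeI_succ_zero (hp : ∀ᶠ s in 𝓝 (p 0), IsUnit (h s)) (j : Fin 3) :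
    ricci (typeIMetric h) j.succ 0 p = 0 := by
  have hu := hp.self_of_nhds
  have h2 : pd 0 (christoffel (typeIMetric h) 0 j.succ 0) p = 0 := by
    rw [pd_christoffel_time h _ _ _ p (f := fun _ => 0) (hp.mono fun s hs =>
      christoffel_typeI_time_zero_right (p := fun _ => s) hs _), deriv_const]
  have h3 : ∀ i : Fin 3, pd 0 (christoffel (typeIMetric h) i.succ j.succ i.succ) p = 0 := by
    intro i
    rw [pd_christoffel_time h _ _ _ p (f := fun _ => 0) (hp.mono fun s hs =>
      christoffel_typeI_space (p := fun _ => s) hs _ _ _), deriv_const]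
  simp only [ricci, Fin.sum_univ_succ (n := 3), pd_christoffel_space, h2, h3,
    christoffel_typeI_time_zero_left hu, christoffel_typeI_space_zero_zero hu,
    christoffel_typeI_mixed_left hu, christoffel_typeI_mixed_right hu, christoffel_typeI_space hu,
    christoffel_typeI_time_zero_right hu, christoffel_typeI_time hu]
  simp

/-- The two quadratic terms stay separate since symmetry of `h` is not assumed here; they merge in
`ricci_typeI_spatial`. -/
lemma ricci_typeI_succ_succ (hp : ∀ᶠ s in 𝓝 (p 0), IsUnit (h s)) (i j : Fin 3) :
    ricci (typeIMetric h) i.succ j.succ p = deriv (fun s => expansion h s i j) (p 0)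
      + (mixedExpansion h (p 0)).trace * expansion h (p 0) i j
      - (expansion h (p 0) * mixedExpansion h (p 0)) j i
      - (expansion h (p 0) * mixedExpansion h (p 0)) i j := by
  have hu := hp.self_of_nhds
  have h1 : pd 0 (christoffel (typeIMetric h) 0 i.succ j.succ) p =
      deriv (fun s => expansion h s i j) (p 0) :=
    pd_christoffel_time h _ _ _ p (hp.mono fun s hs =>
      christoffel_typeI_time (p := fun _ => s) hs i j)
  simp only [ricci, Fin.sum_univ_succ (n := 3), pd_christoffel_space, h1,
    christoffel_typeI_time_zero_left hu, christoffel_typeI_space_zero_zero hu,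
    christoffel_typeI_mixed_left hu, christoffel_typeI_mixed_right hu, christoffel_typeI_space hu,
    christoffel_typeI_time_zero_right hu, christoffel_typeI_time hu, Matrix.trace,
    Matrix.diag_apply, Matrix.mul_apply (M := expansion h (p 0))]
  simp [Finset.sum_add_distrib, sub_eq_add_neg, Finset.sum_mul, mul_comm (mixedExpansion h _ _ _)]
  ring

end Ricci

end JFormCosmology

namespace JFormCosmology

/-! ### Entrywise derivatives of matrices -/

/-- `A` has the entrywise derivative `A'` at `t`. -/
def HasMatDerivAt {m n : Type*} (A : ℝ → Matrix m n ℝ) (A' : Matrix m n ℝ) (t : ℝ) : Prop :=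
  ∀ i j, HasDerivAt (fun s => A s i j) (A' i j) t

namespace HasMatDerivAt

variable {l m n : Type*} {A : ℝ → Matrix m n ℝ} {A' B' : Matrix m n ℝ}
  {t : ℝ}

lemma mul [Fintype m] {C : ℝ → Matrix l m ℝ} {C' : Matrix l m ℝ} (hC : HasMatDerivAt C C' t)
    (hA : HasMatDerivAt A A' t) :
    HasMatDerivAt (fun s => C s * A s) (C' * A t + C t * A') t := by
  intro i j
  simp only [Matrix.mul_apply, Matrix.add_apply, ← Finset.sum_add_distrib]
  exact HasDerivAt.fun_sum fun k _ => (hC i k).mul (hA k j)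

lemma congr_deriv (hA : HasMatDerivAt A A' t) (h : A' = B') : HasMatDerivAt A B' t := h ▸ hA

lemma trace [Fintype m] {A : ℝ → Matrix m m ℝ} {A' : Matrix m m ℝ} (hA : HasMatDerivAt A A' t) :
    HasDerivAt (fun s => (A s).trace) A'.trace t :=
  HasDerivAt.fun_sum fun i _ => hA i i

lemma mulVec [Fintype n] {u : ℝ → n → ℝ} {u' : n → ℝ} (hA : HasMatDerivAt A A' t)
    (hu : ∀ i, HasDerivAt (fun s => u s i) (u' i) t) (i : m) :
    HasDerivAt (fun s => (A s *ᵥ u s) i) ((A' *ᵥ u t + A t *ᵥ u') i) t := by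
  simp only [Matrix.mulVec, dotProduct, Pi.add_apply, ← Finset.sum_add_distrib]
  exact HasDerivAt.fun_sum fun k _ => (hA i k).mul (hu k)

end HasMatDerivAt

lemma hasDerivAt_dotProduct {n : Type*} [Fintype n] {u v : ℝ → n → ℝ} {u' v' : n → ℝ} {t : ℝ}
    (hu : ∀ i, HasDerivAt (fun s => u s i) (u' i) t)
    (hv : ∀ i, HasDerivAt (fun s => v s i) (v' i) t) :
    HasDerivAt (fun s => u s ⬝ᵥ v s) (u' ⬝ᵥ v t + u t ⬝ᵥ v') t := by
  simp only [dotProduct, ← Finset.sum_add_distrib]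
  exact HasDerivAt.fun_sum fun k _ => (hu k).mul (hv k)

section Inverse

variable {A : ℝ → Matrix (Fin 3) (Fin 3) ℝ} {A' : Matrix (Fin 3) (Fin 3) ℝ} {t : ℝ}

lemma eventually_isUnit (hA : ∀ i j, ContinuousAt (fun s => A s i j) t) (ht : IsUnit (A t)) :
    ∀ᶠ s in 𝓝 t, IsUnit (A s) := by
  have h1 : ContinuousAt (fun s => (A s).det) t := by
    have h2 : ContinuousAt A t := continuousAt_pi.2 fun i => continuousAt_pi.2 fun j => hA i j
    exact (continuous_id.matrix_det.continuousAt).comp h2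
  have h3 : (A t).det ≠ 0 := ((Matrix.isUnit_iff_isUnit_det _).1 ht).ne_zero
  exact (h1.eventually_ne h3).mono fun s hs => (Matrix.isUnit_iff_isUnit_det _).2 hs.isUnit

/-- The adjugate formula shows that the entries of the inverse are differentiable; the value of the
derivative then comes from differentiating A A⁻¹ = 1. -/
lemma HasMatDerivAt.inv (hA : HasMatDerivAt A A' t) (ht : IsUnit (A t)) :
    HasMatDerivAt (fun s => (A s)⁻¹) (-((A t)⁻¹ * A' * (A t)⁻¹)) t := by
  have hdet : (A t).det ≠ 0 := ((Matrix.isUnit_iff_isUnit_det _).1 ht).ne_zero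
  have hd : ∀ i j, DifferentiableAt ℝ (fun s => A s i j) t := fun i j => (hA i j).differentiableAt
  have hdiff : ∀ i j, DifferentiableAt ℝ (fun s => (A s)⁻¹ i j) t := by
    have hdd : DifferentiableAt ℝ (fun s => (A s).det) t := by
      simp only [Matrix.det_fin_three]; fun_prop
    intro i j
    simp only [Matrix.inv_def, Ring.inverse_eq_inv', Matrix.smul_apply, smul_eq_mul]
    refine (hdd.inv hdet).mul ?_
    simp only [Matrix.adjugate_fin_three]
    fin_cases i <;> fin_cases j <;> simp <;> fun_prop
  set P : Matrix (Fin 3) (Fin 3) ℝ := Matrix.of fun i j => deriv (fun s => (A s)⁻¹ i j) t with hP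
  have hPd : HasMatDerivAt (fun s => (A s)⁻¹) P t := fun i j => (hdiff i j).hasDerivAt
  have hprod := hA.mul hPd
  have hone : A' * (A t)⁻¹ + A t * P = 0 := by
    ext i j
    refine (hprod i j).unique ?_
    have hev : (fun s => (A s * (A s)⁻¹) i j) =ᶠ[𝓝 t] fun _ => (1 : Matrix _ _ ℝ) i j := by
      filter_upwards [eventually_isUnit (fun i j => (hA i j).continuousAt) ht] with s hs
      rw [Matrix.mul_nonsing_inv _ ((Matrix.isUnit_iff_isUnit_det _).1 hs)]
    exact (hasDerivAt_const t _).congr_of_eventuallyEq hev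
  refine hPd.congr_deriv ?_
  have h1 : (A t)⁻¹ * (A t * P) = P := by
    rw [← Matrix.mul_assoc, Matrix.nonsing_inv_mul _ hdet.isUnit, Matrix.one_mul]
  rw [← h1, eq_neg_of_add_eq_zero_right hone, Matrix.mul_neg, Matrix.mul_assoc]

end Inverse

/-! ### The evolution equations -/

/-- The spatial components of a one-form. -/
def spatialPart (J : Fin 4 → ℝ) : Fin 3 → ℝ := fun i => J i.succ

/-- The type I field equations at time `t` as evolution and constraint equations. -/
structure EvolutionAt (γ : ℝ) (h : SpatialMetric) (J : ℝ → Fin 4 → ℝ) (ρ : ℝ → ℝ) (t : ℝ) :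
    Prop where
  posDef : (h t).PosDef
  h_smooth : ∀ i j, ContDiffAt ℝ 2 (fun s => h s i j) t
  J_smooth : ∀ μ, ContDiffAt ℝ 1 (fun s => J s μ) t
  ρ_smooth : ContDiffAt ℝ 1 ρ t
  ρ_nonneg : 0 ≤ ρ t
  hamiltonian : (mixedExpansion h t).trace ^ 2 - (mixedExpansion h t * mixedExpansion h t).trace =
    2 * ρ t + J t 0 ^ 2 + spatialPart (J t) ⬝ᵥ ((h t)⁻¹ *ᵥ spatialPart (J t))
  momentum : ∀ i : Fin 3, J t 0 * J t i.succ = 0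
  evolution : HasMatDerivAt (expansion h) ((2 : ℝ) • (expansion h t * mixedExpansion h t)
    - (mixedExpansion h t).trace • expansion h t + vecMulVec (spatialPart (J t)) (spatialPart (J t))
    + ((2 - γ) / 2 * ρ t) • h t) t
  J_space : ∀ i : Fin 3, HasDerivAt (fun s => J s i.succ) 0 t
  J_time : HasDerivAt (fun s => J s 0) (-((mixedExpansion h t).trace * J t 0)) t
  density : HasDerivAt ρ (-(γ * (mixedExpansion h t).trace * ρ t)) t

lemma PosDef.isSymm' {A : Matrix (Fin 3) (Fin 3) ℝ} (hA : A.PosDef) : Aᵀ = A := by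
  have := hA.isHermitian
  rwa [Matrix.IsHermitian, Matrix.conjTranspose_eq_transpose_of_trivial] at this

section Smooth

variable {h : SpatialMetric} {t : ℝ}

lemma hasMatDerivAt_metric (hs : ∀ i j, ContDiffAt ℝ 2 (fun s => h s i j) t) :
    HasMatDerivAt h ((2 : ℝ) • expansion h t) t := by
  intro i j
  have := ((hs i j).differentiableAt (by norm_num)).hasDerivAt
  simpa [expansion, metricDot] using this

lemma hasMatDerivAt_expansion (hs : ∀ i j, ContDiffAt ℝ 2 (fun s => h s i j) t) :
    HasMatDerivAt (expansion h) (Matrix.of fun i j => deriv (fun s => expansion h s i j) t) t := by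
  intro i j
  have h1 : ContDiffAt ℝ 1 (deriv (fun s => h s i j)) t := by
    exact (hs i j).derivWithin (m := 1) (by norm_num)
  have h2 : DifferentiableAt ℝ (fun s => expansion h s i j) t := by
    simpa [expansion, metricDot] using (h1.differentiableAt (by norm_num)).const_mul (1 / 2 : ℝ)
  exact h2.hasDerivAt

lemma expansion_transpose (hp : ∀ᶠ s in 𝓝 t, (h s).PosDef) : (expansion h t)ᵀ = expansion h t := by
  ext i j
  have : (fun s => h s j i) =ᶠ[𝓝 t] fun s => h s i j := by
    filter_upwards [hp] with s hs
    exact congrFun (congrFun (PosDef.isSymm' hs) i) j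
  simp [expansion, metricDot, this.deriv_eq]

end Smooth

end JFormCosmology

namespace JFormCosmology

/-! ### The Einstein equations of type I metrics: evolution and constraints. -/

section Einstein

variable {h : SpatialMetric} {p : Pt} {γ : ℝ} {J : ℝ → Fin 4 → ℝ} {ρ : ℝ → ℝ}

lemma sum_sum_eq_trace_mul {A B : Matrix (Fin 3) (Fin 3) ℝ} (hB : Bᵀ = B) :
    ∑ i, ∑ j, A i j * B i j = (A * B).trace := by
  simp only [Matrix.trace, Matrix.diag_apply, Matrix.mul_apply]
  refine Finset.sum_congr rfl fun i _ => Finset.sum_congr rfl fun j _ => ?_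
  rw [← Matrix.transpose_apply B, hB]

lemma hasMatDerivAt_inv_metric {t : ℝ} (hp : (h t).PosDef)
    (hs : ∀ i j, ContDiffAt ℝ 2 (fun s => h s i j) t) :
    HasMatDerivAt (fun s => (h s)⁻¹) (-((2 : ℝ) • (mixedExpansion h t * (h t)⁻¹))) t := by
  refine ((hasMatDerivAt_metric hs).inv hp.isUnit).congr_deriv ?_
  simp [mixedExpansion]

lemma expansion_mul_mixed_transpose {t : ℝ} (hp : ∀ᶠ s in 𝓝 t, (h s).PosDef) :
    (expansion h t * mixedExpansion h t)ᵀ = expansion h t * mixedExpansion h t := by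
  simp only [mixedExpansion, Matrix.transpose_mul, expansion_transpose hp,
    Matrix.transpose_nonsing_inv, PosDef.isSymm' hp.self_of_nhds, Matrix.mul_assoc]

/-- The time derivative of the expansion tensor. -/
noncomputable def expansionDot (h : SpatialMetric) (t : ℝ) : Matrix (Fin 3) (Fin 3) ℝ :=
  Matrix.of fun i j => deriv (fun s => expansion h s i j) t

lemma expansionDot_transpose {t : ℝ} (hp : ∀ᶠ s in 𝓝 t, (h s).PosDef) :
    (expansionDot h t)ᵀ = expansionDot h t := by
  ext i j
  have : (fun s => expansion h s j i) =ᶠ[𝓝 t] fun s => expansion h s i j := by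
    filter_upwards [hp.eventually_nhds] with s hs
    exact congrFun (congrFun (expansion_transpose hs) i) j
  exact this.deriv_eq

/-- The spatial part of the Ricci tensor. -/
noncomputable def spatialRicci (h : SpatialMetric) (t : ℝ) : Matrix (Fin 3) (Fin 3) ℝ :=
  expansionDot h t + (mixedExpansion h t).trace • expansion h t
    - (2 : ℝ) • (expansion h t * mixedExpansion h t)

lemma ricci_typeI_spatial (hp : ∀ᶠ s in 𝓝 (p 0), (h s).PosDef) (i j : Fin 3) :
    ricci (typeIMetric h) i.succ j.succ p = spatialRicci h (p 0) i j := by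
  rw [ricci_typeI_succ_succ (hp.mono fun s hs => hs.isUnit)]
  have := congrFun (congrFun (expansion_mul_mixed_transpose hp) i) j
  rw [Matrix.transpose_apply] at this
  rw [this]
  simp [spatialRicci, expansionDot]
  ring

lemma trace_inv_mul_expansion_mul_mixed (h : SpatialMetric) (t : ℝ) :
    ((h t)⁻¹ * (expansion h t * mixedExpansion h t)).trace =
      (mixedExpansion h t * mixedExpansion h t).trace := by
  rw [← Matrix.mul_assoc]; rfl

lemma trace_spatialRicci (h : SpatialMetric) (t : ℝ) :
    ((h t)⁻¹ * spatialRicci h t).trace = ((h t)⁻¹ * expansionDot h t).trace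
      + (mixedExpansion h t).trace ^ 2 - 2 * (mixedExpansion h t * mixedExpansion h t).trace := by
  simp only [spatialRicci, Matrix.mul_add, Matrix.mul_sub, Matrix.mul_smul, Matrix.trace_add,
    Matrix.trace_sub, Matrix.trace_smul, smul_eq_mul, trace_inv_mul_expansion_mul_mixed]
  rw [show (h t)⁻¹ * expansion h t = mixedExpansion h t from rfl]
  ring

lemma ricci_typeI_time (hp : ∀ᶠ s in 𝓝 (p 0), (h s).PosDef)
    (hs : ∀ i j, ContDiffAt ℝ 2 (fun s => h s i j) (p 0)) :
    ricci (typeIMetric h) 0 0 p = (mixedExpansion h (p 0) * mixedExpansion h (p 0)).trace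
      - ((h (p 0))⁻¹ * expansionDot h (p 0)).trace := by
  rw [ricci_typeI_zero_zero (hp.mono fun s hs => hs.isUnit)]
  have hK := (hasMatDerivAt_inv_metric hp.self_of_nhds hs).mul (hasMatDerivAt_expansion hs)
  have : ∑ i, deriv (fun s => mixedExpansion h s i i) (p 0) = _ :=
    Finset.sum_congr rfl fun i _ => (hK i i).deriv
  rw [this]
  change -(Matrix.trace _) - _ = _
  rw [Matrix.trace_add, Matrix.neg_mul, Matrix.smul_mul, Matrix.trace_neg, Matrix.trace_smul,
    Matrix.mul_assoc, show (h (p 0))⁻¹ * expansion h (p 0) = mixedExpansion h (p 0) from rfl,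
    smul_eq_mul, expansionDot]
  ring

lemma scalarCurvature_typeI (hp : ∀ᶠ s in 𝓝 (p 0), (h s).PosDef) :
    scalarCurvature (typeIMetric h) p =
      -ricci (typeIMetric h) 0 0 p + ((h (p 0))⁻¹ * spatialRicci h (p 0)).trace := by
  have hsym : (spatialRicci h (p 0))ᵀ = spatialRicci h (p 0) := by
    simp only [spatialRicci, Matrix.transpose_add, Matrix.transpose_sub, Matrix.transpose_smul,
      expansion_transpose hp, expansionDot_transpose hp, expansion_mul_mixed_transpose hp]
  rw [← sum_sum_eq_trace_mul hsym]
  simp only [scalarCurvature, inv_typeIMetric (h := h) hp.self_of_nhds.isUnit,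
    Fin.sum_univ_succ (n := 3), typeIMetric_zero_zero, typeIMetric_zero_succ,
    typeIMetric_succ_zero, typeIMetric_succ_succ, ricci_typeI_spatial hp]
  simp

lemma jForm_norm_typeI (hp : (h (p 0)).PosDef) (v : Fin 4 → ℝ) :
    ∑ a, ∑ b, (typeIMetric h p)⁻¹ a b * v a * v b =
      -v 0 ^ 2 + spatialPart v ⬝ᵥ ((h (p 0))⁻¹ *ᵥ spatialPart v) := by
  simp only [inv_typeIMetric (h := h) hp.isUnit, Fin.sum_univ_succ (n := 3),
    typeIMetric_zero_zero, typeIMetric_zero_succ, typeIMetric_succ_zero, typeIMetric_succ_succ,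
    spatialPart, dotProduct, Matrix.mulVec, Finset.mul_sum, zero_mul, Finset.sum_const_zero,
    zero_add, add_zero]
  congr 1
  · ring
  · refine Finset.sum_congr rfl fun i _ => Finset.sum_congr rfl fun j _ => by ring

lemma trace_inv_mul_vecMulVec (A : Matrix (Fin 3) (Fin 3) ℝ) (v : Fin 3 → ℝ) :
    (A * vecMulVec v v).trace = v ⬝ᵥ (A *ᵥ v) := by
  simp only [Matrix.trace, Matrix.diag_apply, Matrix.mul_apply, vecMulVec_apply, dotProduct,
    Matrix.mulVec, Finset.mul_sum]
  refine Finset.sum_congr rfl fun i _ => Finset.sum_congr rfl fun j _ => by ring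

/-- This is trace reversal. The h-trace of the spatial equations, combined with the 00 equation,
gives R = |J|² - J_0² + (4 - 3γ)ρ with |J|² the square of the spatial part. Inserting this turns the
spatial equations into R_ij = J_i J_j + (2 - γ)/2 ρ h_ij and removes the second derivatives from the
00 equation, which becomes the Hamiltonian constraint. The same two traces give the converse. -/
lemma einstein_typeI_iff (hp : ∀ᶠ s in 𝓝 (p 0), (h s).PosDef)
    (hs : ∀ i j, ContDiffAt ℝ 2 (fun s => h s i j) (p 0)) :
    (∀ μ ν, einstein (typeIMetric h) μ ν p =
      fluidTensor γ (typeIMetric h) comoving (fun p => ρ (p 0)) p μ ν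
        + jFormTensor (typeIMetric h) (fun p => J (p 0)) p μ ν) ↔
    ((mixedExpansion h (p 0)).trace ^ 2 - (mixedExpansion h (p 0) * mixedExpansion h (p 0)).trace =
      2 * ρ (p 0) + J (p 0) 0 ^ 2
        + spatialPart (J (p 0)) ⬝ᵥ ((h (p 0))⁻¹ *ᵥ spatialPart (J (p 0)))) ∧
    (∀ i : Fin 3, J (p 0) 0 * J (p 0) i.succ = 0) ∧
    expansionDot h (p 0) = (2 : ℝ) • (expansion h (p 0) * mixedExpansion h (p 0))
      - (mixedExpansion h (p 0)).trace • expansion h (p 0)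
      + vecMulVec (spatialPart (J (p 0))) (spatialPart (J (p 0)))
      + ((2 - γ) / 2 * ρ (p 0)) • h (p 0) := by
  have hp0 := hp.self_of_nhds
  set t := p 0 with ht
  have hR := scalarCurvature_typeI hp
  have hR0 := ricci_typeI_time hp hs
  have hX := trace_spatialRicci h t
  have hsplit : (∀ μ ν, einstein (typeIMetric h) μ ν p =
      fluidTensor γ (typeIMetric h) comoving (fun p => ρ (p 0)) p μ ν
        + jFormTensor (typeIMetric h) (fun p => J (p 0)) p μ ν) ↔
      (ricci (typeIMetric h) 0 0 p + 1 / 2 * scalarCurvature (typeIMetric h) p =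
        ρ t + (1 / 2) * (J t 0 ^ 2 + spatialPart (J t) ⬝ᵥ ((h t)⁻¹ *ᵥ spatialPart (J t)))) ∧
      (∀ i : Fin 3, J t 0 * J t i.succ = 0) ∧
      spatialRicci h t - (1 / 2 * scalarCurvature (typeIMetric h) p) • h t =
        vecMulVec (spatialPart (J t)) (spatialPart (J t)) + ((γ - 1) * ρ t - (1 / 2) *
          (-J t 0 ^ 2 + spatialPart (J t) ⬝ᵥ ((h t)⁻¹ *ᵥ spatialPart (J t)))) • h t := by
    have hsucc : ∀ i : Fin 3, comoving p i.succ = 0 := by intro i; fin_cases i <;> rfl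
    have hzero : comoving p 0 = -1 := rfl
    constructor
    · intro H
      refine ⟨?_, fun i => ?_, ?_⟩
      · have := H 0 0
        simp only [einstein, fluidTensor, jFormTensor, Matrix.of_apply, jForm_norm_typeI hp0,
          typeIMetric_zero_zero, hzero, ← ht] at this
        linarith
      · have := H 0 i.succ
        simp only [einstein, fluidTensor, jFormTensor, Matrix.of_apply, jForm_norm_typeI hp0,
          typeIMetric_zero_succ, hzero, hsucc, ← ht,
          ricci_typeI_zero_succ (hp.mono fun s hs => hs.isUnit)] at this
        linarith
      · ext i j
        have := H i.succ j.succ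
        simp only [einstein, fluidTensor, jFormTensor, Matrix.of_apply, jForm_norm_typeI hp0,
          typeIMetric_succ_succ, hsucc, ← ht, ricci_typeI_spatial hp] at this
        simp only [Matrix.sub_apply, Matrix.smul_apply, Matrix.add_apply, vecMulVec_apply,
          smul_eq_mul, spatialPart] at this ⊢
        linarith
    · rintro ⟨h1, h2, h3⟩ μ ν
      refine Fin.cases ?_ (fun i => ?_) μ <;> refine Fin.cases ?_ (fun j => ?_) ν
      · simp only [einstein, fluidTensor, jFormTensor, Matrix.of_apply, jForm_norm_typeI hp0,
          typeIMetric_zero_zero, hzero, ← ht]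
        linarith
      · have := h2 j
        simp only [einstein, fluidTensor, jFormTensor, Matrix.of_apply, jForm_norm_typeI hp0,
          typeIMetric_zero_succ, hzero, hsucc, ← ht,
          ricci_typeI_zero_succ (hp.mono fun s hs => hs.isUnit)]
        linarith
      · have := h2 i
        simp only [einstein, fluidTensor, jFormTensor, Matrix.of_apply, jForm_norm_typeI hp0,
          typeIMetric_succ_zero, hzero, hsucc, ← ht,
          ricci_typeI_succ_zero (hp.mono fun s hs => hs.isUnit)]
        linarith
      · have := congrFun (congrFun h3 i) j
        simp only [einstein, fluidTensor, jFormTensor, Matrix.of_apply, jForm_norm_typeI hp0,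
          typeIMetric_succ_succ, hsucc, ← ht, ricci_typeI_spatial hp]
        simp only [Matrix.sub_apply, Matrix.smul_apply, Matrix.add_apply, vecMulVec_apply,
          smul_eq_mul, spatialPart] at this ⊢
        linarith
  rw [hsplit]
  have htr1 : ((h t)⁻¹ * h t).trace = 3 := by
    rw [Matrix.nonsing_inv_mul _ ((Matrix.isUnit_iff_isUnit_det _).1 hp0.isUnit),
      Matrix.trace_one]; simp
  set N := spatialPart (J t) ⬝ᵥ ((h t)⁻¹ *ᵥ spatialPart (J t)) with hN
  constructor
  · rintro ⟨h1, h2, h3⟩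
    have htr := congrArg (fun M => ((h t)⁻¹ * M).trace) h3
    simp only [Matrix.mul_add, Matrix.mul_sub, Matrix.mul_smul, Matrix.trace_add,
      Matrix.trace_sub, Matrix.trace_smul, smul_eq_mul, trace_inv_mul_vecMulVec, htr1, ← hN] at htr
    refine ⟨by linarith, h2, ?_⟩
    have hsc : 1 / 2 * scalarCurvature (typeIMetric h) p =
        (1 / 2) * (N - J t 0 ^ 2 + (4 - 3 * γ) * ρ t) := by linarith
    rw [hsc, spatialRicci] at h3
    ext i j
    have := congrFun (congrFun h3 i) j
    simp only [Matrix.sub_apply, Matrix.smul_apply, Matrix.add_apply, smul_eq_mul] at this ⊢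
    linarith
  · rintro ⟨h1, h2, h3⟩
    have hric : spatialRicci h t = vecMulVec (spatialPart (J t)) (spatialPart (J t))
        + ((2 - γ) / 2 * ρ t) • h t := by
      rw [spatialRicci, h3]; abel
    have htr := congrArg (fun M => ((h t)⁻¹ * M).trace) hric
    simp only [Matrix.mul_add, Matrix.mul_sub, Matrix.mul_smul, Matrix.trace_add,
      Matrix.trace_sub, Matrix.trace_smul, smul_eq_mul, trace_inv_mul_vecMulVec, htr1, ← hN] at htr
    refine ⟨by linarith, h2, ?_⟩
    have hsc : 1 / 2 * scalarCurvature (typeIMetric h) p =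
        (1 / 2) * (N - J t 0 ^ 2 + (4 - 3 * γ) * ρ t) := by linarith
    rw [hsc, hric]
    ext i j
    simp only [Matrix.sub_apply, Matrix.smul_apply, Matrix.add_apply, smul_eq_mul]
    ring

end Einstein

end JFormCosmology

namespace JFormCosmology

/-! ### The equations of the j-form and of the fluid. -/

section Matter

variable {h : SpatialMetric} {p : Pt} {γ : ℝ} {J : ℝ → Fin 4 → ℝ} {ρ : ℝ → ℝ}

lemma closed_typeI_iff : (∀ μ ν, pd μ (fun x => J (x 0) ν) p = pd ν (fun x => J (x 0) μ) p) ↔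
    ∀ i : Fin 3, deriv (fun s => J s i.succ) (p 0) = 0 := by
  have ht : ∀ ν, pd 0 (fun x => J (x 0) ν) p = deriv (fun s => J s ν) (p 0) := fun ν =>
    pd_time (fun s => J s ν) p
  have hs : ∀ (i : Fin 3) ν, pd i.succ (fun x => J (x 0) ν) p = 0 := fun i ν =>
    pd_space i (fun s => J s ν) p
  constructor
  · intro H i
    rw [← ht, H 0 i.succ, hs]
  · intro H μ ν
    refine Fin.cases ?_ (fun i => ?_) μ <;> refine Fin.cases ?_ (fun j => ?_) ν
    · rfl
    · rw [ht, hs, H]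
    · rw [ht, hs, H]
    · rw [hs, hs]

lemma divOneForm_typeI (hp : ∀ᶠ s in 𝓝 (p 0), (h s).PosDef) :
    divOneForm (typeIMetric h) (fun p => J (p 0)) p =
      -(deriv (fun s => J s 0) (p 0) + (mixedExpansion h (p 0)).trace * J (p 0) 0) := by
  have hu := hp.self_of_nhds.isUnit
  have ht : ∀ ν, pd 0 (fun x => J (x 0) ν) p = deriv (fun s => J s ν) (p 0) := fun ν =>
    pd_time (fun s => J s ν) p
  have hs : ∀ (i : Fin 3) ν, pd i.succ (fun x => J (x 0) ν) p = 0 := fun i ν =>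
    pd_space i (fun s => J s ν) p
  simp only [divOneForm, inv_typeIMetric hu, Fin.sum_univ_succ (n := 3),
    typeIMetric_zero_zero, typeIMetric_zero_succ, typeIMetric_succ_zero, typeIMetric_succ_succ,
    ht, hs, christoffel_typeI_time hu, christoffel_typeI_space hu,
    christoffel_typeI_time_zero_left hu, christoffel_typeI_space_zero_zero hu]
  rw [mixedExpansion, ← sum_sum_eq_trace_mul (expansion_transpose hp)]
  simp [Finset.sum_mul, mul_assoc, add_comm]

lemma divTwoTensor_fluid_space (hp : ∀ᶠ s in 𝓝 (p 0), (h s).PosDef) (k : Fin 3) :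
    divTwoTensor (typeIMetric h) (fluidTensor γ (typeIMetric h) comoving (fun p => ρ (p 0)))
      k.succ p = 0 := by
  have hu := hp.self_of_nhds.isUnit
  have hsucc : ∀ (x : Pt) (i : Fin 3), comoving x i.succ = 0 := by
    intro x i; fin_cases i <;> rfl
  have h1 : ∀ (i : Fin 3) x, fluidTensor γ (typeIMetric h) comoving (fun p => ρ (p 0)) x 0 i.succ
      = 0 := fun i x => by simp [fluidTensor, hsucc]
  have h2 : ∀ (i : Fin 3) x, fluidTensor γ (typeIMetric h) comoving (fun p => ρ (p 0)) x i.succ 0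
      = 0 := fun i x => by simp [fluidTensor, hsucc]
  have h3 : ∀ (i j l : Fin 3),
      pd l.succ (fun x => fluidTensor γ (typeIMetric h) comoving (fun p => ρ (p 0)) x i.succ j.succ)
        p = 0 := fun i j l =>
    pd_space l (fun s => fluidTensor γ (typeIMetric h) comoving (fun p => ρ (p 0)) (fun _ => s)
      i.succ j.succ) p
  simp only [divTwoTensor, inv_typeIMetric hu, Fin.sum_univ_succ (n := 3), h3, h1, h2, pd_const,
    typeIMetric_zero_zero, typeIMetric_zero_succ, typeIMetric_succ_zero, typeIMetric_succ_succ,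
    christoffel_typeI_time hu, christoffel_typeI_space hu,
    christoffel_typeI_time_zero_left hu, christoffel_typeI_space_zero_zero hu]
  simp

lemma divTwoTensor_fluid_time (hp : ∀ᶠ s in 𝓝 (p 0), (h s).PosDef) :
    divTwoTensor (typeIMetric h) (fluidTensor γ (typeIMetric h) comoving (fun p => ρ (p 0)))
      0 p = -(deriv ρ (p 0) + γ * (mixedExpansion h (p 0)).trace * ρ (p 0)) := by
  have hu := hp.self_of_nhds.isUnit
  have hsucc : ∀ (x : Pt) (i : Fin 3), comoving x i.succ = 0 := by
    intro x i; fin_cases i <;> rfl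
  have hzero : ∀ x : Pt, comoving x 0 = -1 := fun x => rfl
  have h1 : ∀ (i : Fin 3) x, fluidTensor γ (typeIMetric h) comoving (fun p => ρ (p 0)) x 0 i.succ
      = 0 := fun i x => by simp [fluidTensor, hsucc]
  have h2 : ∀ (i : Fin 3) x, fluidTensor γ (typeIMetric h) comoving (fun p => ρ (p 0)) x i.succ 0
      = 0 := fun i x => by simp [fluidTensor, hsucc]
  have h3 : ∀ x, fluidTensor γ (typeIMetric h) comoving (fun p => ρ (p 0)) x 0 0 = ρ (x 0) :=
    fun x => by simp [fluidTensor, hzero]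
  have h4 : ∀ (i j : Fin 3), fluidTensor γ (typeIMetric h) comoving (fun p => ρ (p 0)) p
      i.succ j.succ = (γ - 1) * ρ (p 0) * h (p 0) i j :=
    fun i j => by simp [fluidTensor, hsucc]
  have hsymm := PosDef.isSymm' hp.self_of_nhds
  have hT : ∑ i, ∑ j, (h (p 0))⁻¹ i j * (h (p 0) * mixedExpansion h (p 0)) i j =
      (mixedExpansion h (p 0)).trace := by
    have : h (p 0) * mixedExpansion h (p 0) = expansion h (p 0) := by
      rw [mixedExpansion, ← Matrix.mul_assoc,
        Matrix.mul_nonsing_inv _ ((Matrix.isUnit_iff_isUnit_det _).1 hu), Matrix.one_mul]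
    rw [this, sum_sum_eq_trace_mul (expansion_transpose hp), mixedExpansion]
  have hT' : ∑ i, ∑ j, (h (p 0))⁻¹ i j * expansion h (p 0) j i =
      (mixedExpansion h (p 0)).trace := by
    simp only [mixedExpansion, Matrix.trace, Matrix.diag_apply, Matrix.mul_apply]
  simp only [divTwoTensor, inv_typeIMetric hu, Fin.sum_univ_succ (n := 3), h1, h2, h3, h4, pd_const,
    typeIMetric_zero_zero, typeIMetric_zero_succ, typeIMetric_succ_zero, typeIMetric_succ_succ,
    christoffel_typeI_time hu, christoffel_typeI_space hu, pd_time,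
    christoffel_typeI_time_zero_left hu, christoffel_typeI_space_zero_zero hu,
    christoffel_typeI_mixed_right hu, christoffel_typeI_time_zero_right hu]
  have hfin : ∑ i, ∑ j, (h (p 0))⁻¹ i j * (0 - (expansion h (p 0) j i * ρ (p 0) + 0 * 0 +
      ∑ k, (0 * 0 + mixedExpansion h (p 0) k j * ((γ - 1) * ρ (p 0) * h (p 0) i k)))) =
      -(γ * (mixedExpansion h (p 0)).trace * ρ (p 0)) := by
    have e1 : ∀ i j, (h (p 0))⁻¹ i j * (0 - (expansion h (p 0) j i * ρ (p 0) + 0 * 0 +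
        ∑ k, (0 * 0 + mixedExpansion h (p 0) k j * ((γ - 1) * ρ (p 0) * h (p 0) i k)))) =
        -(ρ (p 0) * ((h (p 0))⁻¹ i j * expansion h (p 0) j i)) - (γ - 1) * ρ (p 0) *
          ((h (p 0))⁻¹ i j * (h (p 0) * mixedExpansion h (p 0)) i j) := by
      intro i j
      have : ∑ k, (0 * 0 + mixedExpansion h (p 0) k j * ((γ - 1) * ρ (p 0) * h (p 0) i k)) =
          (γ - 1) * ρ (p 0) * (h (p 0) * mixedExpansion h (p 0)) i j := by
        rw [Matrix.mul_apply, Finset.mul_sum]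
        exact Finset.sum_congr rfl fun k _ => by ring
      rw [this]; ring
    simp only [e1, Finset.sum_sub_distrib, Finset.sum_neg_distrib, ← Finset.mul_sum, hT, hT']
    ring
  simp only [zero_mul, zero_add, mul_zero, add_zero, Finset.sum_const_zero, zero_sub] at hfin ⊢
  rw [hfin]
  ring

end Matter

/-! ### Reduction of the field equations -/

lemma isOpen_slab {I : Set ℝ} (hI : IsOpen I) : IsOpen (slab I) :=
  hI.preimage (continuous_apply 0)

lemma contDiffOn_slab_iff {I : Set ℝ} (hI : IsOpen I) {n : ℕ∞ω} {f : ℝ → ℝ} :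
    ContDiffOn ℝ n (fun p : Pt => f (p 0)) (slab I) ↔ ∀ t ∈ I, ContDiffAt ℝ n f t := by
  constructor
  · intro H t ht
    have h1 : ContDiffAt ℝ n (fun p : Pt => f (p 0)) (fun _ => t) :=
      H.contDiffAt ((isOpen_slab hI).mem_nhds ht)
    have h2 : ContDiffAt ℝ n (fun s : ℝ => (fun _ => s : Pt)) t := by fun_prop
    exact ContDiffAt.comp (g := fun p : Pt => f (p 0)) t h1 h2
  · intro H p hp
    have h2 : ContDiffAt ℝ n (fun p : Pt => p 0) p := by fun_prop
    exact (ContDiffAt.comp p (H (p 0) hp) h2).contDiffWithinAt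

/-- After this equivalence four-dimensional tensors are needed only for the homothety and for
Killing fields. Openness of `I` makes regularity on the slab the same as regularity at each time. -/
theorem isTypeISolution_iff {γ : ℝ} {I : Set ℝ} (hI : IsOpen I) {h : SpatialMetric}
    {J : ℝ → Fin 4 → ℝ} {ρ : ℝ → ℝ} :
    IsTypeISolution γ I h J ρ ↔ ∀ t ∈ I, EvolutionAt γ h J ρ t := by
  constructor
  · rintro ⟨hpos, hf⟩ t ht
    have hp : ∀ᶠ s in 𝓝 t, (h s).PosDef := by
      filter_upwards [hI.mem_nhds ht] with s hs using hpos s hs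
    have hsm : ∀ i j, ContDiffAt ℝ 2 (fun s => h s i j) t := fun i j =>
      (contDiffOn_slab_iff hI).1 (hf.g_smooth i.succ j.succ) t ht
    have hJ : ∀ μ, ContDiffAt ℝ 1 (fun s => J s μ) t := fun μ =>
      (contDiffOn_slab_iff hI (f := fun s => J s μ)).1 (hf.J_smooth μ) t ht
    have hρ : ContDiffAt ℝ 1 ρ t := (contDiffOn_slab_iff hI).1 hf.ρ_smooth t ht
    have hmem : (fun _ => t : Pt) ∈ slab I := ht
    obtain ⟨h1, h2, h3⟩ := (einstein_typeI_iff (p := fun _ => t) hp hsm).1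
      (hf.einstein_eq _ hmem)
    have hcl := closed_typeI_iff.1 (hf.J_closed _ hmem)
    have hco := hf.J_coclosed _ hmem
    rw [divOneForm_typeI (p := fun _ => t) hp] at hco
    have hfl := hf.fluid_conserved _ hmem 0
    rw [divTwoTensor_fluid_time (p := fun _ => t) hp] at hfl
    refine ⟨hpos t ht, hsm, hJ, hρ, hf.ρ_nonneg _ hmem, h1, h2, ?_, fun i => ?_, ?_, ?_⟩
    · exact (hasMatDerivAt_expansion hsm).congr_deriv h3
    · rw [← hcl i]
      exact ((hJ i.succ).differentiableAt (by norm_num)).hasDerivAt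
    · exact ((hJ 0).differentiableAt (by norm_num)).hasDerivAt.congr_deriv (by linarith)
    · exact (hρ.differentiableAt (by norm_num)).hasDerivAt.congr_deriv (by linarith)
  · intro H
    have hp : ∀ t ∈ I, ∀ᶠ s in 𝓝 t, (h s).PosDef := fun t ht => by
      filter_upwards [hI.mem_nhds ht] with s hs using (H s hs).posDef
    refine ⟨fun t ht => (H t ht).posDef, ?_, ?_, ?_, ?_, ?_, ?_, ?_, ?_⟩
    · intro μ ν
      refine Fin.cases ?_ (fun i => ?_) μ <;> refine Fin.cases ?_ (fun j => ?_) ν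
      · exact contDiffOn_const (c := (-1 : ℝ))
      · exact contDiffOn_const (c := (0 : ℝ))
      · exact contDiffOn_const (c := (0 : ℝ))
      · exact (contDiffOn_slab_iff hI).2 fun t ht => (H t ht).h_smooth i j
    · exact fun μ => (contDiffOn_slab_iff hI (f := fun s => J s μ)).2
        fun t ht => (H t ht).J_smooth μ
    · exact (contDiffOn_slab_iff hI).2 fun t ht => (H t ht).ρ_smooth
    · exact fun p hpI => (H _ hpI).ρ_nonneg
    · intro p hpI
      have E := H _ hpI
      refine (einstein_typeI_iff (hp _ hpI) E.h_smooth).2 ⟨E.hamiltonian, E.momentum, ?_⟩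
      ext i j
      exact (E.evolution i j).deriv
    · exact fun p hpI => closed_typeI_iff.2 fun i => ((H _ hpI).J_space i).deriv
    · intro p hpI
      rw [divOneForm_typeI (hp _ hpI), (H _ hpI).J_time.deriv]
      ring
    · intro p hpI ν
      refine Fin.cases ?_ (fun i => ?_) ν
      · rw [divTwoTensor_fluid_time (hp _ hpI), (H _ hpI).density.deriv]
        ring
      · exact divTwoTensor_fluid_space (hp _ hpI) i

end JFormCosmology

namespace JFormCosmology

/-! ### Moments of the `j`-form with respect to the expansion tensor -/

/-- The vectors `Kⁿ J♯`, where `K` is the mixed expansion tensor. -/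
noncomputable def krylov (h : SpatialMetric) (J : ℝ → Fin 4 → ℝ) : ℕ → ℝ → Fin 3 → ℝ
  | 0, t => (h t)⁻¹ *ᵥ spatialPart (J t)
  | n + 1, t => mixedExpansion h t *ᵥ krylov h J n t

/-- The moments `J(Kⁿ J♯)`. -/
noncomputable def moment (h : SpatialMetric) (J : ℝ → Fin 4 → ℝ) (n : ℕ) (t : ℝ) : ℝ :=
  spatialPart (J t) ⬝ᵥ krylov h J n t

lemma vecMulVec_mulVec' (u v w : Fin 3 → ℝ) : vecMulVec u v *ᵥ w = (v ⬝ᵥ w) • u := by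
  ext i
  simp only [Matrix.mulVec, dotProduct, vecMulVec_apply, Pi.smul_apply, smul_eq_mul,
    Finset.sum_mul]
  exact Finset.sum_congr rfl fun k _ => by ring

namespace EvolutionAt

variable {γ : ℝ} {h : SpatialMetric} {J : ℝ → Fin 4 → ℝ} {ρ : ℝ → ℝ} {t : ℝ}

lemma isUnit_det (E : EvolutionAt γ h J ρ t) : IsUnit (h t).det :=
  (Matrix.isUnit_iff_isUnit_det _).1 E.posDef.isUnit

/-- The derivative of h⁻¹ contributes -2K², which cancels the term +2K² coming from the derivative
of θ. This cancellation is what keeps the equations of the moments simple. -/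
lemma hasMatDerivAt_mixed (E : EvolutionAt γ h J ρ t) :
    HasMatDerivAt (mixedExpansion h) (-(mixedExpansion h t).trace • mixedExpansion h t
      + vecMulVec (krylov h J 0 t) (spatialPart (J t)) + ((2 - γ) / 2 * ρ t) • 1) t := by
  refine ((hasMatDerivAt_inv_metric E.posDef E.h_smooth).mul E.evolution).congr_deriv ?_
  have h1 : mixedExpansion h t * (h t)⁻¹ * expansion h t =
      mixedExpansion h t * mixedExpansion h t := by rw [Matrix.mul_assoc]; rfl
  have h2 : (h t)⁻¹ * (expansion h t * mixedExpansion h t) =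
      mixedExpansion h t * mixedExpansion h t := by rw [← Matrix.mul_assoc]; rfl
  have h3 : (h t)⁻¹ * expansion h t = mixedExpansion h t := rfl
  rw [Matrix.neg_mul, Matrix.smul_mul, h1, Matrix.mul_add, Matrix.mul_add, Matrix.mul_sub,
    Matrix.mul_smul, Matrix.mul_smul, Matrix.mul_smul, h2, h3,
    Matrix.nonsing_inv_mul _ E.isUnit_det, Matrix.mul_vecMulVec, krylov, neg_smul]
  abel

lemma hasDerivAt_spatialPart (E : EvolutionAt γ h J ρ t) (i : Fin 3) :
    HasDerivAt (fun s => spatialPart (J s) i) ((0 : Fin 3 → ℝ) i) t := E.J_space i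

lemma hasDerivAt_krylov_zero (E : EvolutionAt γ h J ρ t) (i : Fin 3) :
    HasDerivAt (fun s => krylov h J 0 s i) (((-2 : ℝ) • krylov h J 1 t) i) t := by
  refine ((hasMatDerivAt_inv_metric E.posDef E.h_smooth).mulVec
    E.hasDerivAt_spatialPart i).congr_deriv ?_
  simp [krylov, Matrix.neg_mulVec, Matrix.smul_mulVec]

lemma hasDerivAt_krylov_succ (E : EvolutionAt γ h J ρ t) {n : ℕ} {u' : Fin 3 → ℝ}
    (hn : ∀ i, HasDerivAt (fun s => krylov h J n s i) (u' i) t) (i : Fin 3) :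
    HasDerivAt (fun s => krylov h J (n + 1) s i)
      ((-(mixedExpansion h t).trace • krylov h J (n + 1) t + moment h J n t • krylov h J 0 t
        + ((2 - γ) / 2 * ρ t) • krylov h J n t + mixedExpansion h t *ᵥ u') i) t := by
  refine (E.hasMatDerivAt_mixed.mulVec hn i).congr_deriv ?_
  simp only [Matrix.add_mulVec, Matrix.smul_mulVec, Matrix.one_mulVec, vecMulVec_mulVec']
  rfl

lemma hasDerivAt_krylov_one (E : EvolutionAt γ h J ρ t) (i : Fin 3) :
    HasDerivAt (fun s => krylov h J 1 s i)
      (((-2 : ℝ) • krylov h J 2 t - (mixedExpansion h t).trace • krylov h J 1 t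
        + (moment h J 0 t + (2 - γ) / 2 * ρ t) • krylov h J 0 t) i) t := by
  refine (E.hasDerivAt_krylov_succ E.hasDerivAt_krylov_zero i).congr_deriv ?_
  rw [Matrix.mulVec_smul, show mixedExpansion h t *ᵥ krylov h J 1 t = krylov h J 2 t from rfl]
  simp only [Pi.add_apply, Pi.sub_apply, Pi.smul_apply, smul_eq_mul]
  ring

lemma hasDerivAt_krylov_two (E : EvolutionAt γ h J ρ t) (i : Fin 3) :
    HasDerivAt (fun s => krylov h J 2 s i)
      (((-2 : ℝ) • krylov h J 3 t - (2 * (mixedExpansion h t).trace) • krylov h J 2 t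
        + (moment h J 0 t + (2 - γ) * ρ t) • krylov h J 1 t
        + moment h J 1 t • krylov h J 0 t) i) t := by
  refine (E.hasDerivAt_krylov_succ E.hasDerivAt_krylov_one i).congr_deriv ?_
  rw [Matrix.mulVec_add, Matrix.mulVec_sub, Matrix.mulVec_smul, Matrix.mulVec_smul,
    Matrix.mulVec_smul, show mixedExpansion h t *ᵥ krylov h J 2 t = krylov h J 3 t from rfl,
    show mixedExpansion h t *ᵥ krylov h J 1 t = krylov h J 2 t from rfl,
    show mixedExpansion h t *ᵥ krylov h J 0 t = krylov h J 1 t from rfl]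
  simp only [Pi.add_apply, Pi.sub_apply, Pi.smul_apply, smul_eq_mul]
  ring

lemma hasDerivAt_krylov_three (E : EvolutionAt γ h J ρ t) (i : Fin 3) :
    HasDerivAt (fun s => krylov h J 3 s i)
      (((-2 : ℝ) • krylov h J 4 t - (3 * (mixedExpansion h t).trace) • krylov h J 3 t
        + (moment h J 0 t + 3 * ((2 - γ) / 2) * ρ t) • krylov h J 2 t
        + moment h J 1 t • krylov h J 1 t + moment h J 2 t • krylov h J 0 t) i) t := by
  refine (E.hasDerivAt_krylov_succ E.hasDerivAt_krylov_two i).congr_deriv ?_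
  rw [Matrix.mulVec_add, Matrix.mulVec_add, Matrix.mulVec_sub, Matrix.mulVec_smul,
    Matrix.mulVec_smul, Matrix.mulVec_smul, Matrix.mulVec_smul,
    show mixedExpansion h t *ᵥ krylov h J 3 t = krylov h J 4 t from rfl,
    show mixedExpansion h t *ᵥ krylov h J 2 t = krylov h J 3 t from rfl,
    show mixedExpansion h t *ᵥ krylov h J 1 t = krylov h J 2 t from rfl,
    show mixedExpansion h t *ᵥ krylov h J 0 t = krylov h J 1 t from rfl]
  simp only [Pi.add_apply, Pi.sub_apply, Pi.smul_apply, smul_eq_mul]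
  ring

lemma hasDerivAt_moment (E : EvolutionAt γ h J ρ t) {n : ℕ} {u' : Fin 3 → ℝ}
    (hn : ∀ i, HasDerivAt (fun s => krylov h J n s i) (u' i) t) :
    HasDerivAt (moment h J n) (spatialPart (J t) ⬝ᵥ u') t := by
  refine (hasDerivAt_dotProduct E.hasDerivAt_spatialPart hn).congr_deriv ?_
  simp

lemma hasDerivAt_moment_zero (E : EvolutionAt γ h J ρ t) :
    HasDerivAt (moment h J 0) (-2 * moment h J 1 t) t :=
  (E.hasDerivAt_moment E.hasDerivAt_krylov_zero).congr_deriv (by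
    simp only [dotProduct_smul, smul_eq_mul]; rfl)

lemma hasDerivAt_moment_one (E : EvolutionAt γ h J ρ t) :
    HasDerivAt (moment h J 1) (-2 * moment h J 2 t - (mixedExpansion h t).trace * moment h J 1 t
      + (moment h J 0 t + (2 - γ) / 2 * ρ t) * moment h J 0 t) t :=
  (E.hasDerivAt_moment E.hasDerivAt_krylov_one).congr_deriv (by
    simp only [dotProduct_smul, dotProduct_add, dotProduct_sub, smul_eq_mul]; rfl)

lemma hasDerivAt_moment_two (E : EvolutionAt γ h J ρ t) :
    HasDerivAt (moment h J 2) (-2 * moment h J 3 t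
      - (2 * (mixedExpansion h t).trace) * moment h J 2 t
      + (moment h J 0 t + (2 - γ) * ρ t) * moment h J 1 t + moment h J 1 t * moment h J 0 t) t :=
  (E.hasDerivAt_moment E.hasDerivAt_krylov_two).congr_deriv (by
    simp only [dotProduct_smul, dotProduct_add, dotProduct_sub, smul_eq_mul]; rfl)

/-- Each moment is driven by the next one. The hierarchy stops here because the fourth moment is a
function of the lower ones and of `planeShear`, which the Hamiltonian constraint provides
(`RotatingOn.exists_frame_canonical`). -/
lemma hasDerivAt_moment_three (E : EvolutionAt γ h J ρ t) :
    HasDerivAt (moment h J 3) (-2 * moment h J 4 t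
      - (3 * (mixedExpansion h t).trace) * moment h J 3 t
      + (moment h J 0 t + 3 * ((2 - γ) / 2) * ρ t) * moment h J 2 t
      + moment h J 1 t * moment h J 1 t + moment h J 2 t * moment h J 0 t) t :=
  (E.hasDerivAt_moment E.hasDerivAt_krylov_three).congr_deriv (by
    simp only [dotProduct_smul, dotProduct_add, dotProduct_sub, smul_eq_mul]; rfl)

lemma hasDerivAt_trace (E : EvolutionAt γ h J ρ t) :
    HasDerivAt (fun s => (mixedExpansion h s).trace) (-(mixedExpansion h t).trace ^ 2
      + moment h J 0 t + 3 * ((2 - γ) / 2) * ρ t) t := by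
  refine E.hasMatDerivAt_mixed.trace.congr_deriv ?_
  have : (vecMulVec (krylov h J 0 t) (spatialPart (J t))).trace = moment h J 0 t := by
    rw [Matrix.trace_vecMulVec, dotProduct_comm]; rfl
  rw [Matrix.trace_add, Matrix.trace_add, Matrix.trace_smul, Matrix.trace_smul, Matrix.trace_one,
    this]
  simp
  ring

/-- The covector `θ(J♯, ·)` changes only in the direction of `J`, apart from dilution. -/
lemma hasDerivAt_expansion_krylov (E : EvolutionAt γ h J ρ t) (i : Fin 3) :
    HasDerivAt (fun s => (expansion h s *ᵥ krylov h J 0 s) i)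
      ((-(mixedExpansion h t).trace • (expansion h t *ᵥ krylov h J 0 t)
        + (moment h J 0 t + (2 - γ) / 2 * ρ t) • spatialPart (J t)) i) t := by
  refine (E.evolution.mulVec E.hasDerivAt_krylov_zero i).congr_deriv ?_
  have h1 : h t *ᵥ krylov h J 0 t = spatialPart (J t) := by
    rw [krylov, Matrix.mulVec_mulVec, Matrix.mul_nonsing_inv _ E.isUnit_det, Matrix.one_mulVec]
  have h2 : (expansion h t * mixedExpansion h t) *ᵥ krylov h J 0 t =
      expansion h t *ᵥ krylov h J 1 t := by rw [← Matrix.mulVec_mulVec]; rfl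
  simp only [Matrix.add_mulVec, Matrix.sub_mulVec, Matrix.smul_mulVec, vecMulVec_mulVec', h1, h2,
    Matrix.mulVec_smul]
  simp only [Pi.add_apply, Pi.sub_apply, Pi.smul_apply, smul_eq_mul, moment]
  ring

end EvolutionAt

end JFormCosmology

namespace JFormCosmology

/-! ### Orthonormal frames -/

lemma exists_frame {A : Matrix (Fin 3) (Fin 3) ℝ} (hA : A.PosDef) :
    ∃ E : Matrix (Fin 3) (Fin 3) ℝ, Eᵀ * A * E = 1 := by
  open scoped MatrixOrder in
  obtain ⟨B, hB⟩ := CStarAlgebra.nonneg_iff_eq_star_mul_self.mp hA.posSemidef.nonneg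
  rw [Matrix.star_eq_conjTranspose, Matrix.conjTranspose_eq_transpose_of_trivial] at hB
  have hdet : IsUnit B.det := by
    have h1 := ((Matrix.isUnit_iff_isUnit_det _).1 hA.isUnit).ne_zero
    rw [hB, Matrix.det_mul] at h1
    exact (right_ne_zero_of_mul h1).isUnit
  refine ⟨B⁻¹, ?_⟩
  rw [hB, Matrix.mul_assoc, Matrix.mul_assoc, Matrix.mul_nonsing_inv _ hdet, Matrix.mul_one,
    ← Matrix.transpose_mul, Matrix.mul_nonsing_inv _ hdet, Matrix.transpose_one]

section Frame

variable {h : SpatialMetric} {J : ℝ → Fin 4 → ℝ} {ρ : ℝ → ℝ} {t : ℝ}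
  {E : Matrix (Fin 3) (Fin 3) ℝ}

lemma IsOrthonormalFrame.isUnit (hE : IsOrthonormalFrame h t E) : IsUnit E := by
  rw [IsOrthonormalFrame] at hE
  exact ((Matrix.isUnit_iff_isUnit_det _).2 (Matrix.isUnit_det_of_left_inverse hE))

lemma IsOrthonormalFrame.inv_metric (hE : IsOrthonormalFrame h t E) : (h t)⁻¹ = E * Eᵀ := by
  rw [IsOrthonormalFrame] at hE
  apply Matrix.inv_eq_right_inv
  have h1 : Eᵀ * (h t * E) = 1 := by rw [← Matrix.mul_assoc, hE]
  rw [← Matrix.mul_assoc]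
  exact mul_eq_one_comm.1 h1

lemma IsOrthonormalFrame.mul (hE : IsOrthonormalFrame h t E) {Q : Matrix (Fin 3) (Fin 3) ℝ}
    (hQ : Qᵀ * Q = 1) : IsOrthonormalFrame h t (E * Q) := by
  rw [IsOrthonormalFrame] at hE ⊢
  calc (E * Q)ᵀ * h t * (E * Q) = Qᵀ * (Eᵀ * h t * E) * Q := by
        simp only [Matrix.transpose_mul, Matrix.mul_assoc]
    _ = 1 := by rw [hE, Matrix.mul_one, hQ]

/-- The expansion tensor in a frame. -/
noncomputable def frameExpansion (h : SpatialMetric) (t : ℝ) (E : Matrix (Fin 3) (Fin 3) ℝ) :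
    Matrix (Fin 3) (Fin 3) ℝ := Eᵀ * expansion h t * E

/-- The spatial `j`-form in a frame. -/
def frameForm (J : ℝ → Fin 4 → ℝ) (t : ℝ) (E : Matrix (Fin 3) (Fin 3) ℝ) : Fin 3 → ℝ :=
  Eᵀ *ᵥ spatialPart (J t)

lemma krylov_frame (hE : IsOrthonormalFrame h t E) (n : ℕ) :
    krylov h J n t = E *ᵥ ((frameExpansion h t E) ^ n *ᵥ frameForm J t E) := by
  induction n with
  | zero =>
    simp only [krylov, hE.inv_metric, pow_zero, Matrix.one_mulVec, frameForm, Matrix.mulVec_mulVec,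
      Matrix.one_mul]
  | succ n ih =>
    simp only [krylov, ih, mixedExpansion, hE.inv_metric, pow_succ', frameExpansion,
      Matrix.mulVec_mulVec, Matrix.mul_assoc]

/-- The left side knows nothing of the frame, so the moments are rotation invariants of expansion
and j-form. They are differentiable in time although the frames chosen at different times are
unrelated. -/
lemma moment_frame (hE : IsOrthonormalFrame h t E) (n : ℕ) :
    moment h J n t = frameForm J t E ⬝ᵥ ((frameExpansion h t E) ^ n *ᵥ frameForm J t E) := by
  rw [moment, krylov_frame hE, Matrix.dotProduct_mulVec, ← Matrix.mulVec_transpose]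
  rfl

lemma trace_mixed_frame (hE : IsOrthonormalFrame h t E) :
    (mixedExpansion h t).trace = (frameExpansion h t E).trace := by
  rw [mixedExpansion, hE.inv_metric, frameExpansion, Matrix.mul_assoc, Matrix.trace_mul_comm]

lemma trace_mixed_sq_frame (hE : IsOrthonormalFrame h t E) :
    (mixedExpansion h t * mixedExpansion h t).trace =
      (frameExpansion h t E * frameExpansion h t E).trace := by
  rw [mixedExpansion, hE.inv_metric, frameExpansion]
  calc (E * Eᵀ * expansion h t * (E * Eᵀ * expansion h t)).trace
      = (E * (Eᵀ * expansion h t * E * Eᵀ * expansion h t)).trace := by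
        simp only [Matrix.mul_assoc]
    _ = _ := by rw [Matrix.trace_mul_comm]; simp only [Matrix.mul_assoc]

lemma frameExpansion_transpose (hs : (expansion h t)ᵀ = expansion h t) :
    (frameExpansion h t E)ᵀ = frameExpansion h t E := by
  simp only [frameExpansion, Matrix.transpose_mul, Matrix.transpose_transpose, hs,
    Matrix.mul_assoc]

lemma hState_eq : hState h J ρ t E = ((hubble h t)⁻¹ • frameExpansion h t E - 1,
    (Real.sqrt 6 * hubble h t)⁻¹ • frameForm J t E, J t 0 / (Real.sqrt 6 * hubble h t),
    ρ t / (3 * hubble h t ^ 2)) := by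
  refine Prod.ext ?_ (Prod.ext ?_ rfl)
  · simp only [hState, frameExpansion, expansion, Matrix.mul_smul, Matrix.smul_mul]
  · ext a
    simp only [hState, frameForm, Matrix.mulVec, dotProduct, Matrix.transpose_apply, spatialPart,
      Pi.smul_apply, smul_eq_mul]
    rw [div_eq_inv_mul]

/-- Rotation of a state. -/
def HState.rotate (Q : Matrix (Fin 3) (Fin 3) ℝ) (x : HState) : HState :=
  (Qᵀ * x.1 * Q, Qᵀ *ᵥ x.2.1, x.2.2)

lemma hState_mul {Q : Matrix (Fin 3) (Fin 3) ℝ} (hQ : Qᵀ * Q = 1) :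
    hState h J ρ t (E * Q) = HState.rotate Q (hState h J ρ t E) := by
  rw [hState_eq, hState_eq, HState.rotate]
  refine Prod.ext ?_ (Prod.ext ?_ rfl)
  · simp only [frameExpansion, Matrix.transpose_mul, Matrix.mul_sub, Matrix.sub_mul,
      Matrix.mul_one, hQ, Matrix.mul_smul, Matrix.smul_mul, Matrix.mul_assoc]
  · simp only [frameForm, Matrix.transpose_mul, Matrix.mulVec_smul, Matrix.mulVec_mulVec]

end Frame

/-! ### Adapted frames -/

/-- The state in a frame adapted to the `j`-form and to its rotation. -/
def canonState (s b v w r Ω : ℝ) : HState :=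
  (!![s, 0, w; 0, b, r; w, r, -s - b], ![v, 0, 0], 0, Ω)

lemma mul_mul_transpose_apply (R A : Matrix (Fin 3) (Fin 3) ℝ) (i j : Fin 3) :
    (R * A * Rᵀ) i j = R i ⬝ᵥ (A *ᵥ R j) := by
  rw [Matrix.mul_apply, Matrix.dotProduct_mulVec]
  rfl

/-- The axes are n along V, e along V × SV, and f = e × n. Since e is orthogonal to SV, the entry
between n and e vanishes; the entry between n and f is |V × SV| / |V|², hence positive. -/
lemma exists_adapted_rotation {S : Matrix (Fin 3) (Fin 3) ℝ} {V : Fin 3 → ℝ} (hS : Sᵀ = S)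
    (hc : crossProduct V (S *ᵥ V) ≠ 0) :
    ∃ Q : Matrix (Fin 3) (Fin 3) ℝ, Qᵀ * Q = 1 ∧ ∃ v w s b c r : ℝ, 0 < v ∧ 0 < w ∧
      Qᵀ *ᵥ V = ![v, 0, 0] ∧ Qᵀ * S * Q = !![s, 0, w; 0, b, r; w, r, c] := by
  have hV : V ≠ 0 := by rintro rfl; simp at hc
  have hsymm : ∀ x y : Fin 3 → ℝ, x ⬝ᵥ (S *ᵥ y) = y ⬝ᵥ (S *ᵥ x) := fun x y => by
    rw [Matrix.dotProduct_mulVec, ← Matrix.mulVec_transpose, hS, dotProduct_comm]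
  have hpos : ∀ x : Fin 3 → ℝ, x ≠ 0 → 0 < x ⬝ᵥ x := fun x hx => by
    have := Matrix.dotProduct_star_self_pos_iff.2 hx
    simpa using this
  set v := Real.sqrt (V ⬝ᵥ V) with hv
  have hvpos : 0 < v := Real.sqrt_pos.2 (hpos V hV)
  have hvv : v * v = V ⬝ᵥ V := Real.mul_self_sqrt (hpos V hV).le
  set y := crossProduct V (S *ᵥ V) with hy
  set m := Real.sqrt (y ⬝ᵥ y) with hm
  have hmpos : 0 < m := Real.sqrt_pos.2 (hpos y hc)
  have hmm : m * m = y ⬝ᵥ y := Real.mul_self_sqrt (hpos y hc).le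
  set n := v⁻¹ • V with hn
  set e := m⁻¹ • y with he
  have hVn : V = v • n := by rw [hn, smul_smul, mul_inv_cancel₀ hvpos.ne', one_smul]
  have hye : y = m • e := by rw [he, smul_smul, mul_inv_cancel₀ hmpos.ne', one_smul]
  have hnn : n ⬝ᵥ n = 1 := by
    rw [hn, dotProduct_smul, smul_dotProduct, ← hvv]
    simp only [smul_eq_mul]; field_simp
  have hee : e ⬝ᵥ e = 1 := by
    rw [he, dotProduct_smul, smul_dotProduct, ← hmm]
    simp only [smul_eq_mul]; field_simp
  have hne : n ⬝ᵥ e = 0 := by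
    rw [hn, he, dotProduct_smul, smul_dotProduct, hy, dot_self_cross]; simp
  have heS : e ⬝ᵥ (S *ᵥ n) = 0 := by
    rw [hn, he, Matrix.mulVec_smul, dotProduct_smul, smul_dotProduct, hy, dotProduct_comm,
      dot_cross_self]; simp
  set f := crossProduct e n with hf
  have hff : f ⬝ᵥ f = 1 := by
    rw [hf, cross_dot_cross, hee, hnn, dotProduct_comm e n, hne]; ring
  have hnf : n ⬝ᵥ f = 0 := by rw [hf, dot_cross_self]
  have hef : e ⬝ᵥ f = 0 := by rw [hf, dot_self_cross]
  have hfS : f ⬝ᵥ (S *ᵥ n) = m / v ^ 2 := by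
    have h1 : crossProduct n (S *ᵥ n) = (m / v ^ 2) • e := by
      have : y = (v * v) • crossProduct n (S *ᵥ n) := by
        rw [hy, hVn, Matrix.mulVec_smul, LinearMap.map_smul, LinearMap.map_smul₂, smul_smul]
      rw [hye] at this
      rw [div_eq_inv_mul, ← smul_smul, this, smul_smul, ← pow_two,
        inv_mul_cancel₀ (pow_pos hvpos 2).ne', one_smul]
    rw [hf, dotProduct_comm, triple_product_permutation, h1, dotProduct_smul, hee]
    simp
  have h0 : Matrix.of ![n, e, f] 0 = n := rfl
  have h1 : Matrix.of ![n, e, f] 1 = e := rfl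
  have h2 : Matrix.of ![n, e, f] 2 = f := rfl
  refine ⟨(Matrix.of ![n, e, f])ᵀ, ?_, v, m / v ^ 2, n ⬝ᵥ (S *ᵥ n), e ⬝ᵥ (S *ᵥ e),
    f ⬝ᵥ (S *ᵥ f), e ⬝ᵥ (S *ᵥ f), hvpos, by positivity, ?_, ?_⟩
  · have := mul_mul_transpose_apply (Matrix.of ![n, e, f]) 1
    rw [Matrix.mul_one] at this
    rw [Matrix.transpose_transpose]
    ext i j
    rw [this]
    fin_cases i <;> fin_cases j <;>
      simp [h0, h1, h2, hnn, hee, hff, hne, hnf, hef, dotProduct_comm e n, dotProduct_comm f n,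
        dotProduct_comm f e]
  · ext i
    rw [Matrix.transpose_transpose]
    change (Matrix.of ![n, e, f]) i ⬝ᵥ V = _
    rw [hVn, dotProduct_smul]
    fin_cases i <;> simp [h0, h1, h2, hnn, dotProduct_comm e n, dotProduct_comm f n, hne, hnf]
  · ext i j
    rw [Matrix.transpose_transpose, mul_mul_transpose_apply]
    fin_cases i <;> fin_cases j <;>
      simp [h0, h1, h2, heS, hfS, hsymm n e, hsymm n f, hsymm f e]

end JFormCosmology

namespace JFormCosmology

/-! ### Persistence of rotation -/

/-- The solution of a scalar linear differential equation. -/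
lemma linear_ode_eq_exp {I : Set ℝ} (hI : IsOpen I) (hc : I.OrdConnected) {y g : ℝ → ℝ}
    (hg : ContinuousOn g I) (hy : ∀ t ∈ I, HasDerivAt y (g t * y t) t) {t₁ : ℝ} (ht₁ : t₁ ∈ I) :
    ∀ t ∈ I, y t = y t₁ * Real.exp (∫ s in t₁..t, g s) := by
  have hG : ∀ t ∈ I, HasDerivAt (fun u => ∫ s in t₁..u, g s) (g t) t := by
    intro t ht
    have hsub : Set.uIcc t₁ t ⊆ I := hc.uIcc_subset ht₁ ht
    refine intervalIntegral.integral_hasDerivAt_right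
      (ContinuousOn.intervalIntegrable (hg.mono hsub)) ?_ (hg.continuousAt (hI.mem_nhds ht))
    exact hg.stronglyMeasurableAtFilter hI t ht
  have hd : ∀ t ∈ I, HasDerivAt (fun u => y u * Real.exp (-∫ s in t₁..u, g s)) 0 t := by
    intro t ht
    refine ((hy t ht).mul (hG t ht).neg.exp).congr_deriv ?_
    ring
  intro t ht
  have hpre : IsPreconnected I := hc.isPreconnected
  have hconst := hI.is_const_of_deriv_eq_zero hpre
    (fun u hu => (hd u hu).differentiableAt.differentiableWithinAt)
    (fun u hu => (hd u hu).deriv) ht ht₁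
  simp only [intervalIntegral.integral_same, neg_zero, Real.exp_zero, mul_one] at hconst
  rw [← hconst, mul_assoc, ← Real.exp_add]
  simp

lemma cross_ne_zero_iff {v w : Fin 3 → ℝ} :
    crossProduct v w ≠ 0 ↔ v ≠ 0 ∧ ∀ c : ℝ, w ≠ c • v := by
  constructor
  · intro hc
    refine ⟨?_, ?_⟩
    · rintro rfl; simp at hc
    · rintro c rfl; simp at hc
  · rintro ⟨hv, hw⟩ hc
    rw [cross_apply] at hc
    have h0 := congrFun hc 0
    have h1 := congrFun hc 1
    have h2 := congrFun hc 2
    simp at h0 h1 h2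
    obtain ⟨i, hi⟩ := Function.ne_iff.1 hv
    refine hw (w i / v i) ?_
    simp only [Pi.zero_apply] at hi
    ext j
    simp only [Pi.smul_apply, smul_eq_mul]
    rw [div_mul_eq_mul_div, eq_div_iff hi]
    fin_cases i <;> fin_cases j <;> simp <;> linarith

lemma isRotating_iff_cross {x : HState} :
    IsRotating x ↔ 0 < x.2.2.2 ∧ crossProduct x.2.1 (x.1 *ᵥ x.2.1) ≠ 0 := by
  rw [IsRotating, cross_ne_zero_iff]

/-- The rotation of the `j`-form: the cross product of `J` and `θ(J♯, ·)`. -/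
noncomputable def twist (h : SpatialMetric) (J : ℝ → Fin 4 → ℝ) (t : ℝ) : Fin 3 → ℝ :=
  crossProduct (spatialPart (J t)) (expansion h t *ᵥ krylov h J 0 t)

section

variable {γ : ℝ} {h : SpatialMetric} {J : ℝ → Fin 4 → ℝ} {ρ : ℝ → ℝ} {t : ℝ} {I : Set ℝ}

/-- S is θ/H minus the identity, so S and θ have the same eigenvectors, and the invertible map Eᵀ
carries the coordinate covectors J and θ(J♯) to their frame components. Being parallel can therefore
be tested in coordinates, with no frame. -/
lemma isRotating_hState_iff {E : Matrix (Fin 3) (Fin 3) ℝ} (hE : IsOrthonormalFrame h t E)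
    (hH : hubble h t ≠ 0) : IsRotating (hState h J ρ t E) ↔ 0 < ρ t ∧ twist h J t ≠ 0 := by
  have hET : IsUnit Eᵀ := (Matrix.isUnit_transpose E).2 hE.isUnit
  have hinj : Function.Injective (Eᵀ *ᵥ ·) := Matrix.mulVec_injective_iff_isUnit.2 hET
  have hM : frameExpansion h t E *ᵥ frameForm J t E =
      Eᵀ *ᵥ (expansion h t *ᵥ krylov h J 0 t) := by
    rw [krylov, hE.inv_metric, frameExpansion, frameForm]
    simp only [Matrix.mulVec_mulVec, Matrix.mul_assoc]
  set H := hubble h t with hHdef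
  have h6 : Real.sqrt 6 * H ≠ 0 := mul_ne_zero (by positivity) hH
  rw [hState_eq, IsRotating, twist, cross_ne_zero_iff]
  refine and_congr ?_ (and_congr ?_ ?_)
  · have : (0 : ℝ) < 3 * H ^ 2 := by positivity
    simp only
    constructor
    · intro h0
      by_contra hneg
      exact absurd h0 (not_lt.2 (div_nonpos_of_nonpos_of_nonneg (not_lt.1 hneg) this.le))
    · intro h0; positivity
  · have h0 : frameForm J t E = 0 ↔ spatialPart (J t) = 0 := by
      rw [frameForm]
      exact ⟨fun h0 => hinj (by simpa using h0), fun h0 => by rw [h0, Matrix.mulVec_zero]⟩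
    simp only [ne_eq, smul_eq_zero, inv_eq_zero, ← hHdef, h6, false_or, h0]
  · simp only [← hHdef, Matrix.sub_mulVec, Matrix.one_mulVec, Matrix.smul_mulVec,
      Matrix.mulVec_smul, hM]
    constructor
    · intro hc c heq
      apply hc (H⁻¹ * c - 1)
      rw [heq, Matrix.mulVec_smul, frameForm]
      module
    · intro hc c heq
      apply hc (H * (c + 1))
      apply hinj
      change Eᵀ *ᵥ _ = Eᵀ *ᵥ _
      rw [smul_comm c] at heq
      have h2 := sub_eq_iff_eq_add.1 (smul_right_injective (Fin 3 → ℝ) (inv_ne_zero h6) heq)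
      have h3 := congrArg (fun x => H • x) h2
      simp only [smul_smul, mul_inv_cancel₀ hH, one_smul] at h3
      rw [h3, Matrix.mulVec_smul, frameForm]
      module

lemma EvolutionAt.moment_zero_pos (E : EvolutionAt γ h J ρ t) (hJ : spatialPart (J t) ≠ 0) :
    0 < moment h J 0 t := by
  have := E.posDef.inv.dotProduct_mulVec_pos hJ
  simpa [moment, krylov] using this

lemma trace_mul_self_nonneg {A : Matrix (Fin 3) (Fin 3) ℝ} (hA : Aᵀ = A) : 0 ≤ (A * A).trace := by
  rw [← sum_sum_eq_trace_mul hA]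
  exact Finset.sum_nonneg fun i _ => Finset.sum_nonneg fun j _ => mul_self_nonneg _

lemma eventually_posDef (hI : IsOpen I) (hsol : ∀ t ∈ I, EvolutionAt γ h J ρ t) (ht : t ∈ I) :
    ∀ᶠ s in 𝓝 t, (h s).PosDef := by
  filter_upwards [hI.mem_nhds ht] with s hs using (hsol s hs).posDef

lemma trace_mixed_sq_nonneg (hI : IsOpen I) (hsol : ∀ t ∈ I, EvolutionAt γ h J ρ t) (ht : t ∈ I) :
    0 ≤ (mixedExpansion h t * mixedExpansion h t).trace := by
  obtain ⟨E, hE⟩ := exists_frame (hsol t ht).posDef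
  rw [trace_mixed_sq_frame (E := E) hE]
  exact trace_mul_self_nonneg
    (frameExpansion_transpose (expansion_transpose (eventually_posDef hI hsol ht)))

/-- The properties at all times of an expanding type I solution with a rotating vector. -/
structure RotatingOn (γ : ℝ) (I : Set ℝ) (h : SpatialMetric) (J : ℝ → Fin 4 → ℝ)
    (ρ : ℝ → ℝ) : Prop where
  evolution : ∀ t ∈ I, EvolutionAt γ h J ρ t
  hubble_pos : ∀ t ∈ I, 0 < hubble h t
  temporal : ∀ t ∈ I, J t 0 = 0
  density_pos : ∀ t ∈ I, 0 < ρ t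
  twist_ne : ∀ t ∈ I, twist h J t ≠ 0

lemma spatialPart_ne_zero_of_twist (ht : twist h J t ≠ 0) : spatialPart (J t) ≠ 0 :=
  (cross_ne_zero_iff.1 ht).1

/-- Nonvanishing of ρ and of the twist spreads from one time to all times by homogeneous linear
equations, and positivity of H by the intermediate value theorem. -/
theorem IsRotatingSolution.rotatingOn (hI : IsOpen I) (hc : I.OrdConnected)
    (hr : IsRotatingSolution γ I h J ρ) : RotatingOn γ I h J ρ := by
  have hsol := (isTypeISolution_iff hI).1 hr.solution
  obtain ⟨t₁, ht₁, hH₁, E₁, hE₁, hrot⟩ := hr.rotating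
  obtain ⟨hρ₁, htw₁⟩ := (isRotating_hState_iff hE₁ hH₁.ne').1 hrot
  have hpre : IsPreconnected I := hc.isPreconnected
  have hT : ContinuousOn (fun s => (mixedExpansion h s).trace) I := fun t ht =>
    (hsol t ht).hasDerivAt_trace.continuousAt.continuousWithinAt
  have hJ : ∀ t ∈ I, spatialPart (J t) = spatialPart (J t₁) := by
    intro t ht
    ext i
    exact hI.is_const_of_deriv_eq_zero hpre
      (fun u hu => ((hsol u hu).J_space i).differentiableAt.differentiableWithinAt)
      (fun u hu => ((hsol u hu).J_space i).deriv) ht ht₁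
  have hJne := spatialPart_ne_zero_of_twist htw₁
  have hJ0 : ∀ t ∈ I, J t 0 = 0 := by
    intro t ht
    obtain ⟨i, hi⟩ := Function.ne_iff.1 hJne
    have := (hsol t ht).momentum i
    have hi' : J t i.succ ≠ 0 := by
      have := congrFun (hJ t ht) i
      rw [show J t i.succ = spatialPart (J t) i from rfl, this]; exact hi
    exact (mul_eq_zero.1 this).resolve_right hi'
  -- At zero expansion the left side of the Hamiltonian constraint is -tr K² ≤ 0, while the right
  -- side contains the positive square of J.
  have hTne : ∀ t ∈ I, (mixedExpansion h t).trace ≠ 0 := by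
    intro t ht h0
    have hham := (hsol t ht).hamiltonian
    have h1 := (hsol t ht).moment_zero_pos (by rw [hJ t ht]; exact hJne)
    have h2 := trace_mixed_sq_nonneg hI hsol ht
    have h3 := (hsol t ht).ρ_nonneg
    rw [h0] at hham
    have h4 : moment h J 0 t = spatialPart (J t) ⬝ᵥ ((h t)⁻¹ *ᵥ spatialPart (J t)) := rfl
    rw [← h4] at hham
    nlinarith [sq_nonneg (J t 0)]
  refine ⟨hsol, fun t ht => ?_, hJ0, fun t ht => ?_, fun t ht h0 => ?_⟩
  · have h1 : 0 < (mixedExpansion h t).trace := by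
      by_contra hneg
      have h0 : (0 : ℝ) ∈ (fun s => (mixedExpansion h s).trace) '' I := by
        refine hpre.intermediate_value ht ht₁ hT ⟨not_lt.1 hneg, ?_⟩
        simp only [trace_mixedExpansion]; linarith
      obtain ⟨u, hu, hu0⟩ := h0
      exact hTne u hu hu0
    rw [trace_mixedExpansion] at h1
    linarith
  · have := linear_ode_eq_exp hI hc (g := fun s => -(γ * (mixedExpansion h s).trace)) (y := ρ)
      (hT.const_smul γ).neg (fun t ht => (hsol t ht).density.congr_deriv (by ring)) ht₁ t ht
    rw [this]; positivity
  · apply htw₁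
    -- The part of the derivative of θ(J♯) along J drops out of the antisymmetrized product, leaving
    -- y' = -(tr K) y. Solving from `t` to `t₁` shows that a zero at `t` would be a zero at `t₁`.
    have hy : ∀ i j : Fin 3, spatialPart (J t₁) i * (expansion h t₁ *ᵥ krylov h J 0 t₁) j
        - spatialPart (J t₁) j * (expansion h t₁ *ᵥ krylov h J 0 t₁) i =
        (spatialPart (J t) i * (expansion h t *ᵥ krylov h J 0 t) j
          - spatialPart (J t) j * (expansion h t *ᵥ krylov h J 0 t) i) *
          Real.exp (∫ s in t..t₁, -(mixedExpansion h s).trace) := by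
      intro i j
      refine linear_ode_eq_exp hI hc (g := fun s => -(mixedExpansion h s).trace)
        (y := fun t => spatialPart (J t) i * (expansion h t *ᵥ krylov h J 0 t) j
          - spatialPart (J t) j * (expansion h t *ᵥ krylov h J 0 t) i)
        hT.neg (fun t ht => ?_) ht t₁ ht₁
      have E := hsol t ht
      refine (((E.hasDerivAt_spatialPart i).mul (E.hasDerivAt_expansion_krylov j)).sub
        ((E.hasDerivAt_spatialPart j).mul (E.hasDerivAt_expansion_krylov i))).congr_deriv ?_
      simp only [Pi.add_apply, Pi.smul_apply, Pi.zero_apply, smul_eq_mul]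
      ring
    rw [twist, cross_apply] at h0 ⊢
    have e0 := congrFun h0 0
    have e1 := congrFun h0 1
    have e2 := congrFun h0 2
    simp only [Matrix.cons_val_zero, Matrix.cons_val_one, Matrix.cons_val, Pi.zero_apply] at e0 e1 e2
    ext i
    fin_cases i
    · simpa [e0] using hy 1 2
    · simpa [e1] using hy 2 0
    · simpa [e2] using hy 0 1

end

end JFormCosmology

namespace JFormCosmology

/-! ### The reduced dynamical system -/

section Scalars

variable (h : SpatialMetric) (J : ℝ → Fin 4 → ℝ) (ρ : ℝ → ℝ) (t : ℝ)

/-- Expansion along the `j`-form. -/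
noncomputable def axialRate : ℝ := moment h J 1 t / moment h J 0 t

/-- Square of the expansion component that rotates the `j`-form. -/
noncomputable def twistRate : ℝ := moment h J 2 t / moment h J 0 t - axialRate h J t ^ 2

/-- Expansion along the direction in which the `j`-form rotates. -/
noncomputable def transverseRate : ℝ :=
  (moment h J 3 t / moment h J 0 t - axialRate h J t ^ 3
    - 2 * axialRate h J t * twistRate h J t) / twistRate h J t

noncomputable def axialShear : ℝ := axialRate h J t / hubble h t - 1

noncomputable def transverseShear : ℝ := transverseRate h J t / hubble h t - 1

noncomputable def normalShear : ℝ := -axialShear h J t - transverseShear h J t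

noncomputable def formEnergy : ℝ := moment h J 0 t / (6 * hubble h t ^ 2)

/-- This is the square of the entry `w` of the canonical state, as `formEnergy` is the square of
`v`. Squares are the invariants: the sign of an entry depends on the frame. -/
noncomputable def twistShear : ℝ := twistRate h J t / hubble h t ^ 2

noncomputable def densityParam : ℝ := ρ t / (3 * hubble h t ^ 2)

end Scalars

section Canonical

variable {A B C W R j : ℝ}

/-- Read backwards, the moments 0 to 3 determine j², A, W² and C, and the moment 4 determines R². B
does not occur and is fixed by the trace. -/
lemma canonical_moments (a : Matrix (Fin 3) (Fin 3) ℝ) (ha : a = !![A, 0, W; 0, B, R; W, R, C])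
    (u : Fin 3 → ℝ) (hu : u = ![j, 0, 0]) :
    u ⬝ᵥ (a ^ 0 *ᵥ u) = j ^ 2 ∧ u ⬝ᵥ (a ^ 1 *ᵥ u) = j ^ 2 * A ∧
    u ⬝ᵥ (a ^ 2 *ᵥ u) = j ^ 2 * (A ^ 2 + W ^ 2) ∧
    u ⬝ᵥ (a ^ 3 *ᵥ u) = j ^ 2 * (A ^ 3 + 2 * A * W ^ 2 + W ^ 2 * C) ∧
    u ⬝ᵥ (a ^ 4 *ᵥ u) = j ^ 2 * ((A ^ 2 + W ^ 2) ^ 2 + W ^ 2 * (A + C) ^ 2 + W ^ 2 * R ^ 2) := by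
  subst ha hu
  have h1 : !![A, 0, W; 0, B, R; W, R, C] *ᵥ ![j, 0, 0] = ![j * A, 0, j * W] := by
    ext i; fin_cases i <;> simp [Matrix.mulVec, dotProduct, Fin.sum_univ_three] <;> ring
  have h2 : !![A, 0, W; 0, B, R; W, R, C] *ᵥ ![j * A, 0, j * W] =
      ![j * (A ^ 2 + W ^ 2), j * (W * R), j * (W * (A + C))] := by
    ext i; fin_cases i <;> simp [Matrix.mulVec, dotProduct, Fin.sum_univ_three] <;> ring
  have h3 : !![A, 0, W; 0, B, R; W, R, C] *ᵥ
        ![j * (A ^ 2 + W ^ 2), j * (W * R), j * (W * (A + C))] =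
      ![j * (A ^ 3 + 2 * A * W ^ 2 + W ^ 2 * C), j * (W * R * (A + B + C)),
        j * (W * (A ^ 2 + W ^ 2) + W * R ^ 2 + W * C * (A + C))] := by
    ext i; fin_cases i <;> simp [Matrix.mulVec, dotProduct, Fin.sum_univ_three] <;> ring
  refine ⟨?_, ?_, ?_, ?_, ?_⟩
  · simp [dotProduct, Fin.sum_univ_three]; ring
  · rw [pow_one, h1]; simp [dotProduct, Fin.sum_univ_three]; ring
  · rw [pow_two, ← Matrix.mulVec_mulVec, h1, h2]; simp [dotProduct, Fin.sum_univ_three]; ring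
  · rw [pow_succ, pow_two, ← Matrix.mulVec_mulVec, ← Matrix.mulVec_mulVec, h1, h2, h3]
    simp [dotProduct, Fin.sum_univ_three]; ring
  · rw [pow_succ, pow_succ, pow_two, ← Matrix.mulVec_mulVec, ← Matrix.mulVec_mulVec,
      ← Matrix.mulVec_mulVec, h1, h2, h3]
    simp [Matrix.mulVec, dotProduct, Fin.sum_univ_three]; ring

end Canonical

variable {γ : ℝ} {h : SpatialMetric} {J : ℝ → Fin 4 → ℝ} {ρ : ℝ → ℝ} {t : ℝ} {I : Set ℝ}

/-- The scalars in an orthonormal frame in which the state is canonical. -/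
lemma scalars_of_canonical {E : Matrix (Fin 3) (Fin 3) ℝ} (hE : IsOrthonormalFrame h t E)
    (hH : hubble h t ≠ 0) {s b v w r Ω : ℝ} (hv : v ≠ 0) (hw : w ≠ 0)
    (hc : hState h J ρ t E = canonState s b v w r Ω) :
    axialShear h J t = s ∧ normalShear h J t = b ∧ formEnergy h J t = v ^ 2 ∧
      twistShear h J t = w ^ 2 ∧ densityParam h ρ t = Ω ∧
      (mixedExpansion h t * mixedExpansion h t).trace = hubble h t ^ 2 *
        (3 + s ^ 2 + b ^ 2 + (s + b) ^ 2 + 2 * w ^ 2 + 2 * r ^ 2) ∧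
      moment h J 4 t / moment h J 0 t = (axialRate h J t ^ 2 + twistRate h J t) ^ 2
        + twistRate h J t * (axialRate h J t + transverseRate h J t) ^ 2
        + twistRate h J t * (hubble h t ^ 2 * r ^ 2) := by
  rw [hState_eq, canonState] at hc
  set H := hubble h t with hHdef
  have h6 : Real.sqrt 6 * H ≠ 0 := mul_ne_zero (by positivity) hH
  have hsq : Real.sqrt 6 ^ 2 = 6 := Real.sq_sqrt (by norm_num)
  have hS := congrArg Prod.fst hc
  have hV := congrArg (fun x => x.2.1) hc
  have hO := congrArg (fun x => x.2.2.2) hc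
  simp only at hS hV hO
  have ha : frameExpansion h t E = !![H * (1 + s), 0, H * w; 0, H * (1 + b), H * r;
      H * w, H * r, H * (1 - s - b)] := by
    have h1 : frameExpansion h t E = H • (!![s, 0, w; 0, b, r; w, r, -s - b] + 1) := by
      rw [← hS, sub_add_cancel, smul_smul, mul_inv_cancel₀ hH, one_smul]
    rw [h1]
    ext i j
    fin_cases i <;> fin_cases j <;> simp [Matrix.one_apply, hH] <;> ring
  have hj : frameForm J t E = ![Real.sqrt 6 * H * v, 0, 0] := by
    have h1 : frameForm J t E = (Real.sqrt 6 * H) • ![v, 0, 0] := by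
      rw [← hV, smul_smul, mul_inv_cancel₀ h6, one_smul]
    rw [h1]
    ext i; fin_cases i <;> simp
  obtain ⟨m0, m1, m2, m3, m4⟩ := canonical_moments _ ha _ hj
  simp only [← moment_frame hE] at m0 m1 m2 m3 m4
  have hk0 : moment h J 0 t ≠ 0 := by rw [m0]; exact pow_ne_zero _ (mul_ne_zero h6 hv)
  have hA : axialRate h J t = H * (1 + s) := by
    rw [axialRate, m1, ← m0]; field_simp
  have hW : twistRate h J t = (H * w) ^ 2 := by
    rw [twistRate, hA, m2, ← m0]; field_simp; ring
  have hC : transverseRate h J t = H * (1 - s - b) := by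
    rw [transverseRate, hA, hW, m3, ← m0]; field_simp; ring
  have hs : axialShear h J t = s := by rw [axialShear, hA, ← hHdef]; field_simp; ring
  have hc' : transverseShear h J t = -s - b := by
    rw [transverseShear, hC, ← hHdef]; field_simp; ring
  refine ⟨hs, ?_, ?_, ?_, ?_, ?_, ?_⟩
  · rw [normalShear, hs, hc']; ring
  · rw [formEnergy, m0, ← hHdef, mul_pow, mul_pow, hsq]; field_simp
  · rw [twistShear, hW, ← hHdef]; field_simp
  · rw [densityParam, ← hHdef, hO]
  · rw [trace_mixed_sq_frame hE, ha]
    simp [Matrix.trace, Matrix.mul_apply, Fin.sum_univ_three]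
    ring
  · rw [hA, hW, hC, m4, ← m0]; field_simp

/-- The normalized square of the shear component that turns the plane of rotation, from the
Hamiltonian constraint. -/
noncomputable def planeShear (h : SpatialMetric) (J : ℝ → Fin 4 → ℝ) (ρ : ℝ → ℝ) (t : ℝ) : ℝ :=
  3 * (1 - formEnergy h J t - densityParam h ρ t) - (axialShear h J t ^ 2
    + normalShear h J t ^ 2 + (axialShear h J t + normalShear h J t) ^ 2) / 2 - twistShear h J t

namespace RotatingOn

lemma exists_canonical (hI : IsOpen I) (R : RotatingOn γ I h J ρ) (ht : t ∈ I) :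
    ∃ E : Matrix (Fin 3) (Fin 3) ℝ, IsOrthonormalFrame h t E ∧ ∃ s b v w r Ω : ℝ,
      0 < v ∧ 0 < w ∧ hState h J ρ t E = canonState s b v w r Ω := by
  obtain ⟨E, hE⟩ := exists_frame (R.evolution t ht).posDef
  replace hE : IsOrthonormalFrame h t E := hE
  have hH := (R.hubble_pos t ht).ne'
  have hrot := (isRotating_hState_iff (J := J) (ρ := ρ) hE hH).2
    ⟨R.density_pos t ht, R.twist_ne t ht⟩
  have hcross := (isRotating_iff_cross.1 hrot).2
  have hsym : (hState h J ρ t E).1ᵀ = (hState h J ρ t E).1 := by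
    rw [hState_eq]
    simp only [Matrix.transpose_sub, Matrix.transpose_smul, Matrix.transpose_one,
      frameExpansion_transpose (expansion_transpose (eventually_posDef hI R.evolution ht))]
  obtain ⟨Q, hQ, v, w, s, b, c, r, hv, hw, hQV, hQS⟩ := exists_adapted_rotation hsym hcross
  refine ⟨E * Q, hE.mul hQ, s, b, v, w, r, (hState h J ρ t E).2.2.2, hv, hw, ?_⟩
  have hbc : c = -s - b := by
    have h1 : (hState h J ρ t (E * Q)).1.trace = 0 := by
      rw [hState_eq]
      simp only [Matrix.trace_sub, Matrix.trace_smul, Matrix.trace_one,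
        ← trace_mixed_frame (hE.mul hQ), trace_mixedExpansion, smul_eq_mul]
      simp; field_simp; ring
    rw [hState_mul hQ, HState.rotate, hQS] at h1
    simp [Matrix.trace, Fin.sum_univ_three] at h1
    linarith
  rw [hState_mul hQ, HState.rotate, hQS, hQV, canonState, hbc]
  refine Prod.ext rfl (Prod.ext rfl (Prod.ext ?_ rfl))
  simp [hState, R.temporal t ht]

/-- At each time there is a frame in which the state is canonical. -/
theorem exists_frame_canonical (hI : IsOpen I) (R : RotatingOn γ I h J ρ) (ht : t ∈ I) :
    0 < formEnergy h J t ∧ 0 < twistShear h J t ∧ 0 < densityParam h ρ t ∧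
    ∃ r : ℝ, planeShear h J ρ t = r ^ 2 ∧
    (∃ E : Matrix (Fin 3) (Fin 3) ℝ, IsOrthonormalFrame h t E ∧
      hState h J ρ t E = canonState (axialShear h J t) (normalShear h J t)
        (Real.sqrt (formEnergy h J t)) (Real.sqrt (twistShear h J t)) r (densityParam h ρ t)) ∧
    moment h J 4 t / moment h J 0 t = (axialRate h J t ^ 2 + twistRate h J t) ^ 2
        + twistRate h J t * (axialRate h J t + transverseRate h J t) ^ 2
        + twistRate h J t * (hubble h t ^ 2 * planeShear h J ρ t) := by
  obtain ⟨E, hE, s, b, v, w, r, Ω, hv, hw, hst⟩ := R.exists_canonical hI ht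
  have hH := R.hubble_pos t ht
  obtain ⟨h1, h2, h3, h4, h5, h6, h7⟩ := scalars_of_canonical hE hH.ne' hv.ne' hw.ne' hst
  have hρ := R.density_pos t ht
  -- In the canonical frame r² is the only term of the Hamiltonian constraint that the moments 0 to
  -- 3, H and ρ do not determine, so the constraint can be solved for it.
  have hplane : planeShear h J ρ t = r ^ 2 := by
    have hham := (R.evolution t ht).hamiltonian
    rw [h6, R.temporal t ht, trace_mixedExpansion] at hham
    have hk : spatialPart (J t) ⬝ᵥ ((h t)⁻¹ *ᵥ spatialPart (J t)) = 6 * hubble h t ^ 2 * v ^ 2 := by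
      rw [← h3, formEnergy]; field_simp; rfl
    have hO : ρ t = 3 * hubble h t ^ 2 * Ω := by rw [← h5, densityParam]; field_simp
    rw [hk, hO] at hham
    have hH2 : hubble h t ^ 2 ≠ 0 := pow_ne_zero _ hH.ne'
    have : 9 - (3 + s ^ 2 + b ^ 2 + (s + b) ^ 2 + 2 * w ^ 2 + 2 * r ^ 2) = 6 * Ω + 6 * v ^ 2 := by
      apply mul_left_cancel₀ hH2
      linear_combination hham
    rw [planeShear, h1, h2, h3, h4, h5]
    linarith
  refine ⟨by rw [h3]; positivity, by rw [h4]; positivity, ?_, r, hplane, ⟨E, hE, ?_⟩, ?_⟩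
  · rw [densityParam]; positivity
  · rw [hst, h1, h2, h3, h4, h5, Real.sqrt_sq hv.le, Real.sqrt_sq hw.le]
  · rw [h7, hplane]

end RotatingOn

end JFormCosmology

/-! ### Evolution of the invariant scalars. -/

namespace JFormCosmology

/-- The reduced dynamical system: shear components `s` (along the `j`-form) and `b` (normal to the
plane of rotation), energies `x` and `w` of the `j`-form and of its rotation, density parameter `m`
and Hubble rate `H`. -/
structure ReducedFlow (γ : ℝ) (I : Set ℝ) (s b x w m r H : ℝ → ℝ) : Prop where
  H_pos : ∀ t ∈ I, 0 < H t
  x_pos : ∀ t ∈ I, 0 < x t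
  w_pos : ∀ t ∈ I, 0 < w t
  m_pos : ∀ t ∈ I, 0 < m t
  r_nonneg : ∀ t ∈ I, 0 ≤ r t
  constraint : ∀ t ∈ I,
    s t ^ 2 + b t ^ 2 + (s t + b t) ^ 2 + 2 * w t + 2 * r t + 6 * x t + 6 * m t = 6
  H_deriv : ∀ t ∈ I, HasDerivAt H
    (-(3 - 2 * x t - 3 * (2 - γ) / 2 * m t) * H t ^ 2) t
  s_deriv : ∀ t ∈ I, HasDerivAt s
    (H t * ((-2 * x t - 3 * (2 - γ) / 2 * m t) * s t + 4 * x t - 2 * w t)) t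
  b_deriv : ∀ t ∈ I, HasDerivAt b
    (H t * ((-2 * x t - 3 * (2 - γ) / 2 * m t) * b t - 2 * x t + 2 * r t)) t
  x_deriv : ∀ t ∈ I, HasDerivAt x
    (H t * (2 * (2 - 2 * x t - 3 * (2 - γ) / 2 * m t - s t) * x t)) t
  w_deriv : ∀ t ∈ I, HasDerivAt w
    (H t * (2 * (-2 * x t - 3 * (2 - γ) / 2 * m t + 2 * s t + b t) * w t)) t
  m_deriv : ∀ t ∈ I, HasDerivAt m
    (H t * ((2 * (3 - 2 * x t - 3 * (2 - γ) / 2 * m t) - 3 * γ) * m t)) t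

variable {γ : ℝ} {h : SpatialMetric} {J : ℝ → Fin 4 → ℝ} {ρ : ℝ → ℝ} {t : ℝ} {I : Set ℝ}

lemma EvolutionAt.hasDerivAt_hubble (E : EvolutionAt γ h J ρ t) :
    HasDerivAt (hubble h) (-3 * hubble h t ^ 2
      + (moment h J 0 t + 3 * ((2 - γ) / 2) * ρ t) / 3) t := by
  have h1 : hubble h = fun s => (mixedExpansion h s).trace / 3 := by
    funext s; rw [trace_mixedExpansion]; ring
  rw [h1]
  refine (E.hasDerivAt_trace.div_const 3).congr_deriv ?_
  simp only [trace_mixedExpansion]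
  ring

section Rates

variable (E : EvolutionAt γ h J ρ t) (h0 : moment h J 0 t ≠ 0) (hw : twistRate h J t ≠ 0)
include E h0

lemma EvolutionAt.hasDerivAt_axialRate :
    HasDerivAt (axialRate h J) (-(mixedExpansion h t).trace * axialRate h J t + moment h J 0 t
      + (2 - γ) / 2 * ρ t - 2 * twistRate h J t) t := by
  refine (E.hasDerivAt_moment_one.div E.hasDerivAt_moment_zero h0).congr_deriv ?_
  simp only [twistRate, axialRate]
  field_simp
  ring

include hw

lemma EvolutionAt.hasDerivAt_twistRate :
    HasDerivAt (twistRate h J) (twistRate h J t * (2 * axialRate h J t - 2 * transverseRate h J t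
      - 2 * (mixedExpansion h t).trace)) t := by
  refine ((E.hasDerivAt_moment_two.div E.hasDerivAt_moment_zero h0).sub
    ((E.hasDerivAt_axialRate h0).pow 2)).congr_deriv ?_
  have h3 : moment h J 3 t = moment h J 0 t * (axialRate h J t ^ 3
      + 2 * axialRate h J t * twistRate h J t + twistRate h J t * transverseRate h J t) := by
    rw [transverseRate]; field_simp; ring
  have h2 : moment h J 2 t = moment h J 0 t * (axialRate h J t ^ 2 + twistRate h J t) := by
    rw [twistRate]; field_simp; ring
  have h1 : moment h J 1 t = moment h J 0 t * axialRate h J t := by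
    rw [axialRate]; field_simp
  rw [h3, h2, h1]
  push_cast
  field_simp
  ring

/-- The hypothesis `hr` closes the hierarchy of moments: it trades the fourth moment for `r`, which
is later H² times `planeShear`. -/
lemma EvolutionAt.hasDerivAt_transverseRate {r : ℝ}
    (hr : moment h J 4 t / moment h J 0 t = (axialRate h J t ^ 2 + twistRate h J t) ^ 2
        + twistRate h J t * (axialRate h J t + transverseRate h J t) ^ 2
        + twistRate h J t * r) :
    HasDerivAt (transverseRate h J) (-(mixedExpansion h t).trace * transverseRate h J t
      + (2 - γ) / 2 * ρ t + 2 * twistRate h J t - 2 * r) t := by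
  have hA := E.hasDerivAt_axialRate h0
  have hW := E.hasDerivAt_twistRate h0 hw
  refine ((((E.hasDerivAt_moment_three.div E.hasDerivAt_moment_zero h0).sub (hA.pow 3)).sub
    ((hA.const_mul 2).mul hW)).div hW hw).congr_deriv ?_
  have h4 : moment h J 4 t = moment h J 0 t * ((axialRate h J t ^ 2 + twistRate h J t) ^ 2
        + twistRate h J t * (axialRate h J t + transverseRate h J t) ^ 2
        + twistRate h J t * r) := by
    rw [← hr]; field_simp
  have h3 : moment h J 3 t = moment h J 0 t * (axialRate h J t ^ 3
      + 2 * axialRate h J t * twistRate h J t + twistRate h J t * transverseRate h J t) := by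
    rw [transverseRate]; field_simp; ring
  have h2 : moment h J 2 t = moment h J 0 t * (axialRate h J t ^ 2 + twistRate h J t) := by
    rw [twistRate]; field_simp; ring
  have h1 : moment h J 1 t = moment h J 0 t * axialRate h J t := by
    rw [axialRate]; field_simp
  simp only [Pi.div_apply, Pi.sub_apply, Pi.mul_apply, Pi.pow_apply, h4, h3, h2, h1]
  push_cast
  field_simp
  ring

end Rates

/-- The quotient rule applied to the derivatives of the moments. No equation for `planeShear` is
needed, since the constraint defines it in terms of the other variables. -/
theorem RotatingOn.reducedFlow (hI : IsOpen I) (R : RotatingOn γ I h J ρ) :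
    ReducedFlow γ I (axialShear h J) (normalShear h J) (formEnergy h J) (twistShear h J)
      (densityParam h ρ) (planeShear h J ρ) (hubble h) := by
  have hr : ∀ t ∈ I, 0 ≤ planeShear h J ρ t := fun t ht => by
    obtain ⟨-, -, -, r, hr, -⟩ := R.exists_frame_canonical hI ht
    rw [hr]; positivity
  have hk : ∀ t ∈ I, 0 < moment h J 0 t := fun t ht =>
    (R.evolution t ht).moment_zero_pos (spatialPart_ne_zero_of_twist (R.twist_ne t ht))
  have hw : ∀ t ∈ I, twistRate h J t ≠ 0 := fun t ht h0 => by
    obtain ⟨-, h1, -⟩ := R.exists_frame_canonical hI ht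
    rw [twistShear, h0] at h1; simp at h1
  have hkx : ∀ t ∈ I, moment h J 0 t = 6 * hubble h t ^ 2 * formEnergy h J t := fun t ht => by
    have := (R.hubble_pos t ht).ne'
    rw [formEnergy]; field_simp
  have hρm : ∀ t ∈ I, ρ t = 3 * hubble h t ^ 2 * densityParam h ρ t := fun t ht => by
    have := (R.hubble_pos t ht).ne'
    rw [densityParam]; field_simp
  have hWw : ∀ t ∈ I, twistRate h J t = hubble h t ^ 2 * twistShear h J t := fun t ht => by
    have := (R.hubble_pos t ht).ne'
    rw [twistShear]; field_simp
  have hAs : ∀ t ∈ I, axialRate h J t = hubble h t * (1 + axialShear h J t) := fun t ht => by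
    have := (R.hubble_pos t ht).ne'
    rw [axialShear]; field_simp; ring
  have hCs : ∀ t ∈ I, transverseRate h J t = hubble h t * (1 + transverseShear h J t) :=
    fun t ht => by
      have := (R.hubble_pos t ht).ne'
      rw [transverseShear]; field_simp; ring
  have hHd : ∀ t ∈ I, HasDerivAt (hubble h)
      (-(3 - 2 * formEnergy h J t - 3 * (2 - γ) / 2 * densityParam h ρ t) * hubble h t ^ 2) t :=
    fun t ht => (R.evolution t ht).hasDerivAt_hubble.congr_deriv (by
      rw [hkx t ht, hρm t ht]; ring)
  have hsd : ∀ t ∈ I, HasDerivAt (axialShear h J) (hubble h t *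
      ((-2 * formEnergy h J t - 3 * (2 - γ) / 2 * densityParam h ρ t) * axialShear h J t
        + 4 * formEnergy h J t - 2 * twistShear h J t)) t := fun t ht => by
    have hH := (R.hubble_pos t ht).ne'
    refine ((((R.evolution t ht).hasDerivAt_axialRate (hk t ht).ne').div (hHd t ht)
      hH).sub_const 1).congr_deriv ?_
    rw [hAs t ht, hkx t ht, hρm t ht, hWw t ht, trace_mixedExpansion]
    field_simp
    ring
  refine ⟨R.hubble_pos, fun t ht => (R.exists_frame_canonical hI ht).1,
    fun t ht => (R.exists_frame_canonical hI ht).2.1,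
    fun t ht => (R.exists_frame_canonical hI ht).2.2.1, hr, fun t ht => ?_, hHd, hsd, ?_, ?_, ?_, ?_⟩
  · rw [planeShear]; ring
  · intro t ht
    have hH := (R.hubble_pos t ht).ne'
    obtain ⟨-, -, -, r, -, -, h4⟩ := R.exists_frame_canonical hI ht
    have hcd := (((R.evolution t ht).hasDerivAt_transverseRate (hk t ht).ne' (hw t ht) h4).div
      (hHd t ht) hH).sub_const 1
    refine ((hsd t ht).neg.sub hcd).congr_deriv ?_
    rw [hCs t ht, hρm t ht, hWw t ht, trace_mixedExpansion,
      show normalShear h J t = -axialShear h J t - transverseShear h J t from rfl]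
    field_simp
    ring
  · intro t ht
    have hH := (R.hubble_pos t ht).ne'
    refine ((R.evolution t ht).hasDerivAt_moment_zero.div
      (((hHd t ht).pow 2).const_mul 6) (mul_ne_zero (by norm_num) (pow_ne_zero 2 hH))).congr_deriv ?_
    have h1 : moment h J 1 t = moment h J 0 t * axialRate h J t := by
      have := (hk t ht).ne'
      rw [axialRate]; field_simp
    simp only [Pi.mul_apply, Pi.pow_apply, h1, hkx t ht, hAs t ht]
    push_cast
    field_simp
    ring
  · intro t ht
    have hH := (R.hubble_pos t ht).ne'
    refine (((R.evolution t ht).hasDerivAt_twistRate (hk t ht).ne' (hw t ht)).div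
      ((hHd t ht).pow 2) (pow_ne_zero 2 hH)).congr_deriv ?_
    simp only [Pi.pow_apply, hWw t ht, hAs t ht, hCs t ht, trace_mixedExpansion,
      show normalShear h J t = -axialShear h J t - transverseShear h J t from rfl]
    push_cast
    field_simp
    ring
  · intro t ht
    have hH := (R.hubble_pos t ht).ne'
    refine ((R.evolution t ht).density.div
      (((hHd t ht).pow 2).const_mul 3) (mul_ne_zero (by norm_num) (pow_ne_zero 2 hH))).congr_deriv ?_
    simp only [Pi.mul_apply, Pi.pow_apply, hρm t ht, trace_mixedExpansion]
    push_cast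
    field_simp
    ring

end JFormCosmology

namespace JFormCosmology

/-! ### The Lyapunov function of the reduced flow

`Q` is the deceleration parameter of the Rope. -/

/-- The squared norm of the diagonal part of the shear of the Rope. -/
noncomputable def ropeShearSq (Q : ℝ) : ℝ := (7 * Q ^ 2 - 10 * Q + 4) / 3

/-- The inner product of the diagonal parts of the shear and of the shear of the Rope. -/
noncomputable def shearInner (Q s b : ℝ) : ℝ := (s * (2 - Q) + b * (4 - 5 * Q)) / 6

/-- With x*, w*, m* the values at the Rope, the first three weights are 6x*, 2w*, 6m* divided by 2 -
Q, the proportions in which x, w, m enter the constraint. Their sum is 6(1 - |S*|²)/(2 - Q). The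
last weight is twice this sum: x, w, m are quadratic and 1 - ⟨S, S*⟩ is linear in quantities divided
by H, so H cancels. -/
noncomputable def lyapunov (Q s b x w m : ℝ) : ℝ :=
  (9 * Q - 6) * Real.log x + (5 * Q - 4) * Real.log w + 18 * (1 - Q) / (2 - Q) * Real.log m
    - 12 * (1 - ropeShearSq Q) / (2 - Q) * Real.log (1 - shearInner Q s b)

/-- The rate of change of the Lyapunov function, up to a positive factor. -/
noncomputable def lyapunovRate (Q s b r : ℝ) : ℝ :=
  (1 - ropeShearSq Q) / ropeShearSq Q * (s * (2 - 3 * Q) - b * Q) ^ 2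
    + 12 / ropeShearSq Q * (shearInner Q s b - ropeShearSq Q) ^ 2
    + 24 * (1 - ropeShearSq Q) / (2 - Q) * (1 - Q) * r

section Algebra

variable {Q s b x w m r : ℝ}

lemma ropeShearSq_pos (Q : ℝ) : 0 < ropeShearSq Q := by
  rw [ropeShearSq]; nlinarith [sq_nonneg (7 * Q - 5)]

lemma ropeShearSq_lt_one (hQ : Q ∈ Ioo (4 / 5 : ℝ) 1) : ropeShearSq Q < 1 := by
  obtain ⟨h1, h2⟩ := hQ
  rw [ropeShearSq]; nlinarith

/-- Lagrange's identity |S|²|S*|² = ⟨S, S*⟩² + (S ∧ S*)² in the plane of diagonal trace-free shears,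
where S* has the entries Q and 2 - 3Q. -/
lemma shear_sq_eq (Q s b : ℝ) : (s ^ 2 + b ^ 2 + (s + b) ^ 2) / 6 * ropeShearSq Q
    = shearInner Q s b ^ 2 + (s * (2 - 3 * Q) - b * Q) ^ 2 / 12 := by
  rw [ropeShearSq, shearInner]; ring

lemma shearInner_le (Q s b : ℝ) :
    2 * shearInner Q s b ≤ (s ^ 2 + b ^ 2 + (s + b) ^ 2) / 6 + ropeShearSq Q := by
  have h0 := ropeShearSq_pos Q
  have h1 := shear_sq_eq Q s b
  set S := (s ^ 2 + b ^ 2 + (s + b) ^ 2) / 6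
  have h2 : 0 ≤ S := by positivity
  nlinarith [sq_nonneg (S - ropeShearSq Q), sq_nonneg (s * (2 - 3 * Q) - b * Q)]

lemma le_one_sub_shearInner (hS : s ^ 2 + b ^ 2 + (s + b) ^ 2 ≤ 6) :
    (1 - ropeShearSq Q) / 2 ≤ 1 - shearInner Q s b := by
  have := shearInner_le Q s b
  linarith

lemma one_sub_shearInner_pos (hQ : Q ∈ Ioo (4 / 5 : ℝ) 1)
    (hS : s ^ 2 + b ^ 2 + (s + b) ^ 2 ≤ 6) : 0 < 1 - shearInner Q s b :=
  lt_of_lt_of_le (by linarith [ropeShearSq_lt_one hQ]) (le_one_sub_shearInner hS)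

/-- The reverse Cauchy-Schwarz inequality (1 - |S|²)(1 - |S*|²) ≤ (1 - ⟨S, S*⟩)² for the vectors (1,
S) and (1, S*) of Lorentzian signature, with its defect as a sum of squares. -/
lemma one_sub_shear_sq_mul (Q s b : ℝ) :
    (1 - (s ^ 2 + b ^ 2 + (s + b) ^ 2) / 6) * (1 - ropeShearSq Q) * ropeShearSq Q
    = (1 - shearInner Q s b) ^ 2 * ropeShearSq Q - (shearInner Q s b - ropeShearSq Q) ^ 2
      - (1 - ropeShearSq Q) * (s * (2 - 3 * Q) - b * Q) ^ 2 / 12 := by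
  linear_combination (-(1 - ropeShearSq Q)) * shear_sq_eq Q s b

/-- The left side is the derivative of `lyapunov` along the flow, multiplied by 1 - ⟨S, S*⟩ and
divided by H. The weights are such that, once the constraint is used, x, w and m survive only
through r. -/
lemma lyapunovRate_eq (hQ : Q ∈ Ioo (4 / 5 : ℝ) 1)
    (hc : s ^ 2 + b ^ 2 + (s + b) ^ 2 + 2 * w + 2 * r + 6 * x + 6 * m = 6) :
    ((9 * Q - 6) * (2 * (2 - 2 * x - (2 - Q) * m - s))
      + (5 * Q - 4) * (2 * (-2 * x - (2 - Q) * m + 2 * s + b))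
      + 18 * (1 - Q) / (2 - Q) * (2 * (3 - 2 * x - (2 - Q) * m) - 2 * (Q + 1)))
        * (1 - shearInner Q s b)
      + 12 * (1 - ropeShearSq Q) / (2 - Q) *
        shearInner Q ((-2 * x - (2 - Q) * m) * s + 4 * x - 2 * w)
          ((-2 * x - (2 - Q) * m) * b - 2 * x + 2 * r) = lyapunovRate Q s b r := by
  have h1 := shear_sq_eq Q s b
  have h0 := (ropeShearSq_pos Q).ne'
  have hF : 2 - Q ≠ 0 := by linarith [hQ.2]
  have hr : r = (6 - (s ^ 2 + b ^ 2 + (s + b) ^ 2 + 2 * w + 6 * x + 6 * m)) / 2 := by linarith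
  -- The two squares in the rate are twelve times the defect of the reverse Cauchy-Schwarz
  -- inequality.
  have h2 : (1 - ropeShearSq Q) / ropeShearSq Q * (s * (2 - 3 * Q) - b * Q) ^ 2
    + 12 / ropeShearSq Q * (shearInner Q s b - ropeShearSq Q) ^ 2
    = 12 * (1 - shearInner Q s b) ^ 2
      - 12 * (1 - (s ^ 2 + b ^ 2 + (s + b) ^ 2) / 6) * (1 - ropeShearSq Q) := by
    field_simp
    linear_combination 72 * one_sub_shear_sq_mul Q s b
  rw [lyapunovRate, h2, hr, shearInner, shearInner, ropeShearSq]
  field_simp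
  ring

lemma lyapunovRate_nonneg (hQ : Q ∈ Ioo (4 / 5 : ℝ) 1) (hr : 0 ≤ r) :
    0 ≤ lyapunovRate Q s b r := by
  have h0 := ropeShearSq_pos Q
  have h1 : 0 < 1 - ropeShearSq Q := by linarith [ropeShearSq_lt_one hQ]
  have h2 : 0 < 1 - Q := by linarith [hQ.2]
  have h3 : 0 < 2 - Q := by linarith [hQ.2]
  rw [lyapunovRate]
  positivity

/-- The values of the reduced variables at the Rope. -/
structure IsRopePoint (Q s b x w m r : ℝ) : Prop where
  s_eq : s = Q
  b_eq : b = 2 - 3 * Q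
  x_eq : x = (2 - Q) * (3 * Q - 2) / 2
  w_eq : w = (2 - Q) * (5 * Q - 4) / 2
  m_eq : m = 3 * (1 - Q)
  r_eq : r = 0

noncomputable def ropeLyapunov (Q : ℝ) : ℝ :=
  lyapunov Q Q (2 - 3 * Q) ((2 - Q) * (3 * Q - 2) / 2) ((2 - Q) * (5 * Q - 4) / 2) (3 * (1 - Q))

lemma shearInner_rope (Q : ℝ) : shearInner Q Q (2 - 3 * Q) = ropeShearSq Q := by
  rw [shearInner, ropeShearSq]; ring

set_option maxHeartbeats 1000000 in
/-- The Rope maximizes the Lyapunov function. -/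
lemma lyapunov_le (hQ : Q ∈ Ioo (4 / 5 : ℝ) 1) (hx : 0 < x) (hw : 0 < w) (hm : 0 < m)
    (hr : 0 ≤ r) (hc : s ^ 2 + b ^ 2 + (s + b) ^ 2 + 2 * w + 2 * r + 6 * x + 6 * m = 6) :
    lyapunov Q s b x w m ≤ ropeLyapunov Q ∧
      (lyapunov Q s b x w m = ropeLyapunov Q → IsRopePoint Q s b x w m r) := by
  have h0 := ropeShearSq_pos Q
  have h1 : 0 < 1 - ropeShearSq Q := by linarith [ropeShearSq_lt_one hQ]
  have hQ1 : 0 < 1 - Q := by linarith [hQ.2]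
  have hF : 0 < 2 - Q := by linarith [hQ.2]
  have hx' : 0 < 3 * Q - 2 := by linarith [hQ.1]
  have hw' : 0 < 5 * Q - 4 := by linarith [hQ.1]
  have hD : 0 < 1 - shearInner Q s b := one_sub_shearInner_pos hQ (by linarith)
  have hxs : 0 < (2 - Q) * (3 * Q - 2) / 2 := by positivity
  have hws : 0 < (2 - Q) * (5 * Q - 4) / 2 := by positivity
  have hms : 0 < 3 * (1 - Q) := by positivity
  -- The energy left over by the shear components s, b, r, relative to its value at the Rope. The
  -- triple (x, w, m) is compared with l times its Rope value, so that both have the same weighted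
  -- total.
  set l := (x + w / 3 + m) / (1 - ropeShearSq Q) with hl
  have hlpos : 0 < l := by positivity
  have gibbs : ∀ y z : ℝ, 0 < y → 0 < z →
      Real.log y - Real.log z - Real.log l ≤ y / (l * z) - 1 ∧
      (Real.log y - Real.log z - Real.log l = y / (l * z) - 1 → y = l * z) := by
    intro y z hy hz
    have e : Real.log y - Real.log z - Real.log l = Real.log (y / (l * z)) := by
      rw [Real.log_div hy.ne' (by positivity), Real.log_mul hlpos.ne' hz.ne']; ring
    rw [e]
    refine ⟨Real.log_le_sub_one_of_pos (by positivity), fun h => ?_⟩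
    by_contra hne
    have := Real.log_lt_sub_one_of_pos (x := y / (l * z)) (by positivity)
      (fun h' => hne (by field_simp at h'; linarith))
    linarith
  obtain ⟨gx, gx'⟩ := gibbs x _ hx hxs
  obtain ⟨gw, gw'⟩ := gibbs w _ hw hws
  obtain ⟨gm, gm'⟩ := gibbs m _ hm hms
  have hl1 : l * (1 - ropeShearSq Q) = 1 - (s ^ 2 + b ^ 2 + (s + b) ^ 2) / 6 - r / 3 := by
    rw [hl]; field_simp; linarith
  have hid := one_sub_shear_sq_mul Q s b
  -- By the constraint, l(1 - |S*|²) = 1 - |S|² - r/3. The reverse Cauchy-Schwarz inequality then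
  -- bounds l from above, with all defects kept for the case of equality.
  have hle : l * (1 - ropeShearSq Q) ^ 2 * ropeShearSq Q
      = (1 - shearInner Q s b) ^ 2 * ropeShearSq Q - (shearInner Q s b - ropeShearSq Q) ^ 2
      - (1 - ropeShearSq Q) * (s * (2 - 3 * Q) - b * Q) ^ 2 / 12
      - r / 3 * (1 - ropeShearSq Q) * ropeShearSq Q := by
    linear_combination hid + (1 - ropeShearSq Q) * ropeShearSq Q * hl1
  have p1 : 0 ≤ (shearInner Q s b - ropeShearSq Q) ^ 2 := sq_nonneg _
  have p2 : 0 ≤ (1 - ropeShearSq Q) * (s * (2 - 3 * Q) - b * Q) ^ 2 / 12 := by positivity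
  have p3 : 0 ≤ r / 3 * (1 - ropeShearSq Q) * ropeShearSq Q := by positivity
  have hle1 : l * (1 - ropeShearSq Q) ^ 2 ≤ (1 - shearInner Q s b) ^ 2 :=
    le_of_mul_le_mul_right (by linarith) h0
  have elog : Real.log (l * (1 - ropeShearSq Q) ^ 2)
      = Real.log l + 2 * Real.log (1 - ropeShearSq Q) := by
    rw [Real.log_mul hlpos.ne' (by positivity), Real.log_pow]; push_cast; ring
  have elog' : Real.log ((1 - shearInner Q s b) ^ 2) = 2 * Real.log (1 - shearInner Q s b) := by
    rw [Real.log_pow]; push_cast; ring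
  have gl : Real.log l + 2 * Real.log (1 - ropeShearSq Q)
      ≤ 2 * Real.log (1 - shearInner Q s b) := by
    rw [← elog, ← elog']; exact Real.log_le_log (by positivity) hle1
  -- The linear terms of Gibbs' inequality cancel because the weights are proportional to the Rope
  -- values.
  have hsum : (9 * Q - 6) * (x / (l * ((2 - Q) * (3 * Q - 2) / 2)) - 1)
      + (5 * Q - 4) * (w / (l * ((2 - Q) * (5 * Q - 4) / 2)) - 1)
      + 18 * (1 - Q) / (2 - Q) * (m / (l * (3 * (1 - Q))) - 1) = 0 := by
    have e1 : (9 * Q - 6) * (x / (l * ((2 - Q) * (3 * Q - 2) / 2)))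
        = 6 * x / (l * (2 - Q)) := by
      rw [show 9 * Q - 6 = 3 * (3 * Q - 2) by ring]; field_simp; ring
    have e2 : (5 * Q - 4) * (w / (l * ((2 - Q) * (5 * Q - 4) / 2)))
        = 2 * w / (l * (2 - Q)) := by field_simp
    have e3 : 18 * (1 - Q) / (2 - Q) * (m / (l * (3 * (1 - Q))))
        = 6 * m / (l * (2 - Q)) := by field_simp; ring
    have e4 : 6 * x / (l * (2 - Q)) + 2 * w / (l * (2 - Q)) + 6 * m / (l * (2 - Q))
        = 6 * (1 - ropeShearSq Q) / (2 - Q) := by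
      have : x + w / 3 + m = l * (1 - ropeShearSq Q) := by rw [hl]; field_simp
      rw [← add_div, ← add_div, show 6 * x + 2 * w + 6 * m = 6 * (l * (1 - ropeShearSq Q)) by
        rw [← this]; ring]
      field_simp
    have e5 : 6 * (1 - ropeShearSq Q) / (2 - Q) = (9 * Q - 6) + (5 * Q - 4)
        + 18 * (1 - Q) / (2 - Q) := by
      rw [ropeShearSq]; field_simp; ring
    linarith
  -- The multiples of log l add up to zero: the fourth coefficient is the sum of the first three.
  have hsplit : lyapunov Q s b x w m - ropeLyapunov Q
      = (9 * Q - 6) * (Real.log x - Real.log ((2 - Q) * (3 * Q - 2) / 2) - Real.log l)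
      + (5 * Q - 4) * (Real.log w - Real.log ((2 - Q) * (5 * Q - 4) / 2) - Real.log l)
      + 18 * (1 - Q) / (2 - Q) * (Real.log m - Real.log (3 * (1 - Q)) - Real.log l)
      + 6 * (1 - ropeShearSq Q) / (2 - Q) * (Real.log l + 2 * Real.log (1 - ropeShearSq Q)
        - 2 * Real.log (1 - shearInner Q s b)) := by
    have e5 : 6 * (1 - ropeShearSq Q) / (2 - Q) = (9 * Q - 6) + (5 * Q - 4)
        + 18 * (1 - Q) / (2 - Q) := by
      rw [ropeShearSq]; field_simp; ring
    have e6 : 12 * (1 - ropeShearSq Q) / (2 - Q) = 2 * ((9 * Q - 6) + (5 * Q - 4)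
        + 18 * (1 - Q) / (2 - Q)) := by rw [← e5]; ring
    rw [ropeLyapunov, lyapunov, lyapunov, shearInner_rope, e5, e6]
    ring
  have ax : 0 < 9 * Q - 6 := by linarith
  have aw : 0 < 5 * Q - 4 := hw'
  have am : 0 < 18 * (1 - Q) / (2 - Q) := by positivity
  have al : 0 < 6 * (1 - ropeShearSq Q) / (2 - Q) := by positivity
  have tx := mul_le_mul_of_nonneg_left gx ax.le
  have tw := mul_le_mul_of_nonneg_left gw aw.le
  have tm := mul_le_mul_of_nonneg_left gm am.le
  have tl := mul_nonneg al.le (sub_nonneg.2 gl)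
  -- Equality in the sum forces equality in each of the four inequalities. Those of Gibbs make (x,
  -- w, m) equal to l times its Rope value; the vanishing defects give ⟨S, S*⟩ = |S*|², S ∧ S* = 0,
  -- r = 0, whence l = 1.
  refine ⟨by linarith, fun heq => ?_⟩
  have qx := gx' (mul_left_cancel₀ ax.ne' (by linarith))
  have qw := gw' (mul_left_cancel₀ aw.ne' (by linarith))
  have qm := gm' (mul_left_cancel₀ am.ne' (by linarith))
  have ql : Real.log (l * (1 - ropeShearSq Q) ^ 2) = Real.log ((1 - shearInner Q s b) ^ 2) := by
    rw [elog, elog']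
    exact mul_left_cancel₀ al.ne' (by linarith)
  have ql' : l * (1 - ropeShearSq Q) ^ 2 = (1 - shearInner Q s b) ^ 2 :=
    Real.log_injOn_pos (by simp; positivity) (by simp; positivity) ql
  rw [ql'] at hle
  have z1 : (shearInner Q s b - ropeShearSq Q) ^ 2 = 0 := by linarith
  have z2 : (1 - ropeShearSq Q) * (s * (2 - 3 * Q) - b * Q) ^ 2 / 12 = 0 := by linarith
  have z3 : r / 3 * (1 - ropeShearSq Q) * ropeShearSq Q = 0 := by linarith
  have y1 : shearInner Q s b = ropeShearSq Q :=
    sub_eq_zero.1 (pow_eq_zero_iff two_ne_zero |>.1 z1)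
  have y2 : s * (2 - 3 * Q) - b * Q = 0 := by
    have : (1 - ropeShearSq Q) * (s * (2 - 3 * Q) - b * Q) ^ 2 = 0 := by linarith
    rcases mul_eq_zero.1 this with h | h
    · linarith
    · exact pow_eq_zero_iff (two_ne_zero) |>.1 h
  have y3 : r = 0 := by
    rcases mul_eq_zero.1 z3 with h | h
    · rcases mul_eq_zero.1 h with h | h <;> linarith
    · linarith
  have l1 : l = 1 := by
    rw [y1] at ql'
    have : (1 - ropeShearSq Q) ^ 2 ≠ 0 := by positivity
    exact mul_right_cancel₀ this (by linarith)
  -- A vector in the plane is recovered from its inner product and its wedge product with S*.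
  have ys : s = Q := by
    have : ropeShearSq Q * s = ropeShearSq Q * Q := by
      have : ropeShearSq Q * s = Q * shearInner Q s b + (4 - 5 * Q) / 6
        * (s * (2 - 3 * Q) - b * Q) := by rw [ropeShearSq, shearInner]; ring
      rw [this, y1, y2]; ring
    exact mul_left_cancel₀ h0.ne' this
  have yb : b = 2 - 3 * Q := by
    have : ropeShearSq Q * b = ropeShearSq Q * (2 - 3 * Q) := by
      have : ropeShearSq Q * b = (2 - 3 * Q) * shearInner Q s b - (2 - Q) / 6
        * (s * (2 - 3 * Q) - b * Q) := by rw [ropeShearSq, shearInner]; ring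
      rw [this, y1, y2]; ring
    exact mul_left_cancel₀ h0.ne' this
  rw [l1, one_mul] at qx qw qm
  exact ⟨ys, yb, qx, qw, qm, y3⟩

end Algebra

end JFormCosmology

/-! ### A Barbalat lemma. -/

namespace JFormCosmology

/-- A quantitative Barbalat lemma: if `f' = H p g` with `p ≥ p₀ > 0` and `g' = H k` with `k ≥ -C`,
then the growth of `f` bounds `g`. -/
lemma sq_le_of_deriv_mul {a C p₀ δ : ℝ} {T H f p g k : ℝ → ℝ} (hC : 0 < C) (hp₀ : 0 < p₀)
    (hT : ∀ t > a, HasDerivAt T (H t) t) (hH : ∀ t > a, 0 < H t)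
    (hf : ∀ t > a, HasDerivAt f (H t * (p t * g t)) t) (hp : ∀ t > a, p₀ ≤ p t)
    (hg : ∀ t > a, HasDerivAt g (H t * k t) t) (hk : ∀ t > a, -C ≤ k t)
    (hT' : Tendsto T atTop atTop) {t : ℝ} (ht : a < t) (hδ : ∀ u ≥ t, f u - f t ≤ δ)
    (hgt : 0 ≤ g t) : g t ^ 2 ≤ 2 * C * δ / p₀ := by
  -- In the time T the function g falls at rate at most C, so it stays above g(t) - C(T - T(t)).
  -- This bound reaches zero when T has advanced by g(t)/C.
  obtain ⟨u, htu, hu⟩ : ∃ u ≥ t, T u = T t + g t / C := by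
    obtain ⟨v, hv1, hv2⟩ := ((hT'.eventually_ge_atTop (T t + g t / C)).and
      (eventually_ge_atTop t)).exists
    have hc : ContinuousOn T (Icc t v) := fun y hy =>
      (hT y (lt_of_lt_of_le ht hy.1)).continuousAt.continuousWithinAt
    obtain ⟨u, hu, hu'⟩ := intermediate_value_Icc hv2 hc
      (show T t + g t / C ∈ Icc (T t) (T v) from ⟨by simp; positivity, hv1⟩)
    exact ⟨u, hu.1, hu'⟩
  have hTmono : MonotoneOn T (Ici t) := by
    refine monotoneOn_of_deriv_nonneg (convex_Ici t)
      (fun y hy => (hT y (lt_of_lt_of_le ht hy)).continuousAt.continuousWithinAt)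
      (fun y hy => ?_) (fun y hy => ?_) <;> rw [interior_Ici] at hy
    · exact (hT y (ht.trans hy)).differentiableAt.differentiableWithinAt
    · rw [(hT y (ht.trans hy)).deriv]; exact (hH y (ht.trans hy)).le
  have hgmono : MonotoneOn (fun y => g y + C * T y) (Ici t) := by
    have hd : ∀ y > a, HasDerivAt (fun y => g y + C * T y) (H y * k y + C * H y) y :=
      fun y hy => (hg y hy).add ((hT y hy).const_mul C)
    refine monotoneOn_of_deriv_nonneg (convex_Ici t)
      (fun y hy => (hd y (lt_of_lt_of_le ht hy)).continuousAt.continuousWithinAt)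
      (fun y hy => ?_) (fun y hy => ?_) <;> rw [interior_Ici] at hy
    · exact (hd y (ht.trans hy)).differentiableAt.differentiableWithinAt
    · rw [(hd y (ht.trans hy)).deriv]
      nlinarith [hH y (ht.trans hy), hk y (ht.trans hy)]
  -- f grows at least as fast as p₀ times the integral of that lower bound for g; up to `u` this
  -- integral amounts to g(t)²/(2C).
  have hφ : MonotoneOn (fun y => f y - p₀ * (g t * (T y - T t) - C * (T y - T t) ^ 2 / 2))
      (Icc t u) := by
    have hd : ∀ y > a, HasDerivAt
        (fun y => f y - p₀ * (g t * (T y - T t) - C * (T y - T t) ^ 2 / 2))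
        (H y * (p y * g y) - p₀ * (g t * H y - C * (T y - T t) * H y)) y := fun y hy => by
      have h1 := (hT y hy).sub_const (T t)
      refine ((hf y hy).sub (((h1.const_mul (g t)).sub
        (((h1.pow 2).const_mul C).div_const 2)).const_mul p₀)).congr_deriv ?_
      push_cast; ring
    refine monotoneOn_of_deriv_nonneg (convex_Icc t u)
      (fun y hy => (hd y (lt_of_lt_of_le ht hy.1)).continuousAt.continuousWithinAt)
      (fun y hy => ?_) (fun y hy => ?_) <;> rw [interior_Icc] at hy
    · exact (hd y (ht.trans hy.1)).differentiableAt.differentiableWithinAt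
    · rw [(hd y (ht.trans hy.1)).deriv]
      have h1 : g t + C * T t ≤ g y + C * T y := hgmono (mem_Ici.2 le_rfl) hy.1.le hy.1.le
      have h2 : T y ≤ T t + g t / C := hu ▸ hTmono hy.1.le htu hy.2.le
      have h3 : 0 ≤ g t - C * (T y - T t) := by
        have : C * (T y - T t) ≤ C * (g t / C) := mul_le_mul_of_nonneg_left (by linarith) hC.le
        rw [mul_div_cancel₀ _ hC.ne'] at this
        linarith
      have h4 : p₀ * (g t - C * (T y - T t)) ≤ p y * g y :=
        mul_le_mul (hp y (ht.trans hy.1)) (by linarith) h3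
          (hp₀.le.trans (hp y (ht.trans hy.1)))
      have := mul_nonneg (hH y (ht.trans hy.1)).le (sub_nonneg.2 h4)
      linarith
  have h5 := hφ (left_mem_Icc.2 htu) (right_mem_Icc.2 htu) htu
  simp only [hu, sub_self, add_sub_cancel_left] at h5
  have h6 := hδ u htu
  have h7 : p₀ * (g t * (g t / C) - C * (g t / C) ^ 2 / 2) = p₀ * g t ^ 2 / (2 * C) := by
    field_simp; ring
  rw [h7] at h5
  rw [le_div_iff₀ hp₀]
  have h8 : p₀ * g t ^ 2 / (2 * C) ≤ δ := by
    have : f t - p₀ * (g t * 0 - C * 0 ^ 2 / 2) = f t := by ring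
    linarith
  rw [div_le_iff₀ (by positivity)] at h8
  linarith

/-- Convergence of f makes its later increments small in both directions, and the quantitative lemma
applied to g or to -g turns this into smallness of g². -/
lemma tendsto_zero_of_deriv_mul {a C p₀ l : ℝ} {T H f p g k : ℝ → ℝ} (hC : 0 < C) (hp₀ : 0 < p₀)
    (hT : ∀ t > a, HasDerivAt T (H t) t) (hH : ∀ t > a, 0 < H t)
    (hf : ∀ t > a, HasDerivAt f (H t * (p t * g t)) t) (hp : ∀ t > a, p₀ ≤ p t)
    (hg : ∀ t > a, HasDerivAt g (H t * k t) t) (hk : ∀ t > a, |k t| ≤ C)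
    (hT' : Tendsto T atTop atTop) (hl : Tendsto f atTop (𝓝 l)) : Tendsto g atTop (𝓝 0) := by
  have key : ∀ ε > 0, ∀ᶠ t in atTop, g t ^ 2 ≤ 2 * C * ε / p₀ := fun ε hε => by
    obtain ⟨t₀, ht₀⟩ := (Metric.tendsto_atTop.1 hl) (ε / 2) (by positivity)
    filter_upwards [eventually_ge_atTop t₀, eventually_gt_atTop a] with t ht hta
    have hδ : ∀ u ≥ t, |f u - f t| ≤ ε := fun u hu => by
      have h1 := ht₀ t ht
      have h2 := ht₀ u (ht.trans hu)
      rw [Real.dist_eq] at h1 h2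
      have := abs_sub_le (f u) l (f t)
      rw [abs_sub_comm l] at this
      linarith
    rcases le_total 0 (g t) with h0 | h0
    · exact sq_le_of_deriv_mul hC hp₀ hT hH hf hp hg (fun y hy => (abs_le.1 (hk y hy)).1) hT' hta
        (fun u hu => (abs_le.1 (hδ u hu)).2) h0
    · have := sq_le_of_deriv_mul (f := fun y => -f y) (g := fun y => -g y) (k := fun y => -k y)
        hC hp₀ hT hH (fun y hy => (hf y hy).neg.congr_deriv (by ring)) hp
        (fun y hy => (hg y hy).neg.congr_deriv (by ring))
        (fun y hy => neg_le_neg (abs_le.1 (hk y hy)).2) hT' hta (δ := ε)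
        (fun u hu => by have := (abs_le.1 (hδ u hu)).1; linarith) (by simpa using h0)
      simpa using this
  have h2 : Tendsto (fun t => g t ^ 2) atTop (𝓝 0) := by
    refine Metric.tendsto_nhds.2 fun ε hε => ?_
    filter_upwards [key (ε / 2 * p₀ / (2 * C)) (by positivity)] with t ht
    have e : 2 * C * (ε / 2 * p₀ / (2 * C)) / p₀ = ε / 2 := by field_simp
    rw [e] at ht
    rw [Real.dist_eq, sub_zero, abs_of_nonneg (sq_nonneg _)]
    linarith
  have h3 := h2.sqrt
  simp only [Real.sqrt_sq_eq_abs, Real.sqrt_zero] at h3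
  exact tendsto_zero_iff_abs_tendsto_zero _ |>.2 h3

end JFormCosmology

/-! ### Convergence of the reduced flow. -/

namespace JFormCosmology

namespace ReducedFlow

variable {γ Q a : ℝ} {I : Set ℝ} {s b x w m r H : ℝ → ℝ}

lemma bounds (F : ReducedFlow γ I s b x w m r H) {t : ℝ} (ht : t ∈ I) :
    |s t| ≤ 6 ∧ |b t| ≤ 6 ∧ |x t| ≤ 1 ∧ |w t| ≤ 6 ∧ |m t| ≤ 1 ∧ |r t| ≤ 6 ∧ x t + m t ≤ 1 := by
  have h1 := F.x_pos t ht
  have h2 := F.w_pos t ht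
  have h3 := F.m_pos t ht
  have h4 := F.r_nonneg t ht
  have h5 := F.constraint t ht
  have hs : s t ^ 2 ≤ 6 := by nlinarith [sq_nonneg (b t), sq_nonneg (s t + b t)]
  have hb : b t ^ 2 ≤ 6 := by nlinarith [sq_nonneg (s t), sq_nonneg (s t + b t)]
  have h6 : 0 ≤ s t ^ 2 + b t ^ 2 + (s t + b t) ^ 2 := by positivity
  refine ⟨abs_le_of_sq_le_sq (by linarith) (by norm_num),
    abs_le_of_sq_le_sq (by linarith) (by norm_num), ?_, ?_, ?_, ?_, by linarith⟩ <;>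
  rw [abs_of_nonneg (by linarith)] <;> linarith

/-- The constraint keeps the variables in a compact box. This supplies the constants for the
Barbalat lemma, as the derivatives in question are H times polynomials in the variables. -/
lemma exists_bound (F : ReducedFlow γ I s b x w m r H) {κ : (Fin 6 → ℝ) → ℝ}
    (hκ : Continuous κ) : ∃ C > 0, ∀ t ∈ I, |κ ![s t, b t, x t, w t, m t, r t]| ≤ C := by
  obtain ⟨C, hC⟩ := (isCompact_closedBall (0 : Fin 6 → ℝ) 6).exists_bound_of_continuousOn
    hκ.continuousOn
  refine ⟨max C 1, by positivity, fun t ht => (hC _ ?_).trans (le_max_left _ _)⟩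
  obtain ⟨h1, h2, h3, h4, h5, h6, -⟩ := F.bounds ht
  rw [mem_closedBall_zero_iff, pi_norm_le_iff_of_nonneg (by norm_num)]
  intro i
  fin_cases i <;> simp <;> linarith

/-- Obtained by solving the constraint for r and differentiating. Its precise form is immaterial;
only boundedness relative to H is used. -/
lemma r_deriv (hI : IsOpen I) (F : ReducedFlow γ I s b x w m r H) {t : ℝ} (ht : t ∈ I) :
    HasDerivAt r (H t * (-(2 * s t * ((-2 * x t - 3 * (2 - γ) / 2 * m t) * s t + 4 * x t - 2 * w t)
      + 2 * b t * ((-2 * x t - 3 * (2 - γ) / 2 * m t) * b t - 2 * x t + 2 * r t)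
      + 2 * (s t + b t) * (((-2 * x t - 3 * (2 - γ) / 2 * m t) * s t + 4 * x t - 2 * w t)
        + ((-2 * x t - 3 * (2 - γ) / 2 * m t) * b t - 2 * x t + 2 * r t))
      + 2 * (2 * (-2 * x t - 3 * (2 - γ) / 2 * m t + 2 * s t + b t) * w t)
      + 6 * (2 * (2 - 2 * x t - 3 * (2 - γ) / 2 * m t - s t) * x t)
      + 6 * ((2 * (3 - 2 * x t - 3 * (2 - γ) / 2 * m t) - 3 * γ) * m t)) / 2)) t := by
  have hs := F.s_deriv t ht
  have hb := F.b_deriv t ht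
  have h1 := ((((((hs.pow 2).add (hb.pow 2)).add ((hs.add hb).pow 2)).add
    ((F.w_deriv t ht).const_mul 2)).add ((F.x_deriv t ht).const_mul 6)).add
    ((F.m_deriv t ht).const_mul 6)).const_sub 6 |>.div_const 2
  refine (h1.congr_of_eventuallyEq ?_).congr_deriv ?_
  · filter_upwards [hI.mem_nhds ht] with u hu
    have := F.constraint u hu
    simp only [Pi.add_apply, Pi.pow_apply]
    linarith
  · simp only [Pi.add_apply]; push_cast; ring

/-- The logarithm of the mean scale factor, up to a constant. -/
noncomputable def clock (γ : ℝ) (m H : ℝ → ℝ) (t : ℝ) : ℝ :=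
  -(Real.log (m t) + 2 * Real.log (H t)) / (3 * γ)

lemma hasDerivAt_clock (hγ : 0 < γ) (F : ReducedFlow γ I s b x w m r H) {t : ℝ} (ht : t ∈ I) :
    HasDerivAt (clock γ m H) (H t) t := by
  have hm := (F.m_pos t ht).ne'
  have hH := (F.H_pos t ht).ne'
  refine ((((F.m_deriv t ht).log hm).add (((F.H_deriv t ht).log hH).const_mul 2)).neg.div_const
    (3 * γ)).congr_deriv ?_
  field_simp
  ring

/-- The derivative of 1/H is 1 + q = 3 - 2x - (3/2)(2 - γ)m. It is at least 1 because x + m ≤ 1 and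
γ ≥ 2/3, so 1/H grows at least linearly. -/
lemma tendsto_hubble_inv (hγ : 2 / 3 ≤ γ) (F : ReducedFlow γ (Ioi a) s b x w m r H) :
    Tendsto (fun t => (H t)⁻¹) atTop atTop := by
  have hd : ∀ t ∈ Ioi a, HasDerivAt (fun t => (H t)⁻¹ - t)
      ((3 - 2 * x t - 3 * (2 - γ) / 2 * m t) - 1) t := fun t ht => by
    have hH := (F.H_pos t ht).ne'
    refine (((F.H_deriv t ht).inv hH).sub (hasDerivAt_id t)).congr_deriv ?_
    field_simp
  have hmono : MonotoneOn (fun t => (H t)⁻¹ - t) (Ioi a) := by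
    refine monotoneOn_of_deriv_nonneg (convex_Ioi a)
      (fun y hy => (hd y hy).continuousAt.continuousWithinAt)
      (fun y hy => ?_) (fun y hy => ?_) <;> rw [interior_Ioi] at hy
    · exact (hd y hy).differentiableAt.differentiableWithinAt
    · rw [(hd y hy).deriv]
      have h1 := F.x_pos y hy
      have h2 := F.m_pos y hy
      obtain ⟨-, -, -, -, -, -, h3⟩ := F.bounds hy
      have h4 : 2 / 3 * m y ≤ γ * m y := mul_le_mul_of_nonneg_right hγ h2.le
      nlinarith
  have ha : a + 1 ∈ Ioi a := by simp
  refine tendsto_atTop_mono' _ ?_ (tendsto_atTop_add_const_left atTop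
    ((H (a + 1))⁻¹ - (a + 1)) tendsto_id)
  filter_upwards [eventually_ge_atTop (a + 1)] with t ht
  have := hmono ha (show t ∈ Ioi a by simp; linarith) ht
  simp only [id]
  linarith

/-- Since m ≤ 1, the clock is at least 2/(3γ) times log(1/H). -/
lemma tendsto_clock (hγ' : 2 / 3 ≤ γ) (F : ReducedFlow γ (Ioi a) s b x w m r H) :
    Tendsto (clock γ m H) atTop atTop := by
  have hγ : 0 < γ := by linarith
  have h1 := (Real.tendsto_log_atTop.comp (F.tendsto_hubble_inv hγ')).const_mul_atTop
    (show 0 < 2 / (3 * γ) by positivity)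
  refine tendsto_atTop_mono' _ ?_ h1
  filter_upwards [eventually_gt_atTop a] with t ht
  have hm : Real.log (m t) ≤ 0 := Real.log_nonpos (F.m_pos t ht).le
    ((le_abs_self _).trans (F.bounds ht).2.2.2.2.1)
  simp only [Function.comp, Real.log_inv, clock]
  rw [div_mul_eq_mul_div]
  gcongr
  linarith

section Convergence

variable (hQ : Q ∈ Ioo (4 / 5 : ℝ) 1)
include hQ

lemma hasDerivAt_lyapunov (F : ReducedFlow (2 * (Q + 1) / 3) I s b x w m r H) {t : ℝ}
    (ht : t ∈ I) :
    HasDerivAt (fun t => lyapunov Q (s t) (b t) (x t) (w t) (m t))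
      (H t * ((1 - shearInner Q (s t) (b t))⁻¹ * lyapunovRate Q (s t) (b t) (r t))) t := by
  have hc := F.constraint t ht
  have hx := F.x_pos t ht
  have hw := F.w_pos t ht
  have hm := F.m_pos t ht
  have hD : 0 < 1 - shearInner Q (s t) (b t) :=
    one_sub_shearInner_pos hQ (by linarith [F.r_nonneg t ht])
  have hF : (2 - Q) ≠ 0 := by linarith [hQ.2]
  have hX : HasDerivAt (fun t => 1 - shearInner Q (s t) (b t)) _ t :=
    ((((F.s_deriv t ht).mul_const (2 - Q)).add
      ((F.b_deriv t ht).mul_const (4 - 5 * Q))).div_const 6).const_sub 1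
  refine ((((((F.x_deriv t ht).log hx.ne').const_mul (9 * Q - 6)).add
    (((F.w_deriv t ht).log hw.ne').const_mul (5 * Q - 4))).add
    (((F.m_deriv t ht).log hm.ne').const_mul (18 * (1 - Q) / (2 - Q)))).sub
    ((hX.log hD.ne').const_mul (12 * (1 - ropeShearSq Q) / (2 - Q)))).congr_deriv ?_
  rw [← lyapunovRate_eq hQ hc]
  rw [show 3 * (2 - 2 * (Q + 1) / 3) / 2 = 2 - Q by ring,
    show 3 * (2 * (Q + 1) / 3) = 2 * (Q + 1) by ring]
  generalize hDD : 1 - shearInner Q (s t) (b t) = D at *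
  generalize 12 * (1 - ropeShearSq Q) / (2 - Q) = c1
  generalize 18 * (1 - Q) / (2 - Q) = c2
  rw [shearInner]
  have := hD.ne'
  field_simp
  ring

lemma lyapunov_monotoneOn (F : ReducedFlow (2 * (Q + 1) / 3) I s b x w m r H) (hc : Convex ℝ I)
    (hI : IsOpen I) : MonotoneOn (fun t => lyapunov Q (s t) (b t) (x t) (w t) (m t)) I := by
  refine monotoneOn_of_deriv_nonneg hc
    (fun y hy => (F.hasDerivAt_lyapunov hQ hy).continuousAt.continuousWithinAt)
    (fun y hy => ?_) (fun y hy => ?_) <;> rw [hI.interior_eq] at hy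
  · exact (F.hasDerivAt_lyapunov hQ hy).differentiableAt.differentiableWithinAt
  · rw [(F.hasDerivAt_lyapunov hQ hy).deriv]
    have h1 := lyapunovRate_nonneg (s := s y) (b := b y) hQ (F.r_nonneg y hy)
    have hc := F.constraint y hy
    have hx := F.x_pos y hy
    have hw := F.w_pos y hy
    have hm := F.m_pos y hy
    have hr := F.r_nonneg y hy
    have hD : 0 < 1 - shearInner Q (s y) (b y) := one_sub_shearInner_pos hQ (by linarith)
    have := F.H_pos y hy
    positivity

lemma tendsto_lyapunov (F : ReducedFlow (2 * (Q + 1) / 3) (Ioi a) s b x w m r H) :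
    ∃ l, Tendsto (fun t => lyapunov Q (s t) (b t) (x t) (w t) (m t)) atTop (𝓝 l) := by
  have hmono := F.lyapunov_monotoneOn hQ (convex_Ioi a) isOpen_Ioi
  set f := fun t => lyapunov Q (s t) (b t) (x t) (w t) (m t) with hf
  -- Freezing the argument below a + 1 gives a function that is monotone on the whole line.
  have hmono' : Monotone (fun t => f (max t (a + 1))) := fun y z hyz =>
    hmono (show a < max y (a + 1) by simp) (show a < max z (a + 1) by simp)
      (max_le_max_right _ hyz)
  have hbdd : BddAbove (range fun t => f (max t (a + 1))) := by
    refine ⟨ropeLyapunov Q, ?_⟩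
    rintro _ ⟨t, rfl⟩
    have ht : max t (a + 1) ∈ Ioi a := by simp
    exact (lyapunov_le hQ (F.x_pos _ ht) (F.w_pos _ ht) (F.m_pos _ ht) (F.r_nonneg _ ht)
      (F.constraint _ ht)).1
  refine ⟨_, (tendsto_atTop_ciSup hmono' hbdd).congr' ?_⟩
  filter_upwards [eventually_ge_atTop (a + 1)] with t ht
  simp [max_eq_left ht]

/-- The Barbalat lemma with f the convergent Lyapunov function, g its rate and p = 1/(1 - ⟨S, S*⟩),
in the time given by `clock`. -/
lemma tendsto_lyapunovRate (F : ReducedFlow (2 * (Q + 1) / 3) (Ioi a) s b x w m r H) :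
    Tendsto (fun t => lyapunovRate Q (s t) (b t) (r t)) atTop (𝓝 0) := by
  obtain ⟨l, hl⟩ := F.tendsto_lyapunov hQ
  have hγ : 0 < 2 * (Q + 1) / 3 := by linarith [hQ.1]
  have hγ' : 2 / 3 ≤ 2 * (Q + 1) / 3 := by linarith [hQ.1]
  set g3 := 2 * (Q + 1) / 3
  have hg : ∀ t ∈ Ioi a, HasDerivAt (fun t => lyapunovRate Q (s t) (b t) (r t)) _ t := fun t ht =>
    (((((((F.s_deriv t ht).mul_const (2 - 3 * Q)).sub ((F.b_deriv t ht).mul_const Q)).pow 2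
      ).const_mul ((1 - ropeShearSq Q) / ropeShearSq Q)).add
    (((((((F.s_deriv t ht).mul_const (2 - Q)).add
      ((F.b_deriv t ht).mul_const (4 - 5 * Q))).div_const 6).sub_const (ropeShearSq Q)).pow 2
      ).const_mul (12 / ropeShearSq Q))).add ((F.r_deriv isOpen_Ioi ht).const_mul
        (24 * (1 - ropeShearSq Q) / (2 - Q) * (1 - Q))))
  let sd : (Fin 6 → ℝ) → ℝ := fun v =>
    (-2 * v 2 - 3 * (2 - g3) / 2 * v 4) * v 0 + 4 * v 2 - 2 * v 3
  let bd : (Fin 6 → ℝ) → ℝ := fun v =>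
    (-2 * v 2 - 3 * (2 - g3) / 2 * v 4) * v 1 - 2 * v 2 + 2 * v 5
  let rd : (Fin 6 → ℝ) → ℝ := fun v => -(2 * v 0 * sd v + 2 * v 1 * bd v
      + 2 * (v 0 + v 1) * (sd v + bd v)
      + 2 * (2 * (-2 * v 2 - 3 * (2 - g3) / 2 * v 4 + 2 * v 0 + v 1) * v 3)
      + 6 * (2 * (2 - 2 * v 2 - 3 * (2 - g3) / 2 * v 4 - v 0) * v 2)
      + 6 * ((2 * (3 - 2 * v 2 - 3 * (2 - g3) / 2 * v 4) - 3 * g3) * v 4)) / 2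
  let κ : (Fin 6 → ℝ) → ℝ := fun v =>
    (1 - ropeShearSq Q) / ropeShearSq Q * (2 * (v 0 * (2 - 3 * Q) - v 1 * Q)
      * (sd v * (2 - 3 * Q) - bd v * Q))
    + 12 / ropeShearSq Q * (2 * ((v 0 * (2 - Q) + v 1 * (4 - 5 * Q)) / 6 - ropeShearSq Q)
      * ((sd v * (2 - Q) + bd v * (4 - 5 * Q)) / 6))
    + 24 * (1 - ropeShearSq Q) / (2 - Q) * (1 - Q) * rd v
  have hsd : Continuous sd := by fun_prop
  have hbd : Continuous bd := by fun_prop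
  have hrd : Continuous rd := by fun_prop
  have hκ : Continuous κ := by fun_prop
  obtain ⟨C, hC, hk⟩ := F.exists_bound hκ
  refine tendsto_zero_of_deriv_mul (a := a) (T := clock g3 m H) (H := H)
    (p := fun t => (1 - shearInner Q (s t) (b t))⁻¹) (p₀ := 1 / 13)
    (k := fun t => κ ![s t, b t, x t, w t, m t, r t]) hC (by norm_num)
    (fun t ht => F.hasDerivAt_clock hγ ht) F.H_pos (fun t ht => F.hasDerivAt_lyapunov hQ ht)
    (fun t ht => ?_) (fun t ht => (hg t ht).congr_deriv ?_) hk (F.tendsto_clock hγ') hl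
  · have hc := F.constraint t ht
    have hx := F.x_pos t ht
    have hw := F.w_pos t ht
    have hm := F.m_pos t ht
    have hr := F.r_nonneg t ht
    have hD : 0 < 1 - shearInner Q (s t) (b t) := one_sub_shearInner_pos hQ (by linarith)
    -- The bounds |s|, |b| ≤ 6 give 1 - ⟨S, S*⟩ ≤ 13. The estimate is crude; any positive lower
    -- bound for p would do.
    rw [one_div]
    refine inv_anti₀ hD ?_
    obtain ⟨h1, h2, -⟩ := F.bounds ht
    rw [abs_le] at h1 h2
    obtain ⟨q1, q2⟩ := hQ
    rw [shearInner]
    nlinarith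
  · simp [κ, sd, bd, rd]
    ring

/-- The rate is a sum of nonnegative terms, so r, S ∧ S* and ⟨S, S*⟩ - |S*|² each tend to zero,
which settles s and b. The rate does not see x, w, m separately; these are found from the
requirement that s and b come to rest. -/
lemma tendsto_rope (F : ReducedFlow (2 * (Q + 1) / 3) (Ioi a) s b x w m r H) :
    Tendsto s atTop (𝓝 Q) ∧ Tendsto b atTop (𝓝 (2 - 3 * Q)) ∧
    Tendsto x atTop (𝓝 ((2 - Q) * (3 * Q - 2) / 2)) ∧
    Tendsto w atTop (𝓝 ((2 - Q) * (5 * Q - 4) / 2)) ∧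
    Tendsto m atTop (𝓝 (3 * (1 - Q))) ∧ Tendsto r atTop (𝓝 0) := by
  have h0 := ropeShearSq_pos Q
  have h1 : 0 < 1 - ropeShearSq Q := by linarith [ropeShearSq_lt_one hQ]
  have h2 : 0 < 1 - Q := by linarith [hQ.2]
  have h3 : 0 < 2 - Q := by linarith [hQ.2]
  have hx' : 0 < 3 * Q - 2 := by linarith [hQ.1]
  have hG := F.tendsto_lyapunovRate hQ
  have hγ : 0 < 2 * (Q + 1) / 3 := by linarith [hQ.1]
  have hγ' : 2 / 3 ≤ 2 * (Q + 1) / 3 := by linarith [hQ.1]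
  have hcr : 0 < 24 * (1 - ropeShearSq Q) / (2 - Q) * (1 - Q) := by positivity
  have hcc : 0 < (1 - ropeShearSq Q) / ropeShearSq Q := by positivity
  have hcx : 0 < 12 / ropeShearSq Q := by positivity
  have hrt : Tendsto r atTop (𝓝 0) := by
    have := hG.div_const (24 * (1 - ropeShearSq Q) / (2 - Q) * (1 - Q))
    rw [zero_div] at this
    refine squeeze_zero' ?_ ?_ this
    · filter_upwards [eventually_gt_atTop a] with t ht using F.r_nonneg t ht
    · filter_upwards [eventually_gt_atTop a] with t ht
      rw [le_div_iff₀ hcr, lyapunovRate, mul_comm]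
      have : 0 ≤ (1 - ropeShearSq Q) / ropeShearSq Q * (s t * (2 - 3 * Q) - b t * Q) ^ 2
        + 12 / ropeShearSq Q * (shearInner Q (s t) (b t) - ropeShearSq Q) ^ 2 := by positivity
      linarith
  have sqrt_lim : ∀ f : ℝ → ℝ, Tendsto (fun t => f t ^ 2) atTop (𝓝 0) → Tendsto f atTop (𝓝 0) := by
    intro f hf
    have h3 := hf.sqrt
    simp only [Real.sqrt_sq_eq_abs, Real.sqrt_zero] at h3
    exact tendsto_zero_iff_abs_tendsto_zero _ |>.2 h3
  have hct : Tendsto (fun t => s t * (2 - 3 * Q) - b t * Q) atTop (𝓝 0) := by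
    refine sqrt_lim _ ?_
    have := hG.div_const ((1 - ropeShearSq Q) / ropeShearSq Q)
    rw [zero_div] at this
    refine squeeze_zero' (Eventually.of_forall fun t => sq_nonneg _) ?_ this
    filter_upwards [eventually_gt_atTop a] with t ht
    rw [le_div_iff₀ hcc, lyapunovRate, mul_comm]
    have := F.r_nonneg t ht
    have : 0 ≤ 12 / ropeShearSq Q * (shearInner Q (s t) (b t) - ropeShearSq Q) ^ 2
      + 24 * (1 - ropeShearSq Q) / (2 - Q) * (1 - Q) * r t := by positivity
    linarith
  have hXt : Tendsto (fun t => shearInner Q (s t) (b t) - ropeShearSq Q) atTop (𝓝 0) := by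
    refine sqrt_lim _ ?_
    have := hG.div_const (12 / ropeShearSq Q)
    rw [zero_div] at this
    refine squeeze_zero' (Eventually.of_forall fun t => sq_nonneg _) ?_ this
    filter_upwards [eventually_gt_atTop a] with t ht
    rw [le_div_iff₀ hcx, lyapunovRate, mul_comm]
    have := F.r_nonneg t ht
    have : 0 ≤ (1 - ropeShearSq Q) / ropeShearSq Q * (s t * (2 - 3 * Q) - b t * Q) ^ 2
      + 24 * (1 - ropeShearSq Q) / (2 - Q) * (1 - Q) * r t := by positivity
    linarith
  have hst : Tendsto s atTop (𝓝 Q) := by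
    have h := (((hXt.const_mul Q).add (hct.const_mul ((4 - 5 * Q) / 6))).div_const
      (ropeShearSq Q)).add_const Q
    have e : (Q * 0 + (4 - 5 * Q) / 6 * 0) / ropeShearSq Q + Q = Q := by ring
    rw [e] at h
    refine h.congr fun t => ?_
    field_simp
    rw [ropeShearSq, shearInner]; ring
  have hbt : Tendsto b atTop (𝓝 (2 - 3 * Q)) := by
    have h := (((hXt.const_mul (2 - 3 * Q)).sub (hct.const_mul ((2 - Q) / 6))).div_const
      (ropeShearSq Q)).add_const (2 - 3 * Q)
    have e : ((2 - 3 * Q) * 0 - (2 - Q) / 6 * 0) / ropeShearSq Q + (2 - 3 * Q) = 2 - 3 * Q := by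
      ring
    rw [e] at h
    refine h.congr fun t => ?_
    field_simp
    rw [ropeShearSq, shearInner]; ring
  have hyb : ∃ C, ∀ t ∈ Ioi a, |-2 * x t - (2 - Q) * m t| ≤ C := by
    obtain ⟨C, -, hC⟩ := F.exists_bound (κ := fun v => -2 * v 2 - (2 - Q) * v 4) (by fun_prop)
    exact ⟨C, by simpa using hC⟩
  obtain ⟨Cy, hCy⟩ := hyb
  have mul_lim : ∀ f : ℝ → ℝ, Tendsto f atTop (𝓝 0) →
      Tendsto (fun t => (-2 * x t - (2 - Q) * m t) * f t) atTop (𝓝 0) := by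
    intro f hf
    refine squeeze_zero_norm' (a := fun t => Cy * |f t|) ?_ ?_
    · filter_upwards [eventually_gt_atTop a] with t ht
      rw [Real.norm_eq_abs, abs_mul]
      exact mul_le_mul_of_nonneg_right (hCy t ht) (abs_nonneg _)
    · simpa using hf.abs.const_mul Cy
  have hF2 : 3 * (2 - 2 * (Q + 1) / 3) / 2 = 2 - Q := by ring
  have hF3 : 3 * (2 * (Q + 1) / 3) = 2 * (Q + 1) := by ring
  have hsD := F.s_deriv
  have hbD := F.b_deriv
  have hxD := F.x_deriv
  have hwD := F.w_deriv
  have hmD := F.m_deriv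
  have hrD := fun t ht => F.r_deriv isOpen_Ioi (t := t) ht
  simp only [hF2, hF3] at hsD hbD hxD hwD hmD hrD
  let sd : (Fin 6 → ℝ) → ℝ := fun v => (-2 * v 2 - (2 - Q) * v 4) * v 0 + 4 * v 2 - 2 * v 3
  let bd : (Fin 6 → ℝ) → ℝ := fun v => (-2 * v 2 - (2 - Q) * v 4) * v 1 - 2 * v 2 + 2 * v 5
  let xd : (Fin 6 → ℝ) → ℝ := fun v => 2 * (2 - 2 * v 2 - (2 - Q) * v 4 - v 0) * v 2
  let wd : (Fin 6 → ℝ) → ℝ := fun v => 2 * (-2 * v 2 - (2 - Q) * v 4 + 2 * v 0 + v 1) * v 3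
  let md : (Fin 6 → ℝ) → ℝ := fun v => (2 * (3 - 2 * v 2 - (2 - Q) * v 4) - 2 * (Q + 1)) * v 4
  let rd : (Fin 6 → ℝ) → ℝ := fun v => -(2 * v 0 * sd v + 2 * v 1 * bd v
      + 2 * (v 0 + v 1) * (sd v + bd v) + 2 * wd v + 6 * xd v + 6 * md v) / 2
  let κ₁ : (Fin 6 → ℝ) → ℝ := fun v => (-2 * xd v - (2 - Q) * md v) * v 0
    + (-2 * v 2 - (2 - Q) * v 4) * sd v + 4 * xd v - 2 * wd v
  let κ₂ : (Fin 6 → ℝ) → ℝ := fun v => (-2 * xd v - (2 - Q) * md v) * v 1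
    + (-2 * v 2 - (2 - Q) * v 4) * bd v - 2 * xd v + 2 * rd v
  have c1 : Continuous sd := by fun_prop
  have c2 : Continuous bd := by fun_prop
  have c3 : Continuous xd := by fun_prop
  have c4 : Continuous wd := by fun_prop
  have c5 : Continuous md := by fun_prop
  have c6 : Continuous rd := by fun_prop
  have c7 : Continuous κ₁ := by fun_prop
  have c8 : Continuous κ₂ := by fun_prop
  obtain ⟨C₁, hC₁, hk₁⟩ := F.exists_bound c7
  obtain ⟨C₂, hC₂, hk₂⟩ := F.exists_bound c8
  -- Barbalat once more, with p = 1: s converges and its second derivative in clock time is bounded,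
  -- so its first derivative tends to zero.
  have e1 : Tendsto (fun t => (-2 * x t - (2 - Q) * m t) * s t + 4 * x t - 2 * w t) atTop
      (𝓝 0) := by
    refine tendsto_zero_of_deriv_mul (a := a) (T := clock _ m H) (H := H) (p := fun _ => 1)
      (p₀ := 1) (k := fun t => κ₁ ![s t, b t, x t, w t, m t, r t]) hC₁ one_pos
      (fun t ht => F.hasDerivAt_clock hγ ht) F.H_pos
      (fun t ht => (hsD t ht).congr_deriv (by ring)) (fun _ _ => le_rfl)
      (fun t ht => ((((((hxD t ht).const_mul (-2)).sub ((hmD t ht).const_mul (2 - Q))).mul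
        (hsD t ht)).add ((hxD t ht).const_mul 4)).sub ((hwD t ht).const_mul 2)).congr_deriv ?_)
      hk₁ (F.tendsto_clock hγ') hst
    simp [κ₁, sd, bd, xd, wd, md, rd]
    ring
  have e2 : Tendsto (fun t => (-2 * x t - (2 - Q) * m t) * b t - 2 * x t + 2 * r t) atTop
      (𝓝 0) := by
    refine tendsto_zero_of_deriv_mul (a := a) (T := clock _ m H) (H := H) (p := fun _ => 1)
      (p₀ := 1) (k := fun t => κ₂ ![s t, b t, x t, w t, m t, r t]) hC₂ one_pos
      (fun t ht => F.hasDerivAt_clock hγ ht) F.H_pos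
      (fun t ht => (hbD t ht).congr_deriv (by ring)) (fun _ _ => le_rfl)
      (fun t ht => ((((((hxD t ht).const_mul (-2)).sub ((hmD t ht).const_mul (2 - Q))).mul
        (hbD t ht)).sub ((hxD t ht).const_mul 2)).add ((hrD t ht).const_mul 2)).congr_deriv ?_)
      hk₂ (F.tendsto_clock hγ') hbt
    simp [κ₂, sd, bd, xd, wd, md, rd]
    ring
  have f1 : Tendsto (fun t => (-2 * x t - (2 - Q) * m t) * Q + 4 * x t - 2 * w t) atTop
      (𝓝 0) := by
    have := e1.sub (mul_lim (fun t => s t - Q) (by simpa using hst.sub_const Q))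
    rw [sub_zero] at this
    exact this.congr fun t => by ring
  have f2 : Tendsto (fun t => (-2 * x t - (2 - Q) * m t) * (2 - 3 * Q) - 2 * x t) atTop
      (𝓝 0) := by
    have := (e2.sub (mul_lim (fun t => b t - (2 - 3 * Q))
      (by simpa using hbt.sub_const (2 - 3 * Q)))).sub (hrt.const_mul 2)
    rw [sub_zero, mul_zero, sub_zero] at this
    exact this.congr fun t => by ring
  have f3 : Tendsto (fun t => 2 * w t + 6 * x t + 6 * m t - 6 * (1 - ropeShearSq Q)) atTop
      (𝓝 0) := by
    have := ((((hst.pow 2).add (hbt.pow 2)).add ((hst.add hbt).pow 2)).add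
      (hrt.const_mul 2)).const_sub (6 * ropeShearSq Q)
    rw [show 6 * ropeShearSq Q - (Q ^ 2 + (2 - 3 * Q) ^ 2 + (Q + (2 - 3 * Q)) ^ 2 + 2 * 0) = 0 by
      rw [ropeShearSq]; ring] at this
    refine this.congr' ?_
    filter_upwards [eventually_gt_atTop a] with t ht
    linarith [F.constraint t ht]
  -- `f1`, `f2`, `f3` are asymptotic linear equations for x, w, m. Adding `f1` and `f3` eliminates
  -- w; together with `f2` this leaves two equations whose determinant is a nonzero multiple of 1 -
  -- |S*|².
  have hxt : Tendsto x atTop (𝓝 ((2 - Q) * (3 * Q - 2) / 2)) := by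
    have h := ((((f1.add f3).const_mul ((2 - Q) * (3 * Q - 2))).sub
      (f2.const_mul (6 - (2 - Q) * Q))).div_const (12 * (1 - ropeShearSq Q))).add_const
      ((2 - Q) * (3 * Q - 2) / 2)
    refine (h.congr fun t => ?_).trans_eq (by simp)
    field_simp
    rw [ropeShearSq]; ring
  have hmt : Tendsto m atTop (𝓝 (3 * (1 - Q))) := by
    have h := ((((f1.add f3).const_mul (6 * (1 - Q))).add
      (f2.const_mul (10 - 2 * Q))).div_const (12 * (1 - ropeShearSq Q))).add_const
      (3 * (1 - Q))
    refine (h.congr fun t => ?_).trans_eq (by simp)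
    field_simp
    rw [ropeShearSq]; ring
  have hwt : Tendsto w atTop (𝓝 ((2 - Q) * (5 * Q - 4) / 2)) := by
    have h := ((f3.sub (hxt.const_mul 6)).sub (hmt.const_mul 6)).div_const 2 |>.add_const
      (3 * (1 - ropeShearSq Q))
    refine (h.congr fun t => by ring).trans_eq ?_
    congr 1
    rw [ropeShearSq]; ring
  exact ⟨hst, hbt, hxt, hwt, hmt, hrt⟩

end Convergence

end ReducedFlow

end JFormCosmology

/-! ### The Rope as a limit state. -/

namespace JFormCosmology

/-- The Hubble-normalized state of the Rope with deceleration parameter `Q`. -/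
noncomputable def ropeState (Q : ℝ) : HState :=
  canonState Q (2 - 3 * Q) (Real.sqrt ((2 - Q) * (3 * Q - 2) / 2))
    (Real.sqrt ((2 - Q) * (5 * Q - 4) / 2)) 0 (3 * (1 - Q))

lemma continuous_canonState :
    Continuous fun v : ℝ × ℝ × ℝ × ℝ × ℝ × ℝ =>
      canonState v.1 v.2.1 v.2.2.1 v.2.2.2.1 v.2.2.2.2.1 v.2.2.2.2.2 := by
  unfold canonState
  refine Continuous.prodMk ?_ (Continuous.prodMk ?_ (by fun_prop))
  · refine continuous_matrix fun i j => ?_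
    fin_cases i <;> fin_cases j <;> simp <;> fun_prop
  · refine continuous_pi fun i => ?_
    fin_cases i <;> simp <;> fun_prop

lemma tendsto_canonState {α : Type*} {l : Filter α} {s b v w r m : α → ℝ} {s₀ b₀ v₀ w₀ r₀ m₀ : ℝ}
    (hs : Tendsto s l (𝓝 s₀)) (hb : Tendsto b l (𝓝 b₀)) (hv : Tendsto v l (𝓝 v₀))
    (hw : Tendsto w l (𝓝 w₀)) (hr : Tendsto r l (𝓝 r₀)) (hm : Tendsto m l (𝓝 m₀)) :
    Tendsto (fun t => canonState (s t) (b t) (v t) (w t) (r t) (m t)) l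
      (𝓝 (canonState s₀ b₀ v₀ w₀ r₀ m₀)) :=
  (continuous_canonState.tendsto (s₀, b₀, v₀, w₀, r₀, m₀)).comp
    (hs.prodMk_nhds (hb.prodMk_nhds (hv.prodMk_nhds (hw.prodMk_nhds (hr.prodMk_nhds hm)))))

/-- Rotating solutions converge to the Rope. -/
theorem exists_frames_tendsto_ropeState {Q a : ℝ} (hQ : Q ∈ Ioo (4 / 5 : ℝ) 1)
    {h : SpatialMetric} {J : ℝ → Fin 4 → ℝ} {ρ : ℝ → ℝ}
    (hr : IsRotatingSolution (2 * (Q + 1) / 3) (Ioi a) h J ρ) :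
    ∃ E : ℝ → Matrix (Fin 3) (Fin 3) ℝ, (∀ t > a, IsOrthonormalFrame h t (E t)) ∧
      Tendsto (fun t => hState h J ρ t (E t)) atTop (𝓝 (ropeState Q)) := by
  have R := hr.rotatingOn isOpen_Ioi ordConnected_Ioi
  obtain ⟨h1, h2, h3, h4, h5, h6⟩ := (R.reducedFlow isOpen_Ioi).tendsto_rope hQ
  have hex : ∀ t, ∃ r : ℝ, ∃ E : Matrix (Fin 3) (Fin 3) ℝ, a < t → planeShear h J ρ t = r ^ 2 ∧
      IsOrthonormalFrame h t E ∧
      hState h J ρ t E = canonState (axialShear h J t) (normalShear h J t)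
        (Real.sqrt (formEnergy h J t)) (Real.sqrt (twistShear h J t)) r (densityParam h ρ t) := by
    intro t
    by_cases ht : a < t
    · obtain ⟨-, -, -, r, hr, ⟨E, hE, hS⟩, -⟩ := R.exists_frame_canonical isOpen_Ioi ht
      exact ⟨r, E, fun _ => ⟨hr, hE, hS⟩⟩
    · exact ⟨0, 1, fun h => absurd h ht⟩
  choose r E hrE using hex
  refine ⟨E, fun t ht => (hrE t ht).2.1, ?_⟩
  -- The sign of r may jump with the chosen frame, but its square is `planeShear`, which tends to
  -- zero.
  have hr0 : Tendsto r atTop (𝓝 0) := by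
    have h7 := h6.sqrt
    rw [Real.sqrt_zero] at h7
    refine (tendsto_zero_iff_abs_tendsto_zero _).2 (h7.congr' ?_)
    filter_upwards [eventually_gt_atTop a] with t ht
    rw [(hrE t ht).1, Real.sqrt_sq_eq_abs]; rfl
  refine (tendsto_canonState h1 h2 h3.sqrt h4.sqrt hr0 h5).congr' ?_
  filter_upwards [eventually_gt_atTop a] with t ht using (hrE t ht).2.2.symm

/-! ### Rotation invariants of a state -/

namespace HState

/-- The moments of the `j`-form with respect to the normalized expansion. -/
def moment (x : HState) (n : ℕ) : ℝ := x.2.1 ⬝ᵥ ((x.1 + 1) ^ n *ᵥ x.2.1)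

noncomputable def axial (x : HState) : ℝ := x.moment 1 / x.moment 0 - 1

noncomputable def twistSq (x : HState) : ℝ :=
  x.moment 2 / x.moment 0 - (x.moment 1 / x.moment 0) ^ 2

noncomputable def normal (x : HState) : ℝ :=
  -x.axial - ((x.moment 3 / x.moment 0 - (x.moment 1 / x.moment 0) ^ 3
    - 2 * (x.moment 1 / x.moment 0) * x.twistSq) / x.twistSq - 1)

lemma continuous_moment (n : ℕ) : Continuous fun x : HState => x.moment n := by
  unfold moment
  fun_prop

lemma scalars_canonState {s b v w r Ω : ℝ} (hv : v ≠ 0) (hw : w ≠ 0) :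
    (canonState s b v w r Ω).moment 0 = v ^ 2 ∧ (canonState s b v w r Ω).axial = s ∧
    (canonState s b v w r Ω).twistSq = w ^ 2 ∧ (canonState s b v w r Ω).normal = b := by
  have ha : (canonState s b v w r Ω).1 + 1 =
      !![1 + s, 0, w; 0, 1 + b, r; w, r, 1 - s - b] := by
    ext i j
    fin_cases i <;> fin_cases j <;> simp [canonState, Matrix.one_apply] <;> ring
  obtain ⟨m0, m1, m2, m3, -⟩ := canonical_moments _ ha _
    (show (canonState s b v w r Ω).2.1 = ![v, 0, 0] from rfl)
  change moment _ 0 = _ at m0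
  change moment _ 1 = _ at m1
  change moment _ 2 = _ at m2
  change moment _ 3 = _ at m3
  have ht : (canonState s b v w r Ω).twistSq = w ^ 2 := by
    rw [twistSq, m0, m1, m2]; field_simp; ring
  have hx : (canonState s b v w r Ω).axial = s := by
    rw [axial, m0, m1]; field_simp; ring
  refine ⟨m0, hx, ht, ?_⟩
  rw [normal, ht, hx, m0, m1, m3]; field_simp; ring

end HState

/-- The n-th moment of the solution is 6 H^(n+2) times that of the state, and H cancels in the
scalars. Thus they can be read off from the state in any orthonormal frame, which lets the Lyapunov
function be defined on states. -/
lemma scalars_hState {h : SpatialMetric} {J : ℝ → Fin 4 → ℝ} {ρ : ℝ → ℝ} {t : ℝ}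
    {E : Matrix (Fin 3) (Fin 3) ℝ} (hE : IsOrthonormalFrame h t E) (hH : hubble h t ≠ 0) :
    formEnergy h J t = (hState h J ρ t E).moment 0 ∧
    axialShear h J t = (hState h J ρ t E).axial ∧
    twistShear h J t = (hState h J ρ t E).twistSq ∧
    normalShear h J t = (hState h J ρ t E).normal := by
  set H := hubble h t with hHdef
  have hsq : Real.sqrt 6 ^ 2 = 6 := Real.sq_sqrt (by norm_num)
  have hm : ∀ n, moment h J n t = 6 * H ^ (n + 2) * (hState h J ρ t E).moment n := by
    intro n
    have h1 : frameExpansion h t E = H • ((hState h J ρ t E).1 + 1) := by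
      rw [hState_eq, sub_add_cancel, smul_smul, mul_inv_cancel₀ hH, one_smul]
    have h2 : frameForm J t E = (Real.sqrt 6 * H) • (hState h J ρ t E).2.1 := by
      rw [hState_eq]
      simp only [smul_smul]
      rw [mul_inv_cancel₀ (mul_ne_zero (by positivity) hH), one_smul]
    rw [moment_frame hE, h1, h2, HState.moment, smul_pow, Matrix.smul_mulVec, Matrix.mulVec_smul,
      smul_dotProduct, dotProduct_smul, dotProduct_smul]
    simp only [smul_eq_mul]
    linear_combination H ^ (n + 2) * ((hState h J ρ t E).2.1 ⬝ᵥ ((hState h J ρ t E).1 + 1) ^ n *ᵥ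
      (hState h J ρ t E).2.1) * hsq
  have hm0 : moment h J 0 t = 6 * H ^ 2 * (hState h J ρ t E).moment 0 := hm 0
  have hm1 : moment h J 1 t = 6 * H ^ 3 * (hState h J ρ t E).moment 1 := hm 1
  have hm2 : moment h J 2 t = 6 * H ^ 4 * (hState h J ρ t E).moment 2 := hm 2
  have hm3 : moment h J 3 t = 6 * H ^ 5 * (hState h J ρ t E).moment 3 := hm 3
  have hA : axialRate h J t = H * ((hState h J ρ t E).moment 1 / (hState h J ρ t E).moment 0) := by
    rw [axialRate, hm1, hm0]; field_simp
  have hW : twistRate h J t = H ^ 2 * (hState h J ρ t E).twistSq := by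
    rw [twistRate, hA, HState.twistSq, hm2, hm0]; field_simp
  have hs : axialShear h J t = (hState h J ρ t E).axial := by
    rw [axialShear, hA, HState.axial, ← hHdef]; field_simp
  refine ⟨?_, hs, ?_, ?_⟩
  · rw [formEnergy, hm0, ← hHdef]; field_simp
  · rw [twistShear, hW, ← hHdef]; field_simp
  · rw [normalShear, hs, HState.normal, transverseShear, transverseRate, hA, hW, hm3, hm0, ← hHdef]
    field_simp

/-! ### Stability of the Rope state. -/

section Stability

variable {Q : ℝ}

/-- Admissible states with a large value of the Lyapunov function are close to the Rope. -/
lemma exists_lt_ropeLyapunov (hQ : Q ∈ Ioo (4 / 5 : ℝ) 1) {N : Set HState}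
    (hN : N ∈ 𝓝 (ropeState Q)) :
    ∃ c < ropeLyapunov Q, ∀ s b x w m r : ℝ, 0 < x → 0 < w → 0 < m →
      s ^ 2 + b ^ 2 + (s + b) ^ 2 + 2 * w + 2 * r ^ 2 + 6 * x + 6 * m = 6 →
      c < lyapunov Q s b x w m → canonState s b (Real.sqrt x) (Real.sqrt w) r m ∈ N := by
  have ax : 0 < 9 * Q - 6 := by linarith [hQ.1]
  have aw : 0 < 5 * Q - 4 := by linarith [hQ.1]
  have h2Q : 0 < 2 - Q := by linarith [hQ.2]
  have h1Q : 0 < 1 - Q := by linarith [hQ.2]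
  have am : 0 < 18 * (1 - Q) / (2 - Q) := by positivity
  -- The compact closure of the admissible set: x, w, m may vanish. The last coordinate is the shear
  -- entry r itself, not its square.
  set K : Set (Fin 6 → ℝ) := {v | 0 ≤ v 2 ∧ 0 ≤ v 3 ∧ 0 ≤ v 4 ∧
    v 0 ^ 2 + v 1 ^ 2 + (v 0 + v 1) ^ 2 + 2 * v 3 + 2 * v 5 ^ 2 + 6 * v 2 + 6 * v 4 = 6} with hK
  have hKsq : ∀ v ∈ K, v 0 ^ 2 + v 1 ^ 2 + (v 0 + v 1) ^ 2 ≤ 6 := by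
    rintro v ⟨h1, h2, h3, h4⟩
    linarith [sq_nonneg (v 5)]
  have hKclosed : IsClosed K := by
    simp only [hK, ofPred_and]
    exact (isClosed_le continuous_const (continuous_apply 2)).inter
      ((isClosed_le continuous_const (continuous_apply 3)).inter
        ((isClosed_le continuous_const (continuous_apply 4)).inter
          (isClosed_eq (by fun_prop) continuous_const)))
  have hKcompact : IsCompact K := by
    refine (isCompact_closedBall (0 : Fin 6 → ℝ) 6).of_isClosed_subset hKclosed ?_
    rintro v ⟨h1, h2, h3, h4⟩
    rw [mem_closedBall_zero_iff, pi_norm_le_iff_of_nonneg (by norm_num)]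
    have p0 := sq_nonneg (v 0)
    have p1 := sq_nonneg (v 1)
    have p2 := sq_nonneg (v 0 + v 1)
    have p3 := sq_nonneg (v 5)
    intro i
    rw [Real.norm_eq_abs]
    fin_cases i
    · exact abs_le_of_sq_le_sq (by norm_num; linarith) (by norm_num)
    · exact abs_le_of_sq_le_sq (by norm_num; linarith) (by norm_num)
    · exact (abs_of_nonneg h1).trans_le (by linarith)
    · exact (abs_of_nonneg h2).trans_le (by linarith)
    · exact (abs_of_nonneg h3).trans_le (by linarith)
    · exact abs_le_of_sq_le_sq (a := v 5) (by norm_num; linarith) (by norm_num)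
  let c : (Fin 6 → ℝ) → HState := fun v =>
    canonState (v 0) (v 1) (Real.sqrt (v 2)) (Real.sqrt (v 3)) (v 5) (v 4)
  have hc : Continuous c := continuous_canonState.comp
    (f := fun v : Fin 6 → ℝ => (v 0, v 1, Real.sqrt (v 2), Real.sqrt (v 3), v 5, v 4))
    (by fun_prop)
  -- The exponential of the Lyapunov function. All three exponents are positive, so it extends
  -- continuously by zero to the faces where x, w or m vanishes, and it attains its maximum on the
  -- compact set of states outside the neighbourhood.
  let M : (Fin 6 → ℝ) → ℝ := fun v => v 2 ^ (9 * Q - 6) * v 3 ^ (5 * Q - 4)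
    * v 4 ^ (18 * (1 - Q) / (2 - Q))
    * (1 - shearInner Q (v 0) (v 1)) ^ (-(12 * (1 - ropeShearSq Q) / (2 - Q)))
  have hMc : ContinuousOn M K := by
    refine ContinuousOn.mul (ContinuousOn.mul (ContinuousOn.mul ?_ ?_) ?_) ?_
    · exact ContinuousOn.rpow_const (by fun_prop) fun v _ => Or.inr ax.le
    · exact ContinuousOn.rpow_const (by fun_prop) fun v _ => Or.inr aw.le
    · exact ContinuousOn.rpow_const (by fun_prop) fun v _ => Or.inr am.le
    · refine ContinuousOn.rpow_const (by unfold shearInner; fun_prop) fun v hv => Or.inl ?_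
      exact (one_sub_shearInner_pos hQ (hKsq v hv)).ne'
  have hMexp : ∀ v ∈ K, 0 < v 2 → 0 < v 3 → 0 < v 4 →
      M v = Real.exp (lyapunov Q (v 0) (v 1) (v 2) (v 3) (v 4)) := by
    intro v hv h2 h3 h4
    have hD := one_sub_shearInner_pos hQ (hKsq v hv)
    simp only [M]
    rw [Real.rpow_def_of_pos h2, Real.rpow_def_of_pos h3, Real.rpow_def_of_pos h4,
      Real.rpow_def_of_pos hD, ← Real.exp_add, ← Real.exp_add, ← Real.exp_add, lyapunov]
    congr 1
    ring
  have hlt : ∀ v ∈ K, c v ∉ interior N → M v < Real.exp (ropeLyapunov Q) := by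
    intro v hv hcv
    by_cases hpos : 0 < v 2 ∧ 0 < v 3 ∧ 0 < v 4
    · obtain ⟨h2, h3, h4⟩ := hpos
      rw [hMexp v hv h2 h3 h4, Real.exp_lt_exp]
      obtain ⟨hle, heq⟩ := lyapunov_le hQ h2 h3 h4 (sq_nonneg (v 5)) hv.2.2.2
      refine lt_of_le_of_ne hle fun he => hcv ?_
      have P := heq he
      have hr : v 5 = 0 := pow_eq_zero_iff two_ne_zero |>.1 P.r_eq
      have : c v = ropeState Q := by
        simp only [c, ropeState, P.s_eq, P.b_eq, P.x_eq, P.w_eq, P.m_eq, hr]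
      rw [this]
      exact mem_interior_iff_mem_nhds.2 hN
    · have h0 : M v = 0 := by
        obtain ⟨h2, h3, h4, -⟩ := hv
        simp only [M]
        rcases h2.eq_or_lt with h | h2
        · rw [← h, Real.zero_rpow ax.ne']; ring
        rcases h3.eq_or_lt with h | h3
        · rw [← h, Real.zero_rpow aw.ne']; ring
        rcases h4.eq_or_lt with h | h4
        · rw [← h, Real.zero_rpow am.ne']; ring
        exact absurd ⟨h2, h3, h4⟩ hpos
      rw [h0]; positivity
  have hCc : IsCompact (K ∩ c ⁻¹' (interior N)ᶜ) :=
    hKcompact.inter_right (isOpen_interior.isClosed_compl.preimage hc)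
  obtain ⟨M₀, hM₀, hMle⟩ : ∃ M₀ < Real.exp (ropeLyapunov Q),
      ∀ v ∈ K, c v ∉ interior N → M v ≤ M₀ := by
    rcases (K ∩ c ⁻¹' (interior N)ᶜ).eq_empty_or_nonempty with he | hne
    · refine ⟨0, by positivity, fun v hv hcv => ?_⟩
      exact absurd (show v ∈ K ∩ c ⁻¹' (interior N)ᶜ from ⟨hv, hcv⟩) (by rw [he]; simp)
    · obtain ⟨v₀, hv₀, hmax⟩ := hCc.exists_isMaxOn hne (hMc.mono inter_subset_left)
      exact ⟨M v₀, hlt v₀ hv₀.1 hv₀.2, fun v hv hcv => hmax ⟨hv, hcv⟩⟩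
  have hexp := Real.exp_pos (ropeLyapunov Q)
  -- Raised to a positive number, still below the value at the Rope, so that its logarithm can serve
  -- as threshold.
  set M₁ := max M₀ (Real.exp (ropeLyapunov Q) / 2) with hM₁
  have hM₁pos : 0 < M₁ := lt_of_lt_of_le (by positivity) (le_max_right _ _)
  refine ⟨Real.log M₁, ?_, fun s b x w m r hx hw hm hcon hlyap => ?_⟩
  · rw [Real.log_lt_iff_lt_exp hM₁pos]
    exact max_lt hM₀ (by linarith)
  · by_contra hnot
    have hv : (![s, b, x, w, m, r] : Fin 6 → ℝ) ∈ K := ⟨hx.le, hw.le, hm.le, by simpa using hcon⟩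
    have h1 := hMle _ hv (fun hi => hnot (interior_subset hi))
    rw [hMexp _ hv hx hw hm] at h1
    rw [Real.log_lt_iff_lt_exp hM₁pos] at hlyap
    exact absurd hlyap (not_lt.2 (h1.trans (le_max_left _ _)))

lemma isOpen_isRotating : IsOpen {x : HState | IsRotating x} := by
  simp only [isRotating_iff_cross, ofPred_and]
  refine (isOpen_lt continuous_const (by fun_prop)).inter (isOpen_ne_fun ?_ continuous_const)
  simp only [cross_apply]
  refine continuous_pi fun i => ?_
  fin_cases i <;> simp <;> fun_prop

lemma ropeState_v_pos (hQ : Q ∈ Ioo (4 / 5 : ℝ) 1) :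
    0 < Real.sqrt ((2 - Q) * (3 * Q - 2) / 2) :=
  Real.sqrt_pos.2 (div_pos (mul_pos (by linarith [hQ.2]) (by linarith [hQ.1])) two_pos)

lemma ropeState_w_pos (hQ : Q ∈ Ioo (4 / 5 : ℝ) 1) :
    0 < Real.sqrt ((2 - Q) * (5 * Q - 4) / 2) :=
  Real.sqrt_pos.2 (div_pos (mul_pos (by linarith [hQ.2]) (by linarith [hQ.1])) two_pos)

lemma isRotating_canonState {s b v w r Ω : ℝ} (hv : v ≠ 0) (hw : w ≠ 0) (hΩ : 0 < Ω) :
    IsRotating (canonState s b v w r Ω) := by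
  refine isRotating_iff_cross.2 ⟨hΩ, fun h0 => ?_⟩
  have h1 := congrFun h0 1
  simp [canonState, cross_apply, Matrix.mulVec, dotProduct, Fin.sum_univ_three, hv, hw] at h1

lemma isRotating_ropeState (hQ : Q ∈ Ioo (4 / 5 : ℝ) 1) : IsRotating (ropeState Q) :=
  isRotating_canonState (ropeState_v_pos hQ).ne' (ropeState_w_pos hQ).ne' (by linarith [hQ.2])

lemma ropeState_mem_spatialStates (hQ : Q ∈ Ioo (4 / 5 : ℝ) 1) :
    ropeState Q ∈ spatialStates := by
  have h1 := Real.sq_sqrt (Real.sqrt_pos.1 (ropeState_v_pos hQ)).le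
  have h2 := Real.sq_sqrt (Real.sqrt_pos.1 (ropeState_w_pos hQ)).le
  refine ⟨?_, ?_, rfl, ?_, ?_⟩
  · rw [Matrix.IsSymm]
    ext i j
    fin_cases i <;> fin_cases j <;> simp [ropeState, canonState]
  · simp [ropeState, canonState, Matrix.trace, Fin.sum_univ_three]
  · simp only [ropeState, canonState]; linarith [hQ.2]
  · simp only [ropeState, canonState, Fin.sum_univ_three]
    simp only [Matrix.of_apply, Matrix.cons_val_zero, Matrix.cons_val_one, Matrix.cons_val]
    rw [h1, h2]
    ring

/-- The Lyapunov function of a state. -/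
noncomputable def stateLyapunov (Q : ℝ) (x : HState) : ℝ :=
  lyapunov Q x.axial x.normal (x.moment 0) x.twistSq x.2.2.2

lemma scalars_ropeState (hQ : Q ∈ Ioo (4 / 5 : ℝ) 1) :
    (ropeState Q).moment 0 = (2 - Q) * (3 * Q - 2) / 2 ∧ (ropeState Q).axial = Q ∧
    (ropeState Q).twistSq = (2 - Q) * (5 * Q - 4) / 2 ∧ (ropeState Q).normal = 2 - 3 * Q := by
  obtain ⟨h1, h2, h3, h4⟩ := HState.scalars_canonState (s := Q) (b := 2 - 3 * Q) (r := 0)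
    (Ω := 3 * (1 - Q)) (ropeState_v_pos hQ).ne' (ropeState_w_pos hQ).ne'
  rw [Real.sq_sqrt (Real.sqrt_pos.1 (ropeState_v_pos hQ)).le] at h1
  rw [Real.sq_sqrt (Real.sqrt_pos.1 (ropeState_w_pos hQ)).le] at h3
  exact ⟨h1, h2, h3, h4⟩

lemma stateLyapunov_ropeState (hQ : Q ∈ Ioo (4 / 5 : ℝ) 1) :
    stateLyapunov Q (ropeState Q) = ropeLyapunov Q := by
  obtain ⟨h1, h2, h3, h4⟩ := scalars_ropeState hQ
  rw [stateLyapunov, h1, h2, h3, h4]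
  rfl

lemma continuousAt_stateLyapunov (hQ : Q ∈ Ioo (4 / 5 : ℝ) 1) :
    ContinuousAt (stateLyapunov Q) (ropeState Q) := by
  obtain ⟨h1, h2, h3, h4⟩ := scalars_ropeState hQ
  have hx : (ropeState Q).moment 0 ≠ 0 := by
    rw [h1]; exact (Real.sqrt_pos.1 (ropeState_v_pos hQ)).ne'
  have hw : (ropeState Q).twistSq ≠ 0 := by
    rw [h3]; exact (Real.sqrt_pos.1 (ropeState_w_pos hQ)).ne'
  have c0 := (HState.continuous_moment 0).continuousAt (x := ropeState Q)
  have c1 := (HState.continuous_moment 1).continuousAt (x := ropeState Q)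
  have c2 := (HState.continuous_moment 2).continuousAt (x := ropeState Q)
  have c3 := (HState.continuous_moment 3).continuousAt (x := ropeState Q)
  have ca : ContinuousAt HState.axial (ropeState Q) := (c1.div c0 hx).sub continuousAt_const
  have ct : ContinuousAt HState.twistSq (ropeState Q) :=
    (c2.div c0 hx).sub ((c1.div c0 hx).pow 2)
  have cn : ContinuousAt HState.normal (ropeState Q) :=
    ca.neg.sub (((((c3.div c0 hx).sub ((c1.div c0 hx).pow 3)).sub
      ((continuousAt_const.mul (c1.div c0 hx)).mul ct)).div ct hw).sub continuousAt_const)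
  have hD : 1 - shearInner Q (ropeState Q).axial (ropeState Q).normal ≠ 0 := by
    rw [h2, h4, shearInner_rope]
    linarith [ropeShearSq_lt_one hQ]
  have cD : ContinuousAt (fun x : HState => 1 - shearInner Q x.axial x.normal) (ropeState Q) :=
    continuousAt_const.sub (((ca.mul continuousAt_const).add
      (cn.mul continuousAt_const)).div_const 6)
  have hm : (ropeState Q).2.2.2 ≠ 0 := by
    simp only [ropeState, canonState]; linarith [hQ.2]
  have cm : ContinuousAt (fun x : HState => x.2.2.2) (ropeState Q) := by fun_prop
  exact ((((continuousAt_const.mul (c0.log hx)).add (continuousAt_const.mul (ct.log hw))).add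
    (continuousAt_const.mul (cm.log hm))).sub (continuousAt_const.mul (cD.log hD)))

/-- N' consists of the rotating states whose Lyapunov value exceeds the threshold of
`exists_lt_ropeLyapunov`. The value cannot decrease along the solution, so every later state, in its
canonical frame, lies in N. -/
theorem isStableState_ropeState (hQ : Q ∈ Ioo (4 / 5 : ℝ) 1) :
    IsStableState (2 * (Q + 1) / 3) (ropeState Q) := by
  intro N hN
  obtain ⟨c, hc, hcN⟩ := exists_lt_ropeLyapunov hQ hN
  refine ⟨{x | IsRotating x} ∩ {x | c < stateLyapunov Q x}, inter_mem
    (isOpen_isRotating.mem_nhds (isRotating_ropeState hQ))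
    ((continuousAt_stateLyapunov hQ).eventually_const_lt
      (by rw [stateLyapunov_ropeState hQ]; exact hc)), ?_⟩
  rintro a h J ρ hsol t₀ ht₀ hH₀ E₀ hE₀ ⟨hrot, hlyap⟩ t ht
  have R : RotatingOn (2 * (Q + 1) / 3) (Ioi a) h J ρ :=
    IsRotatingSolution.rotatingOn isOpen_Ioi ordConnected_Ioi ⟨hsol, t₀, ht₀, hH₀, E₀, hE₀, hrot⟩
  have F := R.reducedFlow isOpen_Ioi
  have hta : t ∈ Ioi a := lt_of_lt_of_le ht₀ ht
  obtain ⟨hx, hw, hm, r, hr, ⟨E, hE, hS⟩, -⟩ := R.exists_frame_canonical isOpen_Ioi hta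
  refine ⟨E, hE, hS ▸ hcN _ _ _ _ _ _ hx hw hm ?_ ?_⟩
  · rw [← hr]; exact F.constraint t hta
  · refine lt_of_lt_of_le ?_ (F.lyapunov_monotoneOn hQ (convex_Ioi a) isOpen_Ioi ht₀ hta ht)
    obtain ⟨g1, g2, g3, g4⟩ := scalars_hState (J := J) (ρ := ρ) hE₀ hH₀.ne'
    simp only [g1, g2, g3, g4]
    exact hlyap

end Stability

end JFormCosmology

namespace JFormCosmology

/-! ### The range of existence of rotating equilibria -/

/-- Stationarity of m, x and w gives s = q and b = 2 - 3q. The two remaining equations express w and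
r by x, and the constraint factorizes: either q = 1 or r = 0. The second case is the Rope, where w >
0 and m > 0 mean q > 4/5 and q < 1. -/
lemma deceleration_mem_of_equilibrium {q s b x w m r : ℝ} (hq : q ≤ 2) (hw : 0 < w)
    (hm : 0 < m) (hr : 0 ≤ r)
    (hc : s ^ 2 + b ^ 2 + (s + b) ^ 2 + 2 * w + 2 * r + 6 * x + 6 * m = 6)
    (hs' : (-2 * x - (2 - q) * m) * s + 4 * x - 2 * w = 0)
    (hb' : (-2 * x - (2 - q) * m) * b - 2 * x + 2 * r = 0)
    (hx' : 2 - 2 * x - (2 - q) * m - s = 0) (hw' : -2 * x - (2 - q) * m + 2 * s + b = 0)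
    (hm' : 2 * (3 - 2 * x - (2 - q) * m) - 2 * (q + 1) = 0) : q ∈ Ioo (4 / 5 : ℝ) 1 := by
  have hy : 2 * x + (2 - q) * m = 2 - q := by linarith
  have e1 : s = q := by linarith
  have e2 : b = 2 - 3 * q := by linarith
  subst e1 e2
  have hs2 : s < 2 := by
    rcases hq.eq_or_lt with h | h
    · subst h; linarith
    · exact h
  have hw2 : 2 * w = 4 * x - (2 - s) * s := by linear_combination -hs' - s * hy
  have hr2 : 2 * r = 2 * x - (2 - s) * (3 * s - 2) := by
    linear_combination hb' + (2 - 3 * s) * hy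
  have key : (1 - s) * (2 * x - (2 - s) * (3 * s - 2)) = 0 := by
    linear_combination (2 - s) / 6 * hc - (2 - s) / 6 * hw2 - (2 - s) / 6 * hr2 - hy
  have hF : 0 < 2 - s := by linarith
  rcases mul_eq_zero.1 key with h | h
  · have : s = 1 := by linarith
    -- For q = 1 one finds 2r = 2x - 1 = -m < 0, against r ≥ 0.
    subst this
    linarith
  · have hm2 : m = 3 * (1 - s) := by
      apply mul_left_cancel₀ hF.ne'
      linear_combination hy - h
    have hw3 : 0 < (2 - s) * (5 * s - 4) := by nlinarith
    have := (mul_pos_iff_of_pos_left hF).1 hw3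
    constructor <;> linarith

theorem gamma_mem_of_equilibrium {γ a b : ℝ} (hγ : γ ≤ 2) (hab : a < b) {h : SpatialMetric}
    {J : ℝ → Fin 4 → ℝ} {ρ : ℝ → ℝ} {x : HState} (hsol : IsTypeISolution γ (Ioo a b) h J ρ)
    (heq : IsEquilibrium (Ioo a b) h J ρ x) (hx : IsRotating x) :
    γ ∈ Ioo (6 / 5 : ℝ) (4 / 3) := by
  obtain ⟨t, ht⟩ := nonempty_Ioo.2 hab
  have R : RotatingOn γ (Ioo a b) h J ρ := by
    refine IsRotatingSolution.rotatingOn isOpen_Ioo ordConnected_Ioo ⟨hsol, t, ht, (heq t ht).1, ?_⟩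
    obtain ⟨-, E, hE, hS⟩ := heq t ht
    exact ⟨E, hE, hS ▸ hx⟩
  have F := R.reducedFlow isOpen_Ioo
  have hconst : ∀ u ∈ Ioo a b, formEnergy h J u = x.moment 0 ∧ axialShear h J u = x.axial ∧
      twistShear h J u = x.twistSq ∧ normalShear h J u = x.normal ∧
      densityParam h ρ u = x.2.2.2 := by
    intro u hu
    obtain ⟨hH, E, hE, hS⟩ := heq u hu
    obtain ⟨h1, h2, h3, h4⟩ := scalars_hState (J := J) (ρ := ρ) hE hH.ne'
    rw [hS] at h1 h2 h3 h4
    exact ⟨h1, h2, h3, h4, by rw [← hS]; rfl⟩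
  have hzero : ∀ {f : ℝ → ℝ} {c d : ℝ}, (∀ u ∈ Ioo a b, f u = c) →
      HasDerivAt f (hubble h t * d) t → d = 0 := by
    intro f c d hf hd
    have h0 : HasDerivAt f 0 t := (hasDerivAt_const t c).congr_of_eventuallyEq (by
      filter_upwards [isOpen_Ioo.mem_nhds ht] with u hu using hf u hu)
    exact (mul_eq_zero.1 (hd.unique h0)).resolve_left (F.H_pos t ht).ne'
  have hf : 3 * (2 - γ) / 2 = 2 - (3 * γ / 2 - 1) := by ring
  have e1 := hzero (fun u hu => (hconst u hu).2.1) (F.s_deriv t ht)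
  have e2 := hzero (fun u hu => (hconst u hu).2.2.2.1) (F.b_deriv t ht)
  have e3 := (mul_eq_zero.1 (hzero (fun u hu => (hconst u hu).1) (F.x_deriv t ht))).resolve_right
    (F.x_pos t ht).ne'
  have e4 := (mul_eq_zero.1 (hzero (fun u hu => (hconst u hu).2.2.1)
    (F.w_deriv t ht))).resolve_right (F.w_pos t ht).ne'
  have e5 := (mul_eq_zero.1 (hzero (fun u hu => (hconst u hu).2.2.2.2)
    (F.m_deriv t ht))).resolve_right (F.m_pos t ht).ne'
  rw [hf] at e1 e2 e3 e4 e5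
  have := deceleration_mem_of_equilibrium (q := 3 * γ / 2 - 1) (by linarith)
    (F.w_pos t ht) (F.m_pos t ht) (F.r_nonneg t ht) (F.constraint t ht) e1 e2 (by linarith)
    (by linarith) (by linarith)
  constructor <;> linarith [this.1, this.2]

/-! ### Rotating states are dense -/

lemma eventually_cubic_ne_zero {a b c d : ℝ} (hd : d ≠ 0) :
    ∀ᶠ ε in 𝓝[>] (0 : ℝ), a + b * ε + c * ε ^ 2 + d * ε ^ 3 ≠ 0 := by
  have hp : (Polynomial.C a + Polynomial.C b * Polynomial.X + Polynomial.C c * Polynomial.X ^ 2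
      + Polynomial.C d * Polynomial.X ^ 3 : Polynomial ℝ) ≠ 0 := by
    intro h0
    have := congrArg (fun p => Polynomial.coeff p 3) h0
    simp [Polynomial.coeff_C, Polynomial.coeff_X, Polynomial.coeff_X_pow, hd] at this
  have hfin := Polynomial.finite_setOfPred_isRoot hp
  -- Zero may be a root; with it removed, the complement of the finite root set is a neighbourhood
  -- of zero.
  have h1 : ∀ᶠ ε in 𝓝[>] (0 : ℝ), ε ∉ ({ε | Polynomial.IsRoot _ ε} \ {0} : Set ℝ) :=
    mem_nhdsWithin_of_mem_nhds ((hfin.subset sdiff_subset).isClosed.isOpen_compl.mem_nhds (by simp))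
  filter_upwards [h1, self_mem_nhdsWithin] with ε hε hpos h0
  exact hε ⟨by simpa [Polynomial.IsRoot] using h0, (ne_of_gt hpos : ε ≠ 0)⟩

/-- Adding ε in a fixed direction to S, V and Ω makes one component of V × SV a cubic polynomial in
ε with leading coefficient -1, whatever the state. Hence the perturbed state rotates for all small ε
> 0. Rescaling restores the constraint and affects neither eigenvectors nor the sign of Ω. -/
theorem spatialStates_subset_closure :
    spatialStates ⊆ closure (spatialStates ∩ {s | IsRotating s}) := by
  rintro ⟨S, V, Θ, Ω⟩ ⟨hsym, htr, hΘ, hΩ, hcon⟩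
  simp only at hsym htr hΘ hΩ hcon
  subst hΘ
  let S₁ : Matrix (Fin 3) (Fin 3) ℝ := !![0, 0, 1; 0, 0, 0; 1, 0, 0]
  let V₁ : Fin 3 → ℝ := ![1, 0, 0]
  -- The left side of the constraint for the perturbed state. S and V are rescaled by N^(-1/2) and Ω
  -- by N^(-1).
  let N : ℝ → ℝ := fun ε => (1 / 6) * ∑ a, ∑ b, (S + ε • S₁) a b ^ 2
    + ∑ a, (V + ε • V₁) a ^ 2 + (Ω + ε)
  let l : ℝ → ℝ := fun ε => (Real.sqrt (N ε))⁻¹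
  let f : ℝ → HState := fun ε =>
    (l ε • (S + ε • S₁), l ε • (V + ε • V₁), 0, l ε ^ 2 * (Ω + ε))
  have hN0 : N 0 = 1 := by simpa [N] using hcon
  have hNc : Continuous N := by
    refine Continuous.add (Continuous.add (continuous_const.mul ?_) ?_) (by fun_prop)
    · refine continuous_finsetSum _ fun i _ => continuous_finsetSum _ fun j _ => ?_
      simp only [Matrix.add_apply, Matrix.smul_apply]; fun_prop
    · refine continuous_finsetSum _ fun i _ => ?_
      simp only [Pi.add_apply, Pi.smul_apply]; fun_prop
  have hlc : ContinuousAt l 0 :=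
    ((Real.continuous_sqrt.comp hNc).continuousAt).inv₀ (by simp [hN0])
  have hl0 : l 0 = 1 := by simp [l, hN0]
  have hf0 : f 0 = (S, V, 0, Ω) := by simp [f, hl0]
  have hfc : ContinuousAt f 0 := by
    refine ContinuousAt.prodMk (hlc.smul (by fun_prop)) (ContinuousAt.prodMk
      (hlc.smul (by fun_prop)) (ContinuousAt.prodMk continuousAt_const
        ((hlc.pow 2).mul (by fun_prop))))
  have htend : Tendsto f (𝓝[>] 0) (𝓝 (S, V, 0, Ω)) := by
    rw [← hf0]; exact hfc.tendsto.mono_left nhdsWithin_le_nhds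
  refine mem_closure_of_tendsto htend ?_
  have hcub := eventually_cubic_ne_zero
    (a := V 2 * (S 0 0 * V 0 + S 0 1 * V 1 + S 0 2 * V 2)
      - V 0 * (S 2 0 * V 0 + S 2 1 * V 1 + S 2 2 * V 2))
    (b := V 2 * (S 0 0 + V 2) - (S 2 0 * V 0 + S 2 1 * V 1 + S 2 2 * V 2) - V 0 * (S 2 0 + V 0))
    (c := -(S 2 0 + V 0) - V 0) (d := -1) (by norm_num)
  filter_upwards [hcub, self_mem_nhdsWithin] with ε hε hpos
  have hpos : 0 < ε := hpos
  have hNpos : 0 < N ε := by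
    have h1 : 0 ≤ ∑ a, ∑ b, (S + ε • S₁) a b ^ 2 :=
      Finset.sum_nonneg fun _ _ => Finset.sum_nonneg fun _ _ => sq_nonneg _
    have h2 : 0 ≤ ∑ a, (V + ε • V₁) a ^ 2 := Finset.sum_nonneg fun _ _ => sq_nonneg _
    simp only [N]; linarith
  have hlpos : 0 < l ε := inv_pos.2 (Real.sqrt_pos.2 hNpos)
  have hl2 : l ε ^ 2 * N ε = 1 := by
    simp only [l]
    rw [inv_pow, Real.sq_sqrt hNpos.le, inv_mul_cancel₀ hNpos.ne']
  have hΩε : 0 < Ω + ε := by linarith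
  refine ⟨⟨?_, ?_, rfl, ?_, ?_⟩, isRotating_iff_cross.2 ⟨?_, fun h0 => ?_⟩⟩
  · have h1 : S₁ᵀ = S₁ := by
      ext i j; fin_cases i <;> fin_cases j <;> simp [S₁]
    rw [Matrix.IsSymm]
    simp only [f, Matrix.transpose_smul, Matrix.transpose_add, hsym.eq, h1]
  · simp only [f, Matrix.trace_smul, Matrix.trace_add, htr]
    simp [S₁, Matrix.trace, Fin.sum_univ_three]
  · simp only [f]; positivity
  · refine Eq.trans ?_ hl2
    simp only [f, N, Matrix.smul_apply, Pi.smul_apply, smul_eq_mul, mul_pow, ← Finset.mul_sum]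
    ring
  · simp only [f]; positivity
  · apply hε
    have h1 := congrFun h0 1
    simp only [f, Matrix.mulVec_smul, Matrix.smul_mulVec, LinearMap.map_smul, LinearMap.map_smul₂,
      LinearMap.smul_apply, Pi.smul_apply, smul_eq_mul, Pi.zero_apply, mul_eq_zero, hlpos.ne', false_or] at h1
    have u0 : (V + ε • V₁) 0 = V 0 + ε := by simp [V₁]
    have u1 : (V + ε • V₁) 1 = V 1 := by simp [V₁]
    have u2 : (V + ε • V₁) 2 = V 2 := by simp [V₁]
    have a00 : (S + ε • S₁) 0 0 = S 0 0 := by simp [S₁]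
    have a01 : (S + ε • S₁) 0 1 = S 0 1 := by simp [S₁]
    have a02 : (S + ε • S₁) 0 2 = S 0 2 + ε := by simp [S₁]
    have a20 : (S + ε • S₁) 2 0 = S 2 0 + ε := by simp [S₁]
    have a21 : (S + ε • S₁) 2 1 = S 2 1 := by simp [S₁]
    have a22 : (S + ε • S₁) 2 2 = S 2 2 := by simp [S₁]
    have h2 : (V + ε • V₁) 2 * ((S + ε • S₁) *ᵥ (V + ε • V₁)) 0
        - (V + ε • V₁) 0 * ((S + ε • S₁) *ᵥ (V + ε • V₁)) 2 = 0 := by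
      simpa only [cross_apply, Matrix.cons_val_one, Matrix.cons_val_zero, hlpos.ne', false_or]
        using h1
    simp only [Matrix.mulVec, dotProduct, Fin.sum_univ_three, u0, u1, u2, a00, a01, a02, a20, a21,
      a22] at h2
    linear_combination h2

end JFormCosmology

namespace JFormCosmology

/-! ### Locality of the field equations. -/

section Congr

variable {γ : ℝ} {h h' : SpatialMetric} {J J' : ℝ → Fin 4 → ℝ} {ρ ρ' : ℝ → ℝ} {t : ℝ}

lemma expansion_congr (hh : h' =ᶠ[𝓝 t] h) : expansion h' t = expansion h t := by
  ext i j
  have : (fun s => h' s i j) =ᶠ[𝓝 t] fun s => h s i j := hh.fun_comp fun A => A i j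
  simp [expansion, metricDot, this.deriv_eq]

lemma eventually_expansion_congr (hh : h' =ᶠ[𝓝 t] h) : expansion h' =ᶠ[𝓝 t] expansion h := by
  filter_upwards [hh.eventuallyEq_nhds] with s hs using expansion_congr hs

lemma mixedExpansion_congr (hh : h' =ᶠ[𝓝 t] h) : mixedExpansion h' t = mixedExpansion h t := by
  rw [mixedExpansion, mixedExpansion, expansion_congr hh, hh.eq_of_nhds]

lemma hubble_congr (hh : h' =ᶠ[𝓝 t] h) : hubble h' t = hubble h t := by
  have := congrArg Matrix.trace (mixedExpansion_congr hh)
  rw [trace_mixedExpansion, trace_mixedExpansion] at this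
  linarith

lemma EvolutionAt.congr (E : EvolutionAt γ h J ρ t) (hh : h' =ᶠ[𝓝 t] h) (hJ : J' =ᶠ[𝓝 t] J)
    (hρ : ρ' =ᶠ[𝓝 t] ρ) : EvolutionAt γ h' J' ρ' t := by
  have eh := hh.eq_of_nhds
  have eJ := hJ.eq_of_nhds
  have eρ := hρ.eq_of_nhds
  have eθ := expansion_congr hh
  have eK := mixedExpansion_congr hh
  have hJi : ∀ μ, (fun s => J' s μ) =ᶠ[𝓝 t] fun s => J s μ := fun μ => hJ.fun_comp fun A => A μ
  refine ⟨eh ▸ E.posDef, fun i j => (E.h_smooth i j).congr_of_eventuallyEq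
      (hh.fun_comp fun A => A i j), fun μ => (E.J_smooth μ).congr_of_eventuallyEq (hJi μ),
    E.ρ_smooth.congr_of_eventuallyEq hρ, eρ ▸ E.ρ_nonneg, ?_, ?_, ?_, ?_, ?_, ?_⟩
  · rw [eK, eρ, eJ, eh]; exact E.hamiltonian
  · rw [eJ]; exact E.momentum
  · rw [eK, eρ, eJ, eh, eθ]
    exact fun i j => (E.evolution i j).congr_of_eventuallyEq
      ((eventually_expansion_congr hh).fun_comp fun A => A i j)
  · exact fun i => (E.J_space i).congr_of_eventuallyEq (hJi _)
  · rw [eK, eJ]; exact E.J_time.congr_of_eventuallyEq (hJi _)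
  · rw [eK, eρ]; exact E.density.congr_of_eventuallyEq hρ

lemma hState_congr (hh : h' =ᶠ[𝓝 t] h) (hJ : J' t = J t) (hρ : ρ' t = ρ t)
    (E : Matrix (Fin 3) (Fin 3) ℝ) : hState h' J' ρ' t E = hState h J ρ t E := by
  rw [hState_eq, hState_eq, frameExpansion, frameExpansion, frameForm, frameForm,
    expansion_congr hh, hubble_congr hh, hJ, hρ]

lemma IsTypeISolution.congr {I : Set ℝ} (hI : IsOpen I) (hsol : IsTypeISolution γ I h J ρ)
    (hh : ∀ t ∈ I, h' t = h t) (hJ : ∀ t ∈ I, J' t = J t) (hρ : ∀ t ∈ I, ρ' t = ρ t) :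
    IsTypeISolution γ I h' J' ρ' :=
  (isTypeISolution_iff hI).2 fun t ht => ((isTypeISolution_iff hI).1 hsol t ht).congr
    (by filter_upwards [hI.mem_nhds ht] with s hs using hh s hs)
    (by filter_upwards [hI.mem_nhds ht] with s hs using hJ s hs)
    (by filter_upwards [hI.mem_nhds ht] with s hs using hρ s hs)

end Congr

/-! ### Scaling metrics -/

/-- The metric `t^(a i + a j) M i j`. -/
noncomputable def scalingMetric (a : Fin 3 → ℝ) (M : Matrix (Fin 3) (Fin 3) ℝ) : SpatialMetric :=
  fun t => Matrix.of fun i j => t ^ (a i + a j) * M i j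

/-- The diagonal matrix with entries `t^(a i)`. -/
noncomputable def scalingFrame (a : Fin 3 → ℝ) (t : ℝ) : Matrix (Fin 3) (Fin 3) ℝ :=
  Matrix.diagonal fun i => t ^ a i

/-- The matrix `(a i + a j) / 2 * M i j`. -/
noncomputable def scalingExpansion (a : Fin 3 → ℝ) (M : Matrix (Fin 3) (Fin 3) ℝ) :
    Matrix (Fin 3) (Fin 3) ℝ := Matrix.of fun i j => (a i + a j) / 2 * M i j

section Scaling

variable {a v : Fin 3 → ℝ} {M P E : Matrix (Fin 3) (Fin 3) ℝ} {t : ℝ}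

lemma scalingMetric_eq (ht : 0 < t) :
    scalingMetric a M t = scalingFrame a t * M * scalingFrame a t := by
  ext i j
  simp only [scalingMetric, scalingFrame, Matrix.of_apply, Matrix.mul_diagonal,
    Matrix.diagonal_mul, Real.rpow_add ht]
  ring

lemma scalingFrame_mul_neg (ht : 0 < t) : scalingFrame a t * scalingFrame (-a) t = 1 := by
  rw [scalingFrame, scalingFrame, Matrix.diagonal_mul_diagonal, ← Matrix.diagonal_one]
  congr 1
  ext i
  rw [Pi.neg_apply, ← Real.rpow_add ht, add_neg_cancel, Real.rpow_zero]

lemma scalingFrame_neg_mul (ht : 0 < t) : scalingFrame (-a) t * scalingFrame a t = 1 :=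
  mul_eq_one_comm.1 (scalingFrame_mul_neg ht)

lemma scalingFrame_transpose : (scalingFrame a t)ᵀ = scalingFrame a t :=
  Matrix.diagonal_transpose _

lemma inv_scalingMetric (ht : 0 < t) (hP : M * P = 1) :
    (scalingMetric a M t)⁻¹ = scalingFrame (-a) t * P * scalingFrame (-a) t := by
  apply Matrix.inv_eq_right_inv
  rw [scalingMetric_eq ht]
  calc scalingFrame a t * M * scalingFrame a t * (scalingFrame (-a) t * P * scalingFrame (-a) t)
      = scalingFrame a t * M * (scalingFrame a t * scalingFrame (-a) t) * P
        * scalingFrame (-a) t := by simp only [Matrix.mul_assoc]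
    _ = 1 := by
      rw [scalingFrame_mul_neg ht, Matrix.mul_one, Matrix.mul_assoc _ M P, hP, Matrix.mul_one,
        scalingFrame_mul_neg ht]

lemma hasDerivAt_scaling (ht : 0 < t) (i j : Fin 3) :
    HasDerivAt (fun s => scalingMetric a M s i j)
      (2 * (t⁻¹ * scalingMetric a (scalingExpansion a M) t i j)) t := by
  refine ((Real.hasDerivAt_rpow_const (p := a i + a j) (Or.inl ht.ne')).mul_const
    (M i j)).congr_deriv ?_
  simp only [scalingMetric, scalingExpansion, Matrix.of_apply]
  rw [Real.rpow_sub ht, Real.rpow_one]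
  field_simp

lemma expansion_scaling (ht : 0 < t) :
    expansion (scalingMetric a M) t = t⁻¹ • scalingMetric a (scalingExpansion a M) t := by
  ext i j
  simp only [expansion, metricDot, Matrix.smul_apply, Matrix.of_apply,
    (hasDerivAt_scaling ht i j).deriv, smul_eq_mul]
  ring

lemma mixedExpansion_scaling (ht : 0 < t) (hP : M * P = 1) :
    mixedExpansion (scalingMetric a M) t =
      t⁻¹ • (scalingFrame (-a) t * (P * scalingExpansion a M) * scalingFrame a t) := by
  rw [mixedExpansion, inv_scalingMetric ht hP, expansion_scaling ht, Matrix.mul_smul,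
    scalingMetric_eq ht]
  congr 1
  calc scalingFrame (-a) t * P * scalingFrame (-a) t *
        (scalingFrame a t * scalingExpansion a M * scalingFrame a t)
      = scalingFrame (-a) t * P * (scalingFrame (-a) t * scalingFrame a t)
        * scalingExpansion a M * scalingFrame a t := by simp only [Matrix.mul_assoc]
    _ = _ := by rw [scalingFrame_neg_mul ht, Matrix.mul_one]; simp only [Matrix.mul_assoc]

lemma trace_conj_scalingFrame (ht : 0 < t) (X : Matrix (Fin 3) (Fin 3) ℝ) :
    (scalingFrame (-a) t * X * scalingFrame a t).trace = X.trace := by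
  rw [Matrix.trace_mul_comm, ← Matrix.mul_assoc, scalingFrame_mul_neg ht, Matrix.one_mul]

lemma trace_mixed_scaling (ht : 0 < t) (hP : M * P = 1) :
    (mixedExpansion (scalingMetric a M) t).trace = t⁻¹ * (P * scalingExpansion a M).trace := by
  rw [mixedExpansion_scaling ht hP, Matrix.trace_smul, trace_conj_scalingFrame ht, smul_eq_mul]

lemma scalingFrame_neg_mulVec (hv : ∀ i, v i = 0 ∨ a i = 1) :
    scalingFrame (-a) t *ᵥ v = t⁻¹ • v := by
  ext i
  rw [scalingFrame, Matrix.mulVec_diagonal, Pi.smul_apply, smul_eq_mul]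
  rcases hv i with h | h
  · rw [h]; ring
  · rw [Pi.neg_apply, h, Real.rpow_neg_one]

lemma posDef_scalingMetric (ht : 0 < t) (hM : M.PosDef) : (scalingMetric a M t).PosDef := by
  rw [scalingMetric_eq ht]
  have hu : Function.Injective (scalingFrame a t).mulVec := by
    refine Function.LeftInverse.injective (g := (scalingFrame (-a) t).mulVec) fun x => ?_
    rw [Matrix.mulVec_mulVec, scalingFrame_neg_mul ht, Matrix.one_mulVec]
  have := hM.conjTranspose_mul_mul_same hu
  rwa [Matrix.conjTranspose_eq_transpose_of_trivial, scalingFrame_transpose] at this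

/-- Scaling metrics solve the field equations if an algebraic system holds. -/
theorem evolutionAt_scaling {γ ρ₀ : ℝ} (ht : 0 < t) (hM : M.PosDef) (hP : M * P = 1)
    (hv : ∀ i, v i = 0 ∨ a i = 1) (hρ : 0 ≤ ρ₀)
    (hham : (P * scalingExpansion a M).trace ^ 2
      - (P * scalingExpansion a M * (P * scalingExpansion a M)).trace = 2 * ρ₀ + v ⬝ᵥ (P *ᵥ v))
    (hevo : scalingExpansion a (scalingExpansion a M) + scalingExpansion a (scalingExpansion a M)
      - scalingExpansion a M = (2 : ℝ) • (scalingExpansion a M * (P * scalingExpansion a M))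
      - (P * scalingExpansion a M).trace • scalingExpansion a M + vecMulVec v v
      + ((2 - γ) / 2 * ρ₀) • M)
    (hγ : γ * (P * scalingExpansion a M).trace * ρ₀ = 2 * ρ₀) :
    EvolutionAt γ (scalingMetric a M) (fun _ => Fin.cons 0 v) (fun s => ρ₀ / s ^ 2) t := by
  set N := scalingExpansion a M with hN
  have hD1 := scalingFrame_mul_neg (a := a) ht
  have hD2 := scalingFrame_neg_mul (a := a) ht
  have htr := trace_mixed_scaling (a := a) ht hP
  rw [← hN] at htr
  have hsp : spatialPart (Fin.cons 0 v : Fin 4 → ℝ) = v := by ext i; simp [spatialPart]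
  -- v is supported on the directions with exponent 1, in which the frame scales like t. This gives
  -- the source J_i J_j the same scaling as the other terms.
  have hDv : scalingFrame a t *ᵥ v = t • v := by
    have h1 := congrArg (fun x => t • scalingFrame a t *ᵥ x) (scalingFrame_neg_mulVec (t := t) hv)
    simp only [Matrix.mulVec_mulVec, hD1, Matrix.one_mulVec, Matrix.mulVec_smul, smul_smul,
      mul_inv_cancel₀ ht.ne', one_smul] at h1
    exact h1.symm
  refine ⟨posDef_scalingMetric ht hM, fun i j => ?_, fun μ => contDiffAt_const, ?_, by positivity,
    ?_, fun i => by simp, ?_, fun i => by simpa using hasDerivAt_const t (v i), ?_, ?_⟩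
  · exact ((Real.contDiffAt_rpow_const_of_ne ht.ne').mul contDiffAt_const)
  · exact contDiffAt_const.div (contDiffAt_id.pow 2) (by simpa using ht.ne')
  · have h1 : (mixedExpansion (scalingMetric a M) t * mixedExpansion (scalingMetric a M) t).trace
        = t⁻¹ ^ 2 * (P * N * (P * N)).trace := by
      rw [mixedExpansion_scaling ht hP, Matrix.smul_mul, Matrix.mul_smul, smul_smul,
        Matrix.trace_smul, smul_eq_mul, ← trace_conj_scalingFrame (a := a) ht (P * N * (P * N)),
        pow_two]
      congr 2
      calc scalingFrame (-a) t * (P * N) * scalingFrame a t *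
            (scalingFrame (-a) t * (P * N) * scalingFrame a t)
          = scalingFrame (-a) t * (P * N) * (scalingFrame a t * scalingFrame (-a) t) * (P * N)
            * scalingFrame a t := by simp only [Matrix.mul_assoc]
        _ = _ := by rw [hD1, Matrix.mul_one]; simp only [Matrix.mul_assoc]
    have h2 : v ⬝ᵥ ((scalingMetric a M t)⁻¹ *ᵥ v) = t⁻¹ ^ 2 * (v ⬝ᵥ (P *ᵥ v)) := by
      rw [inv_scalingMetric ht hP, ← Matrix.mulVec_mulVec, ← Matrix.mulVec_mulVec,
        Matrix.dotProduct_mulVec, ← Matrix.mulVec_transpose, scalingFrame_transpose,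
        scalingFrame_neg_mulVec hv, Matrix.mulVec_smul, smul_dotProduct, dotProduct_smul]
      simp only [smul_eq_mul]; ring
    rw [hsp, h1, h2, htr]
    simp only [Fin.cons_zero]
    have : ρ₀ / t ^ 2 = t⁻¹ ^ 2 * ρ₀ := by field_simp
    rw [this]
    linear_combination t⁻¹ ^ 2 * hham
  · intro i j
    have hev : (fun s => expansion (scalingMetric a M) s i j) =ᶠ[𝓝 t]
        fun s => s⁻¹ * scalingMetric a N s i j := by
      filter_upwards [lt_mem_nhds ht] with s hs
      rw [expansion_scaling hs]; rfl
    refine (((hasDerivAt_inv ht.ne').mul (hasDerivAt_scaling ht i j)).congr_of_eventuallyEq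
      hev).congr_deriv ?_
    have e1 : expansion (scalingMetric a M) t * mixedExpansion (scalingMetric a M) t
        = t⁻¹ ^ 2 • (scalingFrame a t * (N * (P * N)) * scalingFrame a t) := by
      rw [expansion_scaling ht, mixedExpansion_scaling ht hP, scalingMetric_eq ht,
        Matrix.smul_mul, Matrix.mul_smul, smul_smul, pow_two]
      congr 1
      calc scalingFrame a t * N * scalingFrame a t *
            (scalingFrame (-a) t * (P * N) * scalingFrame a t)
          = scalingFrame a t * N * (scalingFrame a t * scalingFrame (-a) t) * (P * N)
            * scalingFrame a t := by simp only [Matrix.mul_assoc]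
        _ = _ := by rw [hD1, Matrix.mul_one]; simp only [Matrix.mul_assoc]
    have e2 : vecMulVec v v = t⁻¹ ^ 2 • (scalingFrame a t * vecMulVec v v * scalingFrame a t) := by
      rw [Matrix.mul_vecMulVec, Matrix.vecMulVec_mul, ← Matrix.mulVec_transpose,
        scalingFrame_transpose, hDv, Matrix.smul_vecMulVec, Matrix.vecMulVec_smul, smul_smul,
        smul_smul]
      have : t⁻¹ ^ 2 * t * t = 1 := by field_simp
      rw [this, one_smul]
    -- Every term of the evolution equation at time t is t⁻² D X D, with D the scaling frame and X a
    -- constant matrix, so the equation is the conjugate of the algebraic one.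
    have e3 := congrArg (fun X => (t⁻¹ ^ 2 • (scalingFrame a t * X * scalingFrame a t)) i j) hevo
    simp only [Matrix.mul_add, Matrix.add_mul, Matrix.mul_sub, Matrix.sub_mul, Matrix.mul_smul,
      Matrix.smul_mul, ← scalingMetric_eq ht, smul_add, smul_sub, Matrix.add_apply,
      Matrix.sub_apply] at e3
    rw [← scalingMetric_eq ht] at e1 e2
    have e2' := congrFun (congrFun e2 i) j
    rw [hsp, e1, htr, expansion_scaling ht]
    simp only [Matrix.add_apply, Matrix.sub_apply, Matrix.smul_apply, smul_eq_mul] at e3 ⊢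
    have hρt : ρ₀ / t ^ 2 = t⁻¹ ^ 2 * ρ₀ := by field_simp
    have hsq : (t ^ 2)⁻¹ = t⁻¹ ^ 2 := by field_simp
    rw [hρt, hsq]
    simp only [Matrix.smul_apply, smul_eq_mul] at e2'
    linear_combination e3 - e2'
  · simpa using hasDerivAt_const t (0 : ℝ)
  · rw [htr]
    refine ((hasDerivAt_const t ρ₀).div ((hasDerivAt_id t).pow 2)
      (by simpa using ht.ne')).congr_deriv ?_
    simp only [id, Pi.pow_apply]
    field_simp
    push_cast
    linear_combination t * hγ

lemma isOrthonormalFrame_scaling (ht : 0 < t) (hE : Eᵀ * M * E = 1) :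
    IsOrthonormalFrame (scalingMetric a M) t (scalingFrame (-a) t * E) := by
  rw [IsOrthonormalFrame, scalingMetric_eq ht, Matrix.transpose_mul, scalingFrame_transpose]
  calc Eᵀ * scalingFrame (-a) t * (scalingFrame a t * M * scalingFrame a t)
        * (scalingFrame (-a) t * E)
      = Eᵀ * (scalingFrame (-a) t * scalingFrame a t) * M
        * (scalingFrame a t * scalingFrame (-a) t) * E := by simp only [Matrix.mul_assoc]
    _ = 1 := by rw [scalingFrame_neg_mul ht, scalingFrame_mul_neg ht, Matrix.mul_one,
      Matrix.mul_one, hE]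

lemma frameExpansion_scaling (ht : 0 < t) :
    frameExpansion (scalingMetric a M) t (scalingFrame (-a) t * E)
      = t⁻¹ • (Eᵀ * scalingExpansion a M * E) := by
  rw [frameExpansion, expansion_scaling ht, scalingMetric_eq ht, Matrix.transpose_mul,
    scalingFrame_transpose, Matrix.mul_smul, Matrix.smul_mul]
  congr 1
  calc Eᵀ * scalingFrame (-a) t * (scalingFrame a t * scalingExpansion a M * scalingFrame a t)
        * (scalingFrame (-a) t * E)
      = Eᵀ * (scalingFrame (-a) t * scalingFrame a t) * scalingExpansion a M
        * (scalingFrame a t * scalingFrame (-a) t) * E := by simp only [Matrix.mul_assoc]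
    _ = _ := by rw [scalingFrame_neg_mul ht, scalingFrame_mul_neg ht, Matrix.mul_one,
      Matrix.mul_one]

end Scaling

end JFormCosmology

namespace JFormCosmology

/-! ### The Rope -/

noncomputable def ropeExponent (γ : ℝ) : Fin 3 → ℝ := ![1, (4 - 3 * γ) / γ, 2 * (γ - 1) / γ]

noncomputable def ropeTilt (γ : ℝ) : ℝ := Real.sqrt (2 * (5 * γ - 6) / (2 - γ))

/-- The metric of the Rope at time `1`, as a function of the tilt. -/
def tiltMatrix (c : ℝ) : Matrix (Fin 3) (Fin 3) ℝ := !![1, 0, c; 0, 1, 0; c, 0, 1 + c ^ 2]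

def tiltInverse (c : ℝ) : Matrix (Fin 3) (Fin 3) ℝ := !![1 + c ^ 2, 0, -c; 0, 1, 0; -c, 0, 1]

lemma tiltMatrix_mul_tiltInverse (c : ℝ) : tiltMatrix c * tiltInverse c = 1 := by
  ext i j
  fin_cases i <;> fin_cases j <;>
    simp [tiltMatrix, tiltInverse, Matrix.mul_apply, Fin.sum_univ_three] <;> ring

lemma posDef_tiltMatrix (c : ℝ) : (tiltMatrix c).PosDef := by
  refine Matrix.PosDef.of_dotProduct_mulVec_pos ?_ fun x hx => ?_
  · rw [Matrix.IsHermitian, Matrix.conjTranspose_eq_transpose_of_trivial]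
    ext i j
    fin_cases i <;> fin_cases j <;> simp [tiltMatrix]
  · have h1 : star x ⬝ᵥ (tiltMatrix c *ᵥ x) = (x 0 + c * x 2) ^ 2 + x 1 ^ 2 + x 2 ^ 2 := by
      simp [tiltMatrix, Matrix.mulVec, dotProduct, Fin.sum_univ_three]; ring
    rw [h1]
    refine lt_of_le_of_ne (by positivity) fun h0 => hx ?_
    have p0 := sq_nonneg (x 0 + c * x 2)
    have p1 := sq_nonneg (x 1)
    have p2 := sq_nonneg (x 2)
    have e2 : x 2 = 0 := pow_eq_zero_iff two_ne_zero |>.1 (by linarith)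
    have e1 : x 1 = 0 := pow_eq_zero_iff two_ne_zero |>.1 (by linarith)
    have e0 : x 0 + c * x 2 = 0 := pow_eq_zero_iff two_ne_zero |>.1 (by linarith)
    rw [e2, mul_zero, add_zero] at e0
    ext i; fin_cases i <;> simp [e0, e1, e2]

lemma ropeMetric_eq {γ t : ℝ} (hγ : 0 < γ) (ht : 0 < t) :
    ropeMetric γ t = scalingMetric (ropeExponent γ) (tiltMatrix (ropeTilt γ)) t := by
  have h1 : t ^ ((1 : ℝ) + 2 * (γ - 1) / γ) = t ^ 2 * t ^ (1 - 2 / γ) := by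
    rw [← Real.rpow_natCast t 2, ← Real.rpow_add ht]; congr 1; push_cast; field_simp; ring
  have h2 : t ^ (2 * (γ - 1) / γ + 2 * (γ - 1) / γ) = t ^ (4 * (γ - 1) / γ) := by
    congr 1; ring
  have h3 : t ^ 2 * (t ^ (1 - 2 / γ) * t ^ (1 - 2 / γ)) = t ^ (4 * (γ - 1) / γ) := by
    rw [← Real.rpow_natCast t 2, ← Real.rpow_add ht, ← Real.rpow_add ht]
    congr 1; push_cast; field_simp; ring
  have h4 : t ^ ((4 - 3 * γ) / γ + (4 - 3 * γ) / γ) = t ^ (2 * (4 - 3 * γ) / γ) := by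
    congr 1; ring
  have h5 : t ^ ((1 : ℝ) + 1) = t ^ 2 := by
    rw [← Real.rpow_natCast t 2]; norm_num
  have h6 : t ^ (2 * (γ - 1) / γ + 1) = t ^ 2 * t ^ (1 - 2 / γ) := by rw [add_comm, h1]
  ext i j
  rw [ropeMetric, ← ropeTilt]
  fin_cases i <;> fin_cases j <;>
    simp [scalingMetric, tiltMatrix, ropeExponent, sqForm, vecMulVec_apply, h1, h2, h4, h5, h6]
  · ring
  · ring
  · rw [← h3]; ring

lemma ropeTilt_sq {γ : ℝ} (hγ : γ ∈ Icc (6 / 5 : ℝ) (4 / 3)) :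
    ropeTilt γ ^ 2 = 2 * (5 * γ - 6) / (2 - γ) := by
  obtain ⟨h1, h2⟩ := hγ
  exact Real.sq_sqrt (div_nonneg (by linarith) (by linarith))

lemma tiltInverse_mul_expansion (c a₂ a₃ : ℝ) :
    tiltInverse c * scalingExpansion ![1, a₂, a₃] (tiltMatrix c)
      = !![1 + c ^ 2 * (1 - a₃) / 2, 0, c * (1 - a₃) / 2 * (1 + c ^ 2); 0, a₂, 0;
          -(c * (1 - a₃) / 2), 0, a₃ - c ^ 2 * (1 - a₃) / 2] := by
  ext i j
  fin_cases i <;> fin_cases j <;>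
    simp [tiltInverse, scalingExpansion, tiltMatrix, Matrix.mul_apply, Fin.sum_univ_three] <;> ring

lemma trace_tiltInverse_mul_expansion (c a₂ a₃ : ℝ) :
    (tiltInverse c * scalingExpansion ![1, a₂, a₃] (tiltMatrix c)).trace = 1 + a₂ + a₃ := by
  rw [tiltInverse_mul_expansion]
  simp [Matrix.trace, Fin.sum_univ_three]; ring

/-- The end points are included on purpose: there the same formula yields Wonderland and the Edge,
which thus need no separate verification. -/
theorem evolutionAt_rope {γ t : ℝ} (hγ : γ ∈ Icc (6 / 5 : ℝ) (4 / 3)) (ht : 0 < t) :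
    EvolutionAt γ (ropeMetric γ) (ropeForm γ) (ropeDensity γ) t := by
  obtain ⟨hγ1, hγ2⟩ := hγ
  have hγ0 : γ ≠ 0 := by linarith
  have h2γ : 2 - γ ≠ 0 := by linarith
  set c := ropeTilt γ with hc
  have hc2 : c ^ 2 = 2 * (5 * γ - 6) / (2 - γ) := ropeTilt_sq ⟨hγ1, hγ2⟩
  have htr := trace_tiltInverse_mul_expansion c ((4 - 3 * γ) / γ) (2 * (γ - 1) / γ)
  have htr' : 1 + (4 - 3 * γ) / γ + 2 * (γ - 1) / γ = 2 / γ := by field_simp; ring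
  rw [htr'] at htr
  have key : EvolutionAt γ (scalingMetric (ropeExponent γ) (tiltMatrix c))
      (fun _ => Fin.cons 0 ![(2 - γ) / γ, 0, 0])
      (fun s => 2 * (4 - 3 * γ) / γ ^ 2 / s ^ 2) t := by
    refine evolutionAt_scaling ht (posDef_tiltMatrix c) (tiltMatrix_mul_tiltInverse c) ?_
      (div_nonneg (by linarith) (by positivity)) ?_ ?_ ?_
    · intro i; fin_cases i <;> simp [ropeExponent]
    · rw [ropeExponent, htr, tiltInverse_mul_expansion]
      simp [Matrix.trace, Fin.sum_univ_three, Matrix.mul_apply, tiltInverse, Matrix.mulVec,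
        dotProduct]
      have hc4 : c ^ 4 = (2 * (5 * γ - 6) / (2 - γ)) ^ 2 := by rw [← hc2]; ring
      ring_nf
      simp only [hc2, hc4]
      field_simp
      ring
    · rw [ropeExponent, htr, tiltInverse_mul_expansion]
      have hc4 : c ^ 4 = (2 * (5 * γ - 6) / (2 - γ)) ^ 2 := by rw [← hc2]; ring
      have hc3 : c ^ 3 = c * (2 * (5 * γ - 6) / (2 - γ)) := by rw [← hc2]; ring
      ext i j
      fin_cases i <;> fin_cases j <;>
        simp [Fin.sum_univ_three, Matrix.mul_apply, scalingExpansion, tiltMatrix,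
          vecMulVec_apply]
      all_goals
        ring_nf
        try simp only [hc2, hc3, hc4]
        try field_simp
        try ring
    · rw [ropeExponent, htr]; field_simp
  refine key.congr ?_ (Eventually.of_forall fun s => ?_) (Eventually.of_forall fun s => ?_)
  · filter_upwards [lt_mem_nhds ht] with s hs using ropeMetric_eq (by linarith) hs
  · ext i; fin_cases i <;> simp [ropeForm]
  · simp only [ropeDensity]
    rw [div_div]

end JFormCosmology

namespace JFormCosmology

/-! ### Geometry and state of the Rope. -/

section Rope

variable {γ t : ℝ}

lemma isTypeISolution_rope (hγ : γ ∈ Icc (6 / 5 : ℝ) (4 / 3)) :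
    IsTypeISolution γ (Ioi 0) (ropeMetric γ) (ropeForm γ) (ropeDensity γ) :=
  (isTypeISolution_iff isOpen_Ioi).2 fun _ ht => evolutionAt_rope hγ ht

lemma ropeMetric_eventuallyEq (hγ : 0 < γ) (ht : 0 < t) :
    ropeMetric γ =ᶠ[𝓝 t] scalingMetric (ropeExponent γ) (tiltMatrix (ropeTilt γ)) := by
  filter_upwards [lt_mem_nhds ht] with s hs using ropeMetric_eq hγ hs

lemma hubble_rope (hγ : 0 < γ) (ht : 0 < t) : hubble (ropeMetric γ) t = 2 / (3 * γ) * t⁻¹ := by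
  rw [hubble_congr (ropeMetric_eventuallyEq hγ ht)]
  have h1 := trace_mixed_scaling (a := ropeExponent γ) ht
    (tiltMatrix_mul_tiltInverse (ropeTilt γ))
  rw [trace_mixedExpansion, ropeExponent, trace_tiltInverse_mul_expansion, ← ropeExponent] at h1
  have h2 : 1 + (4 - 3 * γ) / γ + 2 * (γ - 1) / γ = 2 / γ := by field_simp; ring
  rw [h2] at h1
  have h3 : hubble (scalingMetric (ropeExponent γ) (tiltMatrix (ropeTilt γ))) t
    = t⁻¹ * (2 / γ) / 3 := by linarith
  rw [h3]; field_simp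

lemma deceleration_rope (hγ : 0 < γ) (ht : 0 < t) :
    deceleration (ropeMetric γ) t = 3 * γ / 2 - 1 := by
  have h1 : hubble (ropeMetric γ) =ᶠ[𝓝 t] fun s => 2 / (3 * γ) * s⁻¹ := by
    filter_upwards [lt_mem_nhds ht] with s hs using hubble_rope hγ hs
  rw [deceleration, h1.deriv_eq, hubble_rope hγ ht,
    ((hasDerivAt_inv ht.ne').const_mul (2 / (3 * γ))).deriv]
  field_simp
  ring

/-- An orthonormal frame at time `1` adapted to the `j`-form of the Rope. -/
noncomputable def tiltFrame (c : ℝ) : Matrix (Fin 3) (Fin 3) ℝ :=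
  !![Real.sqrt (1 + c ^ 2), 0, 0; 0, 1, 0;
    -(c / Real.sqrt (1 + c ^ 2)), 0, 1 / Real.sqrt (1 + c ^ 2)]

lemma tiltFrame_orthonormal (c : ℝ) : (tiltFrame c)ᵀ * tiltMatrix c * tiltFrame c = 1 := by
  have hu : Real.sqrt (1 + c ^ 2) ^ 2 = 1 + c ^ 2 := Real.sq_sqrt (by positivity)
  have hpos : 0 < Real.sqrt (1 + c ^ 2) := Real.sqrt_pos.2 (by positivity)
  rw [tiltFrame]
  generalize Real.sqrt (1 + c ^ 2) = u at hu hpos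
  have hc : c ^ 2 = u ^ 2 - 1 := by linarith
  have hc3 : c ^ 3 = c * (u ^ 2 - 1) := by rw [← hc]; ring
  have hc4 : c ^ 4 = (u ^ 2 - 1) ^ 2 := by rw [← hc]; ring
  ext i j
  fin_cases i <;> fin_cases j <;>
    simp [tiltMatrix, Matrix.mul_apply, Fin.sum_univ_three, hpos.ne'] <;> field_simp <;>
    ring_nf <;> simp only [hc, hc3, hc4] <;> ring

/-- This frame is already adapted: the expansion has the canonical shape with r = 0. Transported by
`scalingFrame` it yields the same normalized state at all times. -/
lemma tiltFrame_expansion (c a₂ a₃ : ℝ) :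
    (tiltFrame c)ᵀ * scalingExpansion ![1, a₂, a₃] (tiltMatrix c) * tiltFrame c
      = !![1, 0, c * (1 - a₃) / 2; 0, a₂, 0; c * (1 - a₃) / 2, 0, a₃] := by
  have hu : Real.sqrt (1 + c ^ 2) ^ 2 = 1 + c ^ 2 := Real.sq_sqrt (by positivity)
  have hpos : 0 < Real.sqrt (1 + c ^ 2) := Real.sqrt_pos.2 (by positivity)
  rw [tiltFrame]
  generalize Real.sqrt (1 + c ^ 2) = u at hu hpos
  have hc : c ^ 2 = u ^ 2 - 1 := by linarith
  have hc3 : c ^ 3 = c * (u ^ 2 - 1) := by rw [← hc]; ring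
  have hc4 : c ^ 4 = (u ^ 2 - 1) ^ 2 := by rw [← hc]; ring
  ext i j
  fin_cases i <;> fin_cases j <;>
    simp [tiltMatrix, scalingExpansion, Matrix.mul_apply, Fin.sum_univ_three, hpos.ne'] <;>
    field_simp <;> ring_nf <;> simp only [hc, hc3, hc4] <;> ring

lemma hState_rope (hγ : γ ∈ Ioo (6 / 5 : ℝ) (4 / 3)) (ht : 0 < t) :
    ∃ E, IsOrthonormalFrame (ropeMetric γ) t E ∧
      hState (ropeMetric γ) (ropeForm γ) (ropeDensity γ) t E = ropeState (3 * γ / 2 - 1) := by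
  obtain ⟨hγ1, hγ2⟩ := hγ
  have hγ0 : 0 < γ := by linarith
  have h2γ : 0 < 2 - γ := by linarith
  have hev := ropeMetric_eventuallyEq hγ0 ht
  set c := ropeTilt γ with hcdef
  have hc2 : c ^ 2 = 2 * (5 * γ - 6) / (2 - γ) := ropeTilt_sq ⟨hγ1.le, hγ2.le⟩
  have hc0 : 0 ≤ c := Real.sqrt_nonneg _
  refine ⟨scalingFrame (-ropeExponent γ) t * tiltFrame c, ?_, ?_⟩
  · rw [IsOrthonormalFrame, hev.eq_of_nhds]
    exact isOrthonormalFrame_scaling ht (tiltFrame_orthonormal c)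
  · rw [hState_eq, frameExpansion, expansion_congr hev, ← frameExpansion,
      frameExpansion_scaling ht, ropeExponent, tiltFrame_expansion, ← ropeExponent,
      hubble_rope hγ0 ht, ropeState, canonState]
    have hform : frameForm (ropeForm γ) t (scalingFrame (-ropeExponent γ) t * tiltFrame c)
        = ![t⁻¹ * ((2 - γ) / γ * Real.sqrt (1 + c ^ 2)), 0, 0] := by
      have h1 : spatialPart (ropeForm γ t) = ![(2 - γ) / γ, 0, 0] := by
        ext i; fin_cases i <;> simp [spatialPart, ropeForm]
      rw [frameForm, h1, Matrix.transpose_mul, scalingFrame_transpose, ← Matrix.mulVec_mulVec,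
        scalingFrame_neg_mulVec (by intro i; fin_cases i <;> simp [ropeExponent])]
      ext i
      fin_cases i <;> simp [tiltFrame, Matrix.mulVec, dotProduct, Fin.sum_univ_three]
      ring
    have hw : c * (2 - (3 * γ / 2 - 1)) / 2
        = Real.sqrt ((2 - (3 * γ / 2 - 1)) * (5 * (3 * γ / 2 - 1) - 4) / 2) := by
      symm
      rw [Real.sqrt_eq_iff_mul_self_eq (by
        apply div_nonneg _ two_pos.le; apply mul_nonneg <;> linarith) (by
        apply div_nonneg _ two_pos.le; apply mul_nonneg <;> linarith)]
      have : c * (2 - (3 * γ / 2 - 1)) / 2 * (c * (2 - (3 * γ / 2 - 1)) / 2)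
        = c ^ 2 * (2 - (3 * γ / 2 - 1)) ^ 2 / 4 := by ring
      rw [this, hc2]
      field_simp
      ring
    have hv : 3 * γ / 2 * ((2 - γ) / γ * Real.sqrt (1 + c ^ 2)) / Real.sqrt 6
        = Real.sqrt ((2 - (3 * γ / 2 - 1)) * (3 * (3 * γ / 2 - 1) - 2) / 2) := by
      have h1 : 3 * γ / 2 * ((2 - γ) / γ * Real.sqrt (1 + c ^ 2)) / Real.sqrt 6
        = Real.sqrt ((3 * (2 - γ) / 2) ^ 2 * (1 + c ^ 2) / 6) := by
        rw [Real.sqrt_div (by positivity), Real.sqrt_mul (by positivity),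
          Real.sqrt_sq (by linarith)]
        field_simp
      rw [h1, hc2]
      congr 1
      field_simp
      ring
    have h6 : Real.sqrt 6 ≠ 0 := by positivity
    refine Prod.ext ?_ (Prod.ext ?_ (Prod.ext ?_ ?_))
    · rw [← hw]
      ext i j
      fin_cases i <;> fin_cases j <;> simp [Matrix.one_apply] <;> field_simp <;> ring
    · rw [hform, ← hv]
      ext i
      fin_cases i <;> simp
      field_simp
    · simp [ropeForm]
    · simp only [ropeDensity]
      field_simp
      ring

lemma isEquilibrium_rope (hγ : γ ∈ Ioo (6 / 5 : ℝ) (4 / 3)) :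
    IsEquilibrium (Ioi 0) (ropeMetric γ) (ropeForm γ) (ropeDensity γ)
      (ropeState (3 * γ / 2 - 1)) := by
  intro t ht
  have hγ0 : 0 < γ := by linarith [hγ.1]
  have ht : 0 < t := ht
  refine ⟨?_, hState_rope hγ ht⟩
  rw [hubble_rope hγ0 ht]; positivity

/-- The homothety is t∂_t + Σ (1 - a_i) x^i ∂_i: the first term multiplies h_ij by a_i + a_j, and
the others contribute the missing 2 - a_i - a_j. -/
lemma isSelfSimilar_rope (hγ : 0 < γ) :
    IsSelfSimilar (slab (Ioi 0)) (typeIMetric (ropeMetric γ)) := by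
  refine ⟨fun p => Fin.cons (p 0) fun i => (1 - ropeExponent γ i) * p i.succ, ?_, ?_⟩
  · refine ContDiff.contDiffOn (contDiff_pi.2 fun μ => ?_)
    refine Fin.cases ?_ (fun i => ?_) μ
    · simp only [Fin.cons_zero]; fun_prop
    · simp only [Fin.cons_succ]; fun_prop
  · intro p hp μ ν
    have ht : 0 < p 0 := hp
    have hpd : ∀ (μ : Fin 4) (i : Fin 3) (c : ℝ),
        pd μ (fun x : Pt => c * x i.succ) p = if i.succ = μ then c else 0 := by
      intro μ i c
      rw [pd, lineDeriv]
      have : (fun s : ℝ => c * (p + s • Pi.single μ (1 : ℝ) : Pt) i.succ)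
          = fun s => c * p i.succ + s * (if i.succ = μ then c else 0) := by
        ext s; simp [Pi.single_apply]; split_ifs <;> ring
      rw [this]
      split_ifs <;> simp
    have hpd0 : ∀ μ : Fin 4, pd μ (fun x : Pt => x 0) p = if 0 = μ then 1 else 0 := by
      intro μ
      rw [pd, lineDeriv]
      have : (fun s : ℝ => (p + s • Pi.single μ (1 : ℝ) : Pt) 0)
          = fun s => p 0 + s * (if 0 = μ then 1 else 0) := by
        ext s; simp [Pi.single_apply]
      rw [this]
      split_ifs <;> simp
    have hd : ∀ i j, metricDot (ropeMetric γ) (p 0) i j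
        = (p 0)⁻¹ * (ropeExponent γ i + ropeExponent γ j) * ropeMetric γ (p 0) i j := by
      intro i j
      have h1 : (fun s => ropeMetric γ s i j) =ᶠ[𝓝 (p 0)] fun s =>
          scalingMetric (ropeExponent γ) (tiltMatrix (ropeTilt γ)) s i j :=
        (ropeMetric_eventuallyEq hγ ht).fun_comp fun A => A i j
      rw [metricDot, Matrix.of_apply, h1.deriv_eq, (hasDerivAt_scaling ht i j).deriv, ropeMetric_eq hγ ht]
      simp only [scalingMetric, scalingExpansion, Matrix.of_apply]
      ring
    rw [lieMetric, Fin.sum_univ_succ]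
    simp only [Fin.cons_zero, Fin.cons_succ]
    refine Fin.cases ?_ (fun i => ?_) μ <;> refine Fin.cases ?_ (fun j => ?_) ν
    · simp [hpd0, hpd, pd_const, typeIMetric]
      norm_num
    · simp [hpd0, hpd, pd_const, typeIMetric, (Fin.succ_ne_zero _).symm,
        Fin.succ_ne_zero]
    · simp [hpd0, hpd, pd_const, typeIMetric, (Fin.succ_ne_zero _).symm,
        Fin.succ_ne_zero]
    · rw [pd_typeIMetric_time]
      simp only [hd, pd_typeIMetric_space, hpd0, hpd]
      have h0 := ht.ne'
      simp [typeIMetric, (Fin.succ_ne_zero _).symm, Finset.sum_add_distrib]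
      field_simp
      ring

end Rope

end JFormCosmology

namespace JFormCosmology

/-! ### Independence of powers -/

/-- This applies the Euler operator t d/dt, of which the powers are eigenfunctions. -/
lemma rpow_sum_deriv {α β δ p q r t₀ : ℝ} (ht₀ : 0 < t₀)
    (hz : ∀ᶠ t in 𝓝 t₀, α * t ^ p + β * t ^ q + δ * t ^ r = 0) :
    ∀ᶠ t in 𝓝 t₀, (α * p) * t ^ p + (β * q) * t ^ q + (δ * r) * t ^ r = 0 := by
  filter_upwards [hz.eventually_nhds, lt_mem_nhds ht₀] with t ht htpos
  have h1 : HasDerivAt (fun t : ℝ => α * t ^ p + β * t ^ q + δ * t ^ r) 0 t :=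
    (hasDerivAt_const t (0 : ℝ)).congr_of_eventuallyEq ht
  have h2 := (((Real.hasDerivAt_rpow_const (p := p) (Or.inl htpos.ne')).const_mul α).add
    ((Real.hasDerivAt_rpow_const (p := q) (Or.inl htpos.ne')).const_mul β)).add
    ((Real.hasDerivAt_rpow_const (p := r) (Or.inl htpos.ne')).const_mul δ)
  have h3 := h2.unique h1
  simp only [Real.rpow_sub_one htpos.ne'] at h3
  field_simp at h3
  linear_combination h3

/-- Applying the Euler operator zero, one and two times gives a Vandermonde system in the exponents.
-/
lemma rpow_independent {α β δ p q r t₀ : ℝ} (ht₀ : 0 < t₀) (hpq : p ≠ q) (hpr : p ≠ r)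
    (hqr : q ≠ r) (hz : ∀ᶠ t in 𝓝 t₀, α * t ^ p + β * t ^ q + δ * t ^ r = 0) :
    α = 0 ∧ β = 0 ∧ δ = 0 := by
  have hz1 := rpow_sum_deriv ht₀ hz
  have e0 := hz.self_of_nhds
  have e1 := hz1.self_of_nhds
  have e2 := (rpow_sum_deriv ht₀ hz1).self_of_nhds
  have P : t₀ ^ p ≠ 0 := (Real.rpow_pos_of_pos ht₀ p).ne'
  have Q : t₀ ^ q ≠ 0 := (Real.rpow_pos_of_pos ht₀ q).ne'
  have R : t₀ ^ r ≠ 0 := (Real.rpow_pos_of_pos ht₀ r).ne'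
  have a1 : α * (t₀ ^ p * ((p - q) * (p - r))) = 0 := by
    linear_combination e2 - (q + r) * e1 + q * r * e0
  have a2 : β * (t₀ ^ q * ((q - p) * (q - r))) = 0 := by
    linear_combination e2 - (p + r) * e1 + p * r * e0
  have a3 : δ * (t₀ ^ r * ((r - p) * (r - q))) = 0 := by
    linear_combination e2 - (p + q) * e1 + p * q * e0
  refine ⟨(mul_eq_zero.1 a1).resolve_right ?_, (mul_eq_zero.1 a2).resolve_right ?_,
    (mul_eq_zero.1 a3).resolve_right ?_⟩
  · exact mul_ne_zero P (mul_ne_zero (sub_ne_zero.2 hpq) (sub_ne_zero.2 hpr))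
  · exact mul_ne_zero Q (mul_ne_zero (sub_ne_zero.2 hpq.symm) (sub_ne_zero.2 hqr))
  · exact mul_ne_zero R (mul_ne_zero (sub_ne_zero.2 hpr.symm) (sub_ne_zero.2 hqr.symm))

/-! ### Killing fields of type I metrics that preserve the observers -/

/-- A Killing field near `p` that preserves the observers and vanishes at `p` is given to first
order by a constant matrix that is infinitesimally orthogonal for the metric at nearby times. -/
lemma exists_infinitesimal_isometry {h : SpatialMetric} {p : Pt} {N : Set Pt} (hN : IsOpen N)
    (hp : p ∈ N) (hh : ∀ᶠ t in 𝓝 (p 0), IsUnit (h t)) {X : Pt → Fin 4 → ℝ}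
    (hX : ContDiffOn ℝ ∞ X N)
    (hk : ∀ x ∈ N, ∀ μ ν, lieMetric (typeIMetric h) X μ ν x = 0)
    (hu : ∀ x ∈ N, ∀ μ, lieOneForm comoving X μ x = 0) (hXp : X p = 0) :
    (∀ μ, pd μ (fun x => X x 0) p = 0) ∧ (∀ k : Fin 3, pd 0 (fun x => X x k.succ) p = 0) ∧
    ∀ᶠ t in 𝓝 (p 0), ∀ i j : Fin 3,
      ∑ k : Fin 3, (h t k j * pd i.succ (fun x => X x k.succ) p
        + h t i k * pd j.succ (fun x => X x k.succ) p) = 0 := by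
  -- Invariance of -dt says that X⁰ has zero differential.
  have h0 : ∀ x ∈ N, ∀ μ, pd μ (fun x => X x 0) x = 0 := by
    intro x hx μ
    have h1 := hu x hx μ
    have h2 : ∀ l, pd l (fun x => comoving x μ) x = 0 := fun l => pd_const _ _ _
    simp only [lieOneForm, h2, mul_zero, zero_add, Fin.sum_univ_succ] at h1
    simpa [comoving] using h1
  obtain ⟨ε, hε, hball⟩ := Metric.isOpen_iff.1 hN p hp
  obtain ⟨ε', hε', hunit⟩ := Metric.eventually_nhds_iff.1 hh
  set δ := min ε ε' with hδ
  have hδpos : 0 < δ := lt_min hε hε'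
  have hballN : Metric.ball p δ ⊆ N :=
    (Metric.ball_subset_ball (min_le_left _ _)).trans hball
  have hunit' : ∀ x ∈ Metric.ball p δ, IsUnit (h (x 0)) := fun x hx => hunit (by
    have := (dist_le_pi_dist x p 0).trans_lt hx
    exact this.trans_le (min_le_right _ _))
  -- The mixed Killing equations reduce to h ∂_t X = 0, and h is invertible here.
  have ht : ∀ x ∈ Metric.ball p δ, ∀ k : Fin 3, pd 0 (fun x => X x k.succ) x = 0 := by
    intro x hx
    have h1 : h (x 0) *ᵥ (fun k : Fin 3 => pd 0 (fun x => X x k.succ) x) = 0 := by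
      ext j
      have h2 := hk x (hballN hx) j.succ 0
      rw [lieMetric, Fin.sum_univ_succ] at h2
      simp only [pd_typeIMetric_zero_right, h0 x (hballN hx), mul_zero, zero_add] at h2
      simpa [typeIMetric, Matrix.mulVec, dotProduct] using h2
    have h3 := (Matrix.mulVec_injective_iff_isUnit.2 (hunit' x hx)) (h1.trans (by simp) :
      h (x 0) *ᵥ _ = h (x 0) *ᵥ 0)
    exact fun k => congrFun h3 k
  have hdiff : ∀ x ∈ Metric.ball p δ, ∀ μ, DifferentiableAt ℝ (fun x => X x μ) x := by
    intro x hx μ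
    exact differentiableAt_pi.1 (((hX x (hballN hx)).contDiffAt
      (hN.mem_nhds (hballN hx))).differentiableAt (by norm_num)) μ
  have hnorm : ‖(Pi.single 0 1 : Pt)‖ ≤ 1 := by
    rw [pi_norm_le_iff_of_nonneg zero_le_one]
    intro i
    by_cases h : i = 0 <;> simp [Pi.single_apply, h]
  -- X is constant along time lines. The radius is halved so that the shifted points stay in the
  -- ball of radius δ. The spatial Killing equations at a shifted point then involve the metric at
  -- that time but the derivatives of X at `p`.
  have hconst : ∀ x ∈ Metric.ball p (δ / 2), ∀ μ, ∀ τ ∈ Metric.ball (0 : ℝ) (δ / 2),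
      X (x + τ • Pi.single 0 1) μ = X x μ := by
    intro x hx μ τ hτ
    have hmem : ∀ σ ∈ Metric.ball (0 : ℝ) (δ / 2), x + σ • (Pi.single 0 1 : Pt) ∈
        Metric.ball p δ := by
      intro σ hσ
      rw [Metric.mem_ball, dist_eq_norm] at hx ⊢
      rw [mem_ball_zero_iff] at hσ
      have e1 : x + σ • (Pi.single 0 1 : Pt) - p = (x - p) + σ • (Pi.single 0 1 : Pt) := by abel
      rw [e1]
      refine (norm_add_le _ _).trans_lt ?_
      have : ‖σ • (Pi.single 0 1 : Pt)‖ ≤ ‖σ‖ := by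
        rw [norm_smul]; exact mul_le_of_le_one_right (norm_nonneg _) hnorm
      linarith
    have hd : ∀ σ ∈ Metric.ball (0 : ℝ) (δ / 2),
        HasDerivAt (fun σ : ℝ => X (x + σ • Pi.single 0 1) μ) 0 σ := by
      intro σ hσ
      have h1 := (hdiff _ (hmem σ hσ) μ).hasFDerivAt
      have h2 : HasDerivAt (fun σ : ℝ => x + σ • (Pi.single 0 1 : Pt)) (Pi.single 0 1) σ := by
        simpa using ((hasDerivAt_id σ).smul_const (Pi.single 0 1 : Pt)).const_add x
      have h3 := h1.comp_hasDerivAt σ h2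
      refine h3.congr_deriv ?_
      rw [← (hdiff _ (hmem σ hσ) μ).lineDeriv_eq_fderiv]
      change pd 0 (fun x => X x μ) _ = 0
      refine Fin.cases ?_ (fun k => ?_) μ
      · exact h0 _ (hballN (hmem σ hσ)) 0
      · exact ht _ (hmem σ hσ) k
    have := Metric.isOpen_ball.is_const_of_deriv_eq_zero
      (convex_ball (0 : ℝ) (δ / 2)).isPreconnected
      (fun σ hσ => (hd σ hσ).differentiableAt.differentiableWithinAt)
      (fun σ hσ => (hd σ hσ).deriv) hτ (Metric.mem_ball_self (by positivity))
    simpa using this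
  refine ⟨h0 p hp, ht p (Metric.mem_ball_self hδpos), ?_⟩
  have hδ2 : 0 < δ / 2 := by positivity
  filter_upwards [Metric.ball_mem_nhds (p 0) hδ2] with t hτ i j
  set τ := t - p 0 with hτdef
  have hτ0 : τ ∈ Metric.ball (0 : ℝ) (δ / 2) := by
    rw [mem_ball_zero_iff]; rwa [Metric.mem_ball, dist_eq_norm] at hτ
  set y : Pt := p + τ • Pi.single 0 1 with hy
  have hyball : y ∈ Metric.ball p δ := by
    rw [Metric.mem_ball, dist_eq_norm, hy, add_sub_cancel_left, norm_smul]
    rw [mem_ball_zero_iff] at hτ0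
    have := mul_le_of_le_one_right (norm_nonneg τ) hnorm
    linarith
  have hy0 : y 0 = t := by simp [hy, hτdef]
  have hpd : ∀ (i k : Fin 3), pd i.succ (fun x => X x k.succ) y
      = pd i.succ (fun x => X x k.succ) p := by
    intro i k
    rw [pd, pd, lineDeriv, lineDeriv]
    apply Filter.EventuallyEq.deriv_eq
    have hc : Tendsto (fun s : ℝ => p + s • (Pi.single i.succ 1 : Pt)) (𝓝 0) (𝓝 p) := by
      have : Continuous fun s : ℝ => p + s • (Pi.single i.succ 1 : Pt) := by fun_prop
      simpa using this.tendsto 0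
    filter_upwards [hc.eventually (Metric.ball_mem_nhds p hδ2)] with s hs
    rw [← hconst _ hs k.succ τ hτ0, hy]
    congr 1
    abel_nf
  have hX0 : X y 0 = 0 := by
    rw [hy, hconst p (Metric.mem_ball_self hδ2) 0 τ hτ0, hXp]; rfl
  have h2 := hk y (hballN hyball) i.succ j.succ
  rw [lieMetric, Fin.sum_univ_succ] at h2
  simp only [hX0, pd_typeIMetric_space, h0 y (hballN hyball), hpd] at h2
  simpa [typeIMetric, hy0] using h2

/-- With B the matrix of spatial derivatives of X at p, the product h(t)B is antisymmetric for all
nearby t. Its entries involve the powers 2a₂ < 2a₃ < 1 + a₃ < 2 of t, which are independent, and the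
tilt c is nonzero, so B = 0. -/
theorem not_isLRSAt_rope {γ : ℝ} (hγ : γ ∈ Ioo (6 / 5 : ℝ) (4 / 3)) {p : Pt}
    (hp : p ∈ slab (Ioi 0)) : ¬ IsLRSAt (typeIMetric (ropeMetric γ)) comoving p := by
  rintro ⟨N, hN, hpN, X, hX, hk, hu, hXp, μ, ν, hne⟩
  obtain ⟨hγ1, hγ2⟩ := hγ
  have hγ0 : 0 < γ := by linarith
  have ht : 0 < p 0 := hp
  have hunit : ∀ᶠ t in 𝓝 (p 0), IsUnit (ropeMetric γ t) := by
    filter_upwards [lt_mem_nhds ht] with t ht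
    exact (evolutionAt_rope ⟨hγ1.le, hγ2.le⟩ ht).posDef.isUnit
  obtain ⟨e0, e1, e2⟩ := exists_infinitesimal_isometry hN hpN hunit hX hk hu hXp
  set B : Fin 3 → Fin 3 → ℝ := fun k i => pd i.succ (fun x => X x k.succ) p with hB
  set c := ropeTilt γ with hc
  have hcpos : 0 < c := Real.sqrt_pos.2 (div_pos (by linarith) (by linarith))
  set a₂ := (4 - 3 * γ) / γ with ha₂
  set a₃ := 2 * (γ - 1) / γ with ha₃
  have b2 : a₂ < 1 / 3 := by rw [ha₂, div_lt_iff₀ hγ0]; linarith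
  have b3 : 1 / 3 < a₃ := by rw [ha₃, lt_div_iff₀ hγ0]; linarith
  have b3' : a₃ < 1 := by rw [ha₃, div_lt_iff₀ hγ0]; linarith
  have hm : ∀ᶠ t in 𝓝 (p 0), ∀ i j : Fin 3,
      ∑ k : Fin 3, (scalingMetric (ropeExponent γ) (tiltMatrix c) t k j * B k i
        + scalingMetric (ropeExponent γ) (tiltMatrix c) t i k * B k j) = 0 := by
    filter_upwards [e2, lt_mem_nhds ht] with t h1 h2
    rw [ropeMetric_eq hγ0 h2] at h1
    exact h1
  -- Where fewer than three powers occur, spare exponents with coefficient zero fill up the form of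
  -- `rpow_independent`.
  have r00 : ∀ᶠ t in 𝓝 (p 0), B 0 0 * t ^ ((1 : ℝ) + 1) + c * B 2 0 * t ^ (1 + a₃)
      + 0 * t ^ (0 : ℝ) = 0 := by
    filter_upwards [hm] with t h1
    have := h1 0 0
    simp [scalingMetric, tiltMatrix, ropeExponent, Fin.sum_univ_three, ← ha₂, ← ha₃,
      add_comm a₃ 1] at this
    linear_combination this / 2
  have r22 : ∀ᶠ t in 𝓝 (p 0), c * B 0 2 * t ^ (1 + a₃) + (1 + c ^ 2) * B 2 2 * t ^ (a₃ + a₃)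
      + 0 * t ^ (0 : ℝ) = 0 := by
    filter_upwards [hm] with t h1
    have := h1 2 2
    simp [scalingMetric, tiltMatrix, ropeExponent, Fin.sum_univ_three, ← ha₂, ← ha₃,
      add_comm a₃ 1] at this
    linear_combination this / 2
  have r11 : ∀ᶠ t in 𝓝 (p 0), B 1 1 * t ^ (a₂ + a₂) + 0 * t ^ (a₂ + a₂ + 1)
      + 0 * t ^ (a₂ + a₂ + 2) = 0 := by
    filter_upwards [hm] with t h1
    have := h1 1 1
    simp [scalingMetric, tiltMatrix, ropeExponent, Fin.sum_univ_three, ← ha₂, ← ha₃,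
      add_comm a₃ 1] at this
    rcases this with h | h <;> rw [h] <;> ring
  have r01 : ∀ᶠ t in 𝓝 (p 0), B 1 0 * t ^ (a₂ + a₂) + B 0 1 * t ^ ((1 : ℝ) + 1)
      + c * B 2 1 * t ^ (1 + a₃) = 0 := by
    filter_upwards [hm] with t h1
    have := h1 0 1
    simp [scalingMetric, tiltMatrix, ropeExponent, Fin.sum_univ_three, ← ha₂, ← ha₃,
      add_comm a₃ 1] at this
    linear_combination this
  have r12 : ∀ᶠ t in 𝓝 (p 0), c * B 0 1 * t ^ (1 + a₃) + (1 + c ^ 2) * B 2 1 * t ^ (a₃ + a₃)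
      + B 1 2 * t ^ (a₂ + a₂) = 0 := by
    filter_upwards [hm] with t h1
    have := h1 1 2
    simp [scalingMetric, tiltMatrix, ropeExponent, Fin.sum_univ_three, ← ha₂, ← ha₃,
      add_comm a₃ 1] at this
    linear_combination this
  obtain ⟨z00, z20, -⟩ := rpow_independent ht (by linarith) (by norm_num) (by linarith) r00
  obtain ⟨z02, z22, -⟩ := rpow_independent ht (by linarith) (by linarith) (by linarith) r22
  obtain ⟨z11, -, -⟩ := rpow_independent ht (by linarith) (by linarith) (by linarith) r11
  obtain ⟨z10, z01, z21⟩ := rpow_independent ht (by linarith) (by linarith) (by linarith) r01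
  obtain ⟨-, -, z12⟩ := rpow_independent ht (by linarith) (by linarith) (by linarith) r12
  have z20' := (mul_eq_zero.1 z20).resolve_left hcpos.ne'
  have z02' := (mul_eq_zero.1 z02).resolve_left hcpos.ne'
  have z21' := (mul_eq_zero.1 z21).resolve_left hcpos.ne'
  have z22' := (mul_eq_zero.1 z22).resolve_left (by positivity)
  have hBz : ∀ k i, B k i = 0 := by
    intro k i
    fin_cases k <;> fin_cases i <;> assumption
  apply hne
  refine Fin.cases (e0 μ) (fun k => ?_) ν
  refine Fin.cases (e1 k) (fun i => hBz k i) μ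

/-! ### Wonderland and the Edge -/

lemma tendsto_ropeMetric {γ₀ t : ℝ} (hγ₀ : γ₀ ∈ Ioo (0 : ℝ) 2) (ht : 0 < t) (s : Set ℝ) :
    Tendsto (fun γ => ropeMetric γ t) (𝓝[s] γ₀) (𝓝 (ropeMetric γ₀ t)) := by
  have h1 : γ₀ ≠ 0 := hγ₀.1.ne'
  have h2 : 2 - γ₀ ≠ 0 := by linarith [hγ₀.2]
  have hpow : ∀ f : ℝ → ℝ, ContinuousAt f γ₀ → ContinuousAt (fun γ => t ^ f γ) γ₀ := fun f hf =>
    continuousAt_const.rpow hf (Or.inl ht.ne')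
  have c1 : ContinuousAt (fun γ : ℝ => Real.sqrt (2 * (5 * γ - 6) / (2 - γ)) * t ^ (1 - 2 / γ))
      γ₀ :=
    (Real.continuous_sqrt.continuousAt.comp
      (f := fun γ : ℝ => 2 * (5 * γ - 6) / (2 - γ))
      (ContinuousAt.div (by fun_prop) (by fun_prop) h2)).mul
      (hpow _ (continuousAt_const.sub (continuousAt_const.div continuousAt_id h1)))
  have c2 : ContinuousAt (fun γ : ℝ => t ^ (2 * (4 - 3 * γ) / γ)) γ₀ :=
    hpow _ (ContinuousAt.div (by fun_prop) continuousAt_id h1)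
  have c3 : ContinuousAt (fun γ : ℝ => t ^ (4 * (γ - 1) / γ)) γ₀ :=
    hpow _ (ContinuousAt.div (by fun_prop) continuousAt_id h1)
  have : ContinuousAt (fun γ => ropeMetric γ t) γ₀ := by
    refine continuousAt_pi.2 fun i => continuousAt_pi.2 fun j => ?_
    have hvec : ∀ i : Fin 3, ContinuousAt (fun γ : ℝ =>
        (![1, 0, Real.sqrt (2 * (5 * γ - 6) / (2 - γ)) * t ^ (1 - 2 / γ)] : Fin 3 → ℝ) i) γ₀ := by
      intro i
      fin_cases i
      · exact continuousAt_const
      · exact continuousAt_const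
      · exact c1
    simp only [ropeMetric, sqForm, Matrix.add_apply, Matrix.smul_apply, vecMulVec_apply,
      smul_eq_mul]
    exact ((continuousAt_const.mul ((hvec i).mul (hvec j))).add
      (c2.mul continuousAt_const)).add (c3.mul continuousAt_const)
  exact this.tendsto.mono_left nhdsWithin_le_nhds

lemma tendsto_ropeForm {γ₀ : ℝ} (hγ₀ : 0 < γ₀) (t : ℝ) (s : Set ℝ) :
    Tendsto (fun γ => ropeForm γ t) (𝓝[s] γ₀) (𝓝 (ropeForm γ₀ t)) := by
  have : ContinuousAt (fun γ => ropeForm γ t) γ₀ := by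
    refine continuousAt_pi.2 fun i => ?_
    fin_cases i
    · exact continuousAt_const
    · exact ContinuousAt.div (f := fun γ : ℝ => 2 - γ) (by fun_prop) continuousAt_id hγ₀.ne'
    · exact continuousAt_const
    · exact continuousAt_const
  exact this.tendsto.mono_left nhdsWithin_le_nhds

lemma tendsto_ropeDensity {γ₀ t : ℝ} (hγ₀ : 0 < γ₀) (ht : 0 < t) (s : Set ℝ) :
    Tendsto (fun γ => ropeDensity γ t) (𝓝[s] γ₀) (𝓝 (ropeDensity γ₀ t)) := by
  have : ContinuousAt (fun γ => ropeDensity γ t) γ₀ := by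
    refine ContinuousAt.div (by fun_prop) (by fun_prop) ?_
    positivity
  exact this.tendsto.mono_left nhdsWithin_le_nhds

/-- At γ = 6/5 the tilt vanishes and the exponents of dy² and dz² coincide. -/
lemma ropeMetric_wonderland (t : ℝ) :
    ropeMetric (6 / 5) t = wonderlandMetric (6 / 5) t := by
  rw [ropeMetric, wonderlandMetric]
  norm_num
  rw [add_assoc]

lemma ropeForm_wonderland (t : ℝ) : ropeForm (6 / 5) t = wonderlandForm (6 / 5) t := by
  have h1 : Real.sqrt ((3 * (6 / 5) - 2) * (2 - 6 / 5) / 2) = 4 / 5 := by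
    rw [show ((3 * (6 / 5) - 2) * (2 - 6 / 5) / 2 : ℝ) = (4 / 5) ^ 2 by norm_num]
    exact Real.sqrt_sq (by norm_num)
  rw [ropeForm, wonderlandForm, h1]
  norm_num

lemma ropeDensity_wonderland (t : ℝ) : ropeDensity (6 / 5) t = wonderlandDensity (6 / 5) t := by
  rw [ropeDensity, wonderlandDensity]
  norm_num

lemma ropeMetric_edge (t : ℝ) : ropeMetric (4 / 3) t = edgeMetric t := by
  rw [ropeMetric, edgeMetric]
  norm_num

lemma ropeForm_edge (t : ℝ) : ropeForm (4 / 3) t = edgeForm t := by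
  rw [ropeForm, edgeForm]
  norm_num

lemma ropeDensity_edge (t : ℝ) : ropeDensity (4 / 3) t = 0 := by
  rw [ropeDensity]
  norm_num

end JFormCosmology

namespace JFormCosmology

/-! ### Global existence for ordinary differential equations with a priori bounds -/

section GlobalExistence

variable {ι : Type*} [Fintype ι]

/-- Truncation of all coordinates to `[-R, R]`. -/
noncomputable def truncate (R : ℝ) (x : ι → ℝ) : ι → ℝ := fun i => max (-R) (min R (x i))

lemma lipschitzWith_truncate (R : ℝ) : LipschitzWith 1 (truncate R : (ι → ℝ) → ι → ℝ) := by
  refine LipschitzWith.of_dist_le_mul fun x y => ?_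
  rw [NNReal.coe_one, one_mul, dist_pi_le_iff dist_nonneg]
  intro i
  refine le_trans ?_ (dist_le_pi_dist x y i)
  rw [Real.dist_eq, Real.dist_eq]
  have h1 := abs_max_sub_max_le_max (-R) (min R (x i)) (-R) (min R (y i))
  have h2 := abs_min_sub_min_le_max R (x i) R (y i)
  simp only [sub_self, abs_zero] at h1 h2
  exact h1.trans (max_le (abs_nonneg _) (h2.trans (max_le (abs_nonneg _) le_rfl)))

lemma norm_truncate_le {R : ℝ} (hR : 0 ≤ R) (x : ι → ℝ) : ‖truncate R x‖ ≤ R := by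
  rw [pi_norm_le_iff_of_nonneg hR]
  intro i
  rw [Real.norm_eq_abs, abs_le]
  exact ⟨le_max_left _ _, max_le (by linarith) (min_le_left _ _)⟩

lemma truncate_of_norm_le {R : ℝ} {x : ι → ℝ} (hx : ‖x‖ ≤ R) : truncate R x = x := by
  ext i
  have := (norm_le_pi_norm x i).trans hx
  rw [Real.norm_eq_abs, abs_le] at this
  simp [truncate, this.1, this.2]

lemma exists_lipschitzOnWith_closedBall {F : (ι → ℝ) → ι → ℝ} (hF : ContDiff ℝ 1 F) (R : ℝ) :
    ∃ K, LipschitzOnWith K F (Metric.closedBall 0 R) :=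
  (hF.contDiffOn).exists_lipschitzOnWith one_ne_zero (convex_closedBall 0 R)
    (isCompact_closedBall 0 R)

/-- An autonomous differential equation whose solutions satisfy an a priori bound on `[t₁, T)` has
a solution on a neighbourhood of `[t₁, T)`. -/
theorem exists_solution_of_apriori_bound {F : (ι → ℝ) → ι → ℝ} (hF : ContDiff ℝ 1 F)
    (y₀ : ι → ℝ) {t₁ T B : ℝ} (hT : t₁ < T)
    (hB : ∀ ε > 0, ∀ s ∈ Ioc t₁ T, ∀ y : ℝ → ι → ℝ, y t₁ = y₀ →
      (∀ t ∈ Ioo (t₁ - ε) s, HasDerivAt y (F (y t)) t) → ∀ t ∈ Ico t₁ s, ‖y t‖ ≤ B) :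
    ∃ ε > 0, ∃ y : ℝ → ι → ℝ, y t₁ = y₀ ∧ ∀ t ∈ Ioo (t₁ - ε) T, HasDerivAt y (F (y t)) t := by
  -- Strictly above the a priori bound and the initial value, so that the truncation at R is never
  -- active on a genuine solution.
  set R : ℝ := max B ‖y₀‖ + 1 with hRdef
  have hBR : B < R := (le_max_left _ _).trans_lt (lt_add_one _)
  have hyR : ‖y₀‖ < R := (le_max_right _ _).trans_lt (lt_add_one _)
  have hR : 0 ≤ R := (norm_nonneg _).trans hyR.le
  obtain ⟨K, hK⟩ := exists_lipschitzOnWith_closedBall hF R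
  obtain ⟨L, hL⟩ := (isCompact_closedBall (0 : ι → ℝ) R).exists_bound_of_continuousOn
    hF.continuous.continuousOn
  have hmem : ∀ x : ι → ℝ, truncate R x ∈ Metric.closedBall (0 : ι → ℝ) R := fun x => by
    simpa using norm_truncate_le hR x
  have hL0 : 0 ≤ L := (norm_nonneg _).trans (hL _ (hmem y₀))
  have hlip : LipschitzWith (K * 1) (fun x => F (truncate R x)) := by
    rw [← lipschitzOnWith_univ]
    exact hK.comp (lipschitzOnWith_univ.2 (lipschitzWith_truncate R)) fun x _ => hmem x
  have ht₁ : t₁ ∈ Icc (t₁ - 1) T := ⟨by linarith, hT.le⟩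
  have hmax : 0 ≤ max (T - t₁) (t₁ - (t₁ - 1)) := le_max_of_le_left (by linarith)
  -- The truncated field is bounded by L and Lipschitz on the whole space, so one application of
  -- Picard-Lindelöf covers the whole interval.
  have hPL : IsPicardLindelof (fun _ x => F (truncate R x)) (tmin := t₁ - 1) (tmax := T)
      ⟨t₁, ht₁⟩ y₀ ⟨L * max (T - t₁) (t₁ - (t₁ - 1)), mul_nonneg hL0 hmax⟩ 0 ⟨L, hL0⟩ (K * 1) :=
    IsPicardLindelof.of_time_independent (fun x _ => hL _ (hmem x)) hlip.lipschitzOnWith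
      (by rw [NNReal.coe_zero, sub_zero]; exact le_rfl)
  obtain ⟨y, hy₀, hy⟩ := hPL.exists_eq_forall_mem_Icc_hasDerivWithinAt₀
  simp only at hy₀
  have hcont : ContinuousOn y (Icc (t₁ - 1) T) := fun t ht => (hy t ht).continuousWithinAt
  have hy' : ∀ t ∈ Ioo (t₁ - 1) T, HasDerivAt y (F (truncate R (y t))) t := fun t ht =>
    (hy t (Ioo_subset_Icc_self ht)).hasDerivAt (Icc_mem_nhds ht.1 ht.2)
  obtain ⟨ε, hε, hε1, hsmall⟩ : ∃ ε > 0, ε ≤ 1 ∧ ∀ t ∈ Ioc (t₁ - ε) t₁, ‖y t‖ < R := by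
    have hc : ContinuousAt (fun t => ‖y t‖) t₁ :=
      ((hy' t₁ ⟨by linarith, hT⟩).continuousAt).norm
    have hev : ∀ᶠ t in 𝓝 t₁, ‖y t‖ < R := hc.eventually_lt continuousAt_const (by rw [hy₀]; exact hyR)
    obtain ⟨δ, hδ, hball⟩ := Metric.eventually_nhds_iff.1 hev
    refine ⟨min δ 1, lt_min hδ one_pos, min_le_right _ _, fun t ht => hball ?_⟩
    rw [Real.dist_eq, abs_lt]
    constructor <;> linarith [ht.1, ht.2, min_le_left δ 1]
  have hode : ∀ s ≤ T, (∀ t ∈ Ico t₁ s, ‖y t‖ < R) →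
      ∀ t ∈ Ioo (t₁ - ε) s, HasDerivAt y (F (y t)) t := by
    intro s hs hlt t ht
    have hn : ‖y t‖ < R := by
      rcases le_or_gt t t₁ with h | h
      · exact hsmall t ⟨ht.1, h⟩
      · exact hlt t ⟨h.le, ht.2⟩
    have := hy' t ⟨by linarith [ht.1], ht.2.trans_le hs⟩
    rwa [truncate_of_norm_le hn.le] at this
  -- Before the first time at which the norm reaches R the curve solves the original equation, so
  -- its norm is at most B; by continuity it is at most B < R at that time too.
  have hall : ∀ t ∈ Icc t₁ T, ‖y t‖ < R := by
    by_contra! hne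
    have hcl : IsCompact (Icc t₁ T ∩ {t | R ≤ ‖y t‖}) := by
      refine isCompact_Icc.of_isClosed_subset ?_ inter_subset_left
      have hc : ContinuousOn (fun t => ‖y t‖) (Icc t₁ T) :=
        (hcont.mono (Icc_subset_Icc_left (by linarith))).norm
      exact hc.preimage_isClosed_of_isClosed isClosed_Icc isClosed_Ici
    obtain ⟨t₀, ht₀, hRt₀⟩ := hne
    obtain ⟨τ, ⟨hτI, hτ⟩, hleast⟩ := hcl.exists_isLeast ⟨t₀, ht₀, hRt₀⟩
    have hτ' : R ≤ ‖y τ‖ := hτ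
    have hτ₁ : t₁ < τ := by
      rcases hτI.1.lt_or_eq with h | h
      · exact h
      · rw [← h, hy₀] at hτ'; exact absurd hτ' (not_le.2 hyR)
    have hbefore : ∀ t ∈ Ico t₁ τ, ‖y t‖ < R := fun t ht => by
      by_contra! h
      exact absurd (hleast ⟨⟨ht.1, ht.2.le.trans hτI.2⟩, h⟩) (not_le.2 ht.2)
    have hbd := hB ε hε τ ⟨hτ₁, hτI.2⟩ y hy₀ (hode τ hτI.2 hbefore)
    have hlim : ‖y τ‖ ≤ B := by
      have hc : ContinuousWithinAt (fun t => ‖y t‖) (Ico t₁ τ) τ :=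
        ((hcont τ ⟨by linarith, hτI.2⟩).norm).mono
          fun t ht => ⟨by linarith [ht.1], ht.2.le.trans hτI.2⟩
      have hne : (𝓝[Ico t₁ τ] τ).NeBot := by
        rw [← mem_closure_iff_nhdsWithin_neBot, closure_Ico hτ₁.ne]
        exact right_mem_Icc.2 hτ₁.le
      exact le_of_tendsto hc (eventually_nhdsWithin_of_forall hbd)
    linarith
  exact ⟨ε, hε, y, hy₀, hode T le_rfl fun t ht => hall t (Ico_subset_Icc_self ht)⟩

/-- Forward uniqueness for an autonomous differential equation. -/
theorem solution_unique_forward {F : (ι → ℝ) → ι → ℝ} (hF : ContDiff ℝ 1 F)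
    {y z : ℝ → ι → ℝ} {t₁ T : ℝ}
    (hy : ∀ t ∈ Icc t₁ T, HasDerivAt y (F (y t)) t)
    (hz : ∀ t ∈ Icc t₁ T, HasDerivAt z (F (z t)) t) (h₁ : y t₁ = z t₁) :
    EqOn y z (Icc t₁ T) := by
  have hcy : ContinuousOn y (Icc t₁ T) := fun t ht => (hy t ht).continuousAt.continuousWithinAt
  have hcz : ContinuousOn z (Icc t₁ T) := fun t ht => (hz t ht).continuousAt.continuousWithinAt
  obtain ⟨By, hBy⟩ := isCompact_Icc.exists_bound_of_continuousOn hcy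
  obtain ⟨Bz, hBz⟩ := isCompact_Icc.exists_bound_of_continuousOn hcz
  obtain ⟨K, hK⟩ := exists_lipschitzOnWith_closedBall hF (max By Bz)
  refine ODE_solution_unique_of_mem_Icc_right (v := fun _ => F)
    (s := fun _ => Metric.closedBall 0 (max By Bz)) (fun _ _ => hK) hcy
    (fun t ht => (hy t (Ico_subset_Icc_self ht)).hasDerivWithinAt) (fun t ht => ?_) hcz
    (fun t ht => (hz t (Ico_subset_Icc_self ht)).hasDerivWithinAt) (fun t ht => ?_) h₁
  · simpa using Or.inl (hBy t (Ico_subset_Icc_self ht))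
  · simpa using Or.inr (hBz t (Ico_subset_Icc_self ht))

end GlobalExistence

end JFormCosmology

namespace JFormCosmology

/-! ### Triples of matrices with a scalar as vectors -/

/-- Three `3 × 3` matrices and a scalar, as a vector. -/
abbrev TripleSpace := Option (Fin 3 × Fin 3 × Fin 3) → ℝ

namespace TripleSpace

/-- The vector with the given matrices and scalar. -/
def pack (A : Fin 3 → Matrix (Fin 3) (Fin 3) ℝ) (r : ℝ) : TripleSpace :=
  fun o => o.elim r fun p => A p.1 p.2.1 p.2.2

/-- The matrices of a vector. -/
def block (y : TripleSpace) (m : Fin 3) : Matrix (Fin 3) (Fin 3) ℝ :=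
  Matrix.of fun i j => y (some (m, i, j))

/-- The scalar of a vector. -/
def scalar (y : TripleSpace) : ℝ := y none

lemma hasDerivAt_iff {y : ℝ → TripleSpace} {A : Fin 3 → Matrix (Fin 3) (Fin 3) ℝ} {r t : ℝ} :
    HasDerivAt y (pack A r) t ↔ (∀ m, HasMatDerivAt (fun s => block (y s) m) (A m) t) ∧
      HasDerivAt (fun s => scalar (y s)) r t := by
  rw [hasDerivAt_pi]
  constructor
  · exact fun h => ⟨fun m i j => h (some (m, i, j)), h none⟩
  · rintro ⟨h₁, h₂⟩ (_ | ⟨m, i, j⟩)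
    · exact h₂
    · exact h₁ m i j

lemma norm_le_iff {y : TripleSpace} {B : ℝ} (hB : 0 ≤ B) :
    ‖y‖ ≤ B ↔ (∀ m i j, |block y m i j| ≤ B) ∧ |scalar y| ≤ B := by
  rw [pi_norm_le_iff_of_nonneg hB]
  constructor
  · exact fun h => ⟨fun m i j => h (some (m, i, j)), h none⟩
  · rintro ⟨h₁, h₂⟩ (_ | ⟨m, i, j⟩)
    · exact h₂
    · exact h₁ m i j

lemma contDiff_block {n : ℕ∞ω} (m i j : Fin 3) : ContDiff ℝ n fun y => block y m i j :=
  contDiff_apply ℝ ℝ (some (m, i, j))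

lemma contDiff_scalar {n : ℕ∞ω} : ContDiff ℝ n scalar := contDiff_apply ℝ ℝ none

lemma contDiff_pack {n : ℕ∞ω} {A : TripleSpace → Fin 3 → Matrix (Fin 3) (Fin 3) ℝ}
    {r : TripleSpace → ℝ} (hA : ∀ m i j, ContDiff ℝ n fun y => A y m i j) (hr : ContDiff ℝ n r) :
    ContDiff ℝ n fun y => pack (A y) (r y) := by
  rw [contDiff_pi]
  rintro (_ | ⟨m, i, j⟩)
  · exact hr
  · exact hA m i j

end TripleSpace

lemma contDiff_matrix_mul {X : Type*} [NormedAddCommGroup X] [NormedSpace ℝ X] {n : ℕ∞ω}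
    {A B : X → Matrix (Fin 3) (Fin 3) ℝ} (hA : ∀ i j, ContDiff ℝ n fun y => A y i j)
    (hB : ∀ i j, ContDiff ℝ n fun y => B y i j) (i j : Fin 3) :
    ContDiff ℝ n fun y => (A y * B y) i j := by
  simp only [Matrix.mul_apply]
  exact ContDiff.sum fun k _ => (hA i k).mul (hB k j)

lemma contDiff_matrix_trace {X : Type*} [NormedAddCommGroup X] [NormedSpace ℝ X] {n : ℕ∞ω}
    {A : X → Matrix (Fin 3) (Fin 3) ℝ} (hA : ∀ i j, ContDiff ℝ n fun y => A y i j) :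
    ContDiff ℝ n fun y => (A y).trace := by
  simp only [Matrix.trace, Matrix.diag_apply]
  exact ContDiff.sum fun k _ => hA k k

/-- A solution of a twice continuously differentiable autonomous equation is of class `C²`. -/
lemma contDiffOn_two_of_ode {X : Type*} [NormedAddCommGroup X] [NormedSpace ℝ X] {F : X → X}
    (hF : ContDiff ℝ 1 F) {y : ℝ → X} {I : Set ℝ} (hI : IsOpen I)
    (hy : ∀ t ∈ I, HasDerivAt y (F (y t)) t) : ContDiffOn ℝ 2 y I := by
  have hdiff : DifferentiableOn ℝ y I :=
    fun t ht => (hy t ht).differentiableAt.differentiableWithinAt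
  have hstep : ∀ n : ℕ, n ≤ 1 → ContDiffOn ℝ n y I → ContDiffOn ℝ (n + 1 : ℕ) y I := by
    intro n hn h
    push_cast
    rw [contDiffOn_succ_iff_deriv_of_isOpen hI]
    refine ⟨hdiff, by simp, ?_⟩
    have hFn : ContDiff ℝ n F := hF.of_le (by exact_mod_cast hn)
    exact (hFn.comp_contDiffOn h).congr fun t ht => (hy t ht).deriv
  have h0 : ContDiffOn ℝ (0 : ℕ) y I := by
    rw [Nat.cast_zero, contDiffOn_zero]
    exact hdiff.continuousOn
  exact_mod_cast hstep 1 le_rfl (hstep 0 (by norm_num) h0)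

/-! ### The field equations in a Fermi-propagated frame -/

section Fermi

open TripleSpace

/-- The right-hand side of the field equations for a Fermi-propagated frame `E`, its dual frame
`f`, the frame components `k` of the expansion tensor, and the density. -/
noncomputable def fermiField (γ : ℝ) (v : Fin 3 → ℝ) (y : TripleSpace) : TripleSpace :=
  pack ![-(block y 0 * block y 2), block y 2 * block y 1,
      -((block y 2).trace • block y 2)
        + (block y 0)ᵀ * vecMulVec v v * block y 0 + ((2 - γ) / 2 * scalar y) • 1]
    (-(γ * (block y 2).trace * scalar y))

lemma contDiff_fermiField (γ : ℝ) (v : Fin 3 → ℝ) {n : ℕ∞ω} : ContDiff ℝ n (fermiField γ v) := by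
  have ht : ContDiff ℝ n fun y : TripleSpace => (block y 2).trace :=
    contDiff_matrix_trace (contDiff_block 2)
  refine contDiff_pack (fun m i j => ?_) ((contDiff_const.mul ht).mul contDiff_scalar).neg
  fin_cases m
  · exact (contDiff_matrix_mul (contDiff_block 0) (contDiff_block 2) i j).neg
  · exact contDiff_matrix_mul (contDiff_block 2) (contDiff_block 1) i j
  · have h0 : ∀ i j, ContDiff ℝ n fun y : TripleSpace => ((block y 0)ᵀ * vecMulVec v v) i j :=
      contDiff_matrix_mul (A := fun y => (block y 0)ᵀ) (B := fun _ => vecMulVec v v)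
        (fun a b => contDiff_block 0 b a) fun a b => contDiff_const
    have h1 : ContDiff ℝ n fun y : TripleSpace => ((block y 0)ᵀ * vecMulVec v v * block y 0) i j :=
      contDiff_matrix_mul h0 (contDiff_block 0) i j
    have h2 : ContDiff ℝ n fun y : TripleSpace =>
        -((block y 2).trace * block y 2 i j) := (ht.mul (contDiff_block 2 i j)).neg
    have h3 : ContDiff ℝ n fun y : TripleSpace =>
        (2 - γ) / 2 * scalar y * (1 : Matrix (Fin 3) (Fin 3) ℝ) i j :=
      (contDiff_const.mul contDiff_scalar).mul contDiff_const
    exact (h2.add h1).add h3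

/-- The field equations for a Fermi-propagated frame. -/
structure FermiFlow (γ : ℝ) (v : Fin 3 → ℝ) (I : Set ℝ) (E f k : ℝ → Matrix (Fin 3) (Fin 3) ℝ)
    (ρ : ℝ → ℝ) : Prop where
  frame : ∀ t ∈ I, HasMatDerivAt E (-(E t * k t)) t
  coframe : ∀ t ∈ I, HasMatDerivAt f (k t * f t) t
  expansion : ∀ t ∈ I, HasMatDerivAt k (-((k t).trace • k t) + (E t)ᵀ * vecMulVec v v * E t
    + ((2 - γ) / 2 * ρ t) • 1) t
  density : ∀ t ∈ I, HasDerivAt ρ (-(γ * (k t).trace * ρ t)) t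

lemma fermiFlow_of_ode {γ : ℝ} {v : Fin 3 → ℝ} {I : Set ℝ} {y : ℝ → TripleSpace}
    (hy : ∀ t ∈ I, HasDerivAt y (fermiField γ v (y t)) t) :
    FermiFlow γ v I (fun t => block (y t) 0) (fun t => block (y t) 1) (fun t => block (y t) 2)
      (fun t => scalar (y t)) where
  frame t ht := (hasDerivAt_iff.1 (hy t ht)).1 0
  coframe t ht := (hasDerivAt_iff.1 (hy t ht)).1 1
  expansion t ht := (hasDerivAt_iff.1 (hy t ht)).1 2
  density t ht := (hasDerivAt_iff.1 (hy t ht)).2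

/-- The constraints on the data of a Fermi-propagated frame. -/
structure FermiData (v : Fin 3 → ℝ) (E f k : Matrix (Fin 3) (Fin 3) ℝ) (ρ : ℝ) : Prop where
  dual : E * f = 1
  symm : kᵀ = k
  trace_pos : 0 < k.trace
  density_pos : 0 < ρ
  hamiltonian : k.trace ^ 2 - (k * k).trace = 2 * ρ + (Eᵀ * vecMulVec v v * E).trace

end Fermi

end JFormCosmology

/-! ### Constraint propagation and a priori bounds in a Fermi-propagated frame. -/

namespace JFormCosmology

lemma HasMatDerivAt.transpose {m n : Type*} {A : ℝ → Matrix m n ℝ} {A' : Matrix m n ℝ} {t : ℝ}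
    (hA : HasMatDerivAt A A' t) : HasMatDerivAt (fun s => (A s)ᵀ) A'ᵀ t := fun i j => hA j i

lemma hasMatDerivAt_const {m n : Type*} (A : Matrix m n ℝ) (t : ℝ) :
    HasMatDerivAt (fun _ => A) 0 t := fun i j => hasDerivAt_const t (A i j)

lemma trace_transpose_mul_vecMulVec_mul_nonneg (v : Fin 3 → ℝ) (E : Matrix (Fin 3) (Fin 3) ℝ) :
    0 ≤ (Eᵀ * vecMulVec v v * E).trace := by
  rw [Matrix.mul_vecMulVec, Matrix.vecMulVec_mul, Matrix.trace_vecMulVec, Matrix.mulVec_transpose]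
  exact Finset.sum_nonneg fun i _ => mul_self_nonneg _

lemma eq_of_hasDerivAt_zero {I : Set ℝ} (hI : IsOpen I) (hc : I.OrdConnected) {y : ℝ → ℝ}
    (hy : ∀ t ∈ I, HasDerivAt y 0 t) {t₁ t : ℝ} (ht₁ : t₁ ∈ I) (ht : t ∈ I) : y t = y t₁ :=
  hI.is_const_of_deriv_eq_zero hc.isPreconnected
    (fun u hu => (hy u hu).differentiableAt.differentiableWithinAt)
    (fun u hu => (hy u hu).deriv) ht ht₁

namespace FermiFlow

variable {γ : ℝ} {v : Fin 3 → ℝ} {I : Set ℝ} {E f k : ℝ → Matrix (Fin 3) (Fin 3) ℝ} {ρ : ℝ → ℝ}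
  {t t₁ : ℝ}

lemma hasDerivAt_trace (hF : FermiFlow γ v I E f k ρ) (ht : t ∈ I) :
    HasDerivAt (fun s => (k s).trace) (-(k t).trace ^ 2 + ((E t)ᵀ * vecMulVec v v * E t).trace
      + 3 * ((2 - γ) / 2 * ρ t)) t := by
  refine (hF.expansion t ht).trace.congr_deriv ?_
  simp only [Matrix.trace_add, Matrix.trace_neg, Matrix.trace_smul, Matrix.trace_one, smul_eq_mul,
    Fintype.card_fin]
  push_cast
  ring

lemma hasDerivAt_trace_sq (hF : FermiFlow γ v I E f k ρ) (ht : t ∈ I) :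
    HasDerivAt (fun s => (k s * k s).trace) (-2 * (k t).trace * (k t * k t).trace
      + 2 * ((E t)ᵀ * vecMulVec v v * E t * k t).trace + (2 - γ) * ρ t * (k t).trace) t := by
  refine ((hF.expansion t ht).mul (hF.expansion t ht)).trace.congr_deriv ?_
  simp only [Matrix.add_mul, Matrix.mul_add, Matrix.neg_mul, Matrix.mul_neg, Matrix.smul_mul,
    Matrix.mul_smul, Matrix.one_mul, Matrix.mul_one, Matrix.trace_add, Matrix.trace_neg,
    Matrix.trace_smul, smul_eq_mul, Matrix.trace_mul_comm (k t) ((E t)ᵀ * vecMulVec v v * E t)]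
  ring

lemma hasDerivAt_trace_form (hF : FermiFlow γ v I E f k ρ) (ht : t ∈ I) (hk : (k t)ᵀ = k t) :
    HasDerivAt (fun s => ((E s)ᵀ * vecMulVec v v * E s).trace)
      (-2 * ((E t)ᵀ * vecMulVec v v * E t * k t).trace) t := by
  refine ((((hF.frame t ht).transpose.mul (hasMatDerivAt_const (vecMulVec v v) t)).mul
    (hF.frame t ht)).trace).congr_deriv ?_
  simp only [Matrix.transpose_neg, Matrix.transpose_mul, hk, Matrix.mul_zero, add_zero,
    Matrix.neg_mul, Matrix.mul_neg, Matrix.trace_add, Matrix.trace_neg]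
  have h1 : (k t * (E t)ᵀ * vecMulVec v v * E t).trace =
      ((E t)ᵀ * vecMulVec v v * E t * k t).trace := by
    rw [Matrix.mul_assoc, Matrix.mul_assoc, Matrix.trace_mul_comm]
    simp only [Matrix.mul_assoc]
  rw [h1]
  simp only [Matrix.mul_assoc]
  ring

lemma continuousOn_trace (hF : FermiFlow γ v I E f k ρ) : ContinuousOn (fun s => (k s).trace) I :=
  fun _ ht => (hF.hasDerivAt_trace ht).continuousAt.continuousWithinAt

/-- The constraints propagate. -/
theorem fermiData (hF : FermiFlow γ v I E f k ρ) (hI : IsOpen I) (hc : I.OrdConnected)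
    (ht₁ : t₁ ∈ I) (hD : FermiData v (E t₁) (f t₁) (k t₁) (ρ t₁)) (ht : t ∈ I) :
    FermiData v (E t) (f t) (k t) (ρ t) := by
  have hT := hF.continuousOn_trace
  -- The sources are symmetric, so the antisymmetric part of k solves y' = -(tr k) y with initial
  -- value zero.
  have hsymm : ∀ t ∈ I, (k t)ᵀ = k t := by
    intro t ht
    ext i j
    have hW : ∀ s, ((E s)ᵀ * vecMulVec v v * E s) j i = ((E s)ᵀ * vecMulVec v v * E s) i j := by
      intro s
      rw [Matrix.mul_vecMulVec, Matrix.vecMulVec_mul, Matrix.mulVec_transpose]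
      simp only [Matrix.vecMulVec_apply]
      ring
    have h := linear_ode_eq_exp hI hc (y := fun s => k s j i - k s i j)
      (g := fun s => -(k s).trace) hT.neg (fun s hs => by
        refine ((hF.expansion s hs j i).sub (hF.expansion s hs i j)).congr_deriv ?_
        simp only [Matrix.add_apply, Matrix.neg_apply, Matrix.smul_apply, smul_eq_mul, hW s,
          Matrix.one_apply, @eq_comm _ j i]
        ring) ht₁ t ht
    have h1 : k t₁ j i - k t₁ i j = 0 := by
      rw [sub_eq_zero]; exact congrFun (congrFun hD.symm i) j
    simp only [h1, zero_mul] at h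
    exact sub_eq_zero.1 h
  have hρ : ∀ t ∈ I, 0 < ρ t := by
    intro t ht
    have h := linear_ode_eq_exp hI hc (y := ρ) (g := fun s => -(γ * (k s).trace))
      ((continuousOn_const.mul hT).neg) (fun s hs => (hF.density s hs).congr_deriv (by ring))
      ht₁ t ht
    rw [h]
    exact mul_pos hD.density_pos (Real.exp_pos _)
  -- The defect of the constraint solves y' = -2(tr k) y with initial value zero.
  have hham : ∀ t ∈ I, (k t).trace ^ 2 - (k t * k t).trace =
      2 * ρ t + ((E t)ᵀ * vecMulVec v v * E t).trace := by
    intro t ht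
    have h := linear_ode_eq_exp hI hc
      (y := fun s => (k s).trace ^ 2 - (k s * k s).trace
        - (2 * ρ s + ((E s)ᵀ * vecMulVec v v * E s).trace))
      (g := fun s => -(2 * (k s).trace)) ((continuousOn_const.mul hT).neg) (fun s hs => by
        refine ((((hF.hasDerivAt_trace hs).pow 2).sub (hF.hasDerivAt_trace_sq hs)).sub
          (((hF.density s hs).const_mul 2).add
            (hF.hasDerivAt_trace_form hs (hsymm s hs)))).congr_deriv ?_
        push_cast
        ring) ht₁ t ht
    simp only [hD.hamiltonian, sub_self, zero_mul] at h
    exact sub_eq_zero.1 h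
  refine ⟨?_, hsymm t ht, ?_, hρ t ht, hham t ht⟩
  · rw [← hD.dual]
    ext i j
    refine eq_of_hasDerivAt_zero hI hc (y := fun s => (E s * f s) i j) (fun s hs => ?_) ht₁ ht
    have h := ((hF.frame s hs).mul (hF.coframe s hs)).congr_deriv (B' := 0) (by
      rw [Matrix.neg_mul, Matrix.mul_assoc, neg_add_cancel])
    exact h i j
  · have hne : ∀ s ∈ I, (k s).trace ≠ 0 := by
      intro s hs h0
      have h1 := hham s hs
      have h2 := trace_mul_self_nonneg (hsymm s hs)
      have h3 := trace_transpose_mul_vecMulVec_mul_nonneg v (E s)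
      have h4 := hρ s hs
      rw [h0] at h1
      linarith
    by_contra! hneg
    obtain ⟨s, hs, h0⟩ := hc.isPreconnected.intermediate_value₂ ht ht₁ hT
      (continuousOn_const (c := (0 : ℝ))) hneg hD.trace_pos.le
    exact hne s hs h0

end FermiFlow

namespace FermiData

variable {v : Fin 3 → ℝ} {E f k : Matrix (Fin 3) (Fin 3) ℝ} {ρ : ℝ}

lemma trace_sq_le (hD : FermiData v E f k ρ) : (k * k).trace ≤ k.trace ^ 2 := by
  linarith [hD.hamiltonian, hD.density_pos, trace_transpose_mul_vecMulVec_mul_nonneg v E]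

/-- For symmetric k the trace of k² is the sum of the squares of the entries, and the Hamiltonian
constraint bounds it by (tr k)². -/
lemma abs_expansion_le (hD : FermiData v E f k ρ) (i j : Fin 3) : |k i j| ≤ k.trace := by
  refine abs_le_of_sq_le_sq ?_ hD.trace_pos.le
  refine le_trans ?_ hD.trace_sq_le
  rw [← sum_sum_eq_trace_mul hD.symm]
  have h1 : k i j * k i j ≤ ∑ b, k i b * k i b :=
    Finset.single_le_sum (f := fun b => k i b * k i b) (fun b _ => mul_self_nonneg _)
      (Finset.mem_univ j)
  have h2 : ∑ b, k i b * k i b ≤ ∑ a, ∑ b, k a b * k a b :=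
    Finset.single_le_sum (f := fun a => ∑ b, k a b * k a b)
      (fun a _ => Finset.sum_nonneg fun b _ => mul_self_nonneg _) (Finset.mem_univ i)
  rw [sq]
  exact h1.trans h2

lemma density_le (hD : FermiData v E f k ρ) : ρ ≤ k.trace ^ 2 := by
  have := trace_mul_self_nonneg hD.symm
  linarith [hD.hamiltonian, hD.density_pos, trace_transpose_mul_vecMulVec_mul_nonneg v E]

lemma dual' (hD : FermiData v E f k ρ) : f * E = 1 := mul_eq_one_comm.1 hD.dual

end FermiData

/-- Exponential bound for the entries of a matrix curve. -/
lemma abs_apply_le_exp {A A' : ℝ → Matrix (Fin 3) (Fin 3) ℝ} {t₁ s M K : ℝ}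
    (hA : ∀ t ∈ Ico t₁ s, HasMatDerivAt A (A' t) t) (hM : ∀ i j, |A t₁ i j| ≤ M)
    (hK : ∀ t ∈ Ico t₁ s, ∀ N, (∀ i j, |A t i j| ≤ N) → ∀ i j, |A' t i j| ≤ K * N) :
    ∀ t ∈ Ico t₁ s, ∀ i j, |A t i j| ≤ M * Real.exp (K * (t - t₁)) := by
  intro t ht i j
  let z : ℝ → Fin 3 × Fin 3 → ℝ := fun τ p => A τ p.1 p.2
  let z' : ℝ → Fin 3 × Fin 3 → ℝ := fun τ p => A' τ p.1 p.2
  have hz : ∀ τ ∈ Ico t₁ s, HasDerivAt z (z' τ) τ := fun τ hτ =>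
    hasDerivAt_pi.2 fun p => hA τ hτ p.1 p.2
  have hsub : Icc t₁ t ⊆ Ico t₁ s := fun τ hτ => ⟨hτ.1, hτ.2.trans_lt ht.2⟩
  have hM0 : 0 ≤ M := (abs_nonneg _).trans (hM 0 0)
  have hle : ∀ τ, ∀ a b, |A τ a b| ≤ ‖z τ‖ := fun τ a b => norm_le_pi_norm (z τ) (a, b)
  have h := norm_le_gronwallBound_of_norm_deriv_right_le (f := z) (f' := z') (δ := M) (K := K)
    (ε := 0) (a := t₁) (b := t)
    (fun τ hτ => (hz τ (hsub hτ)).continuousAt.continuousWithinAt)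
    (fun τ hτ => (hz τ (hsub (Ico_subset_Icc_self hτ))).hasDerivWithinAt)
    ((pi_norm_le_iff_of_nonneg hM0).2 fun p => hM p.1 p.2)
    (fun τ hτ => by
      have hb := hK τ (hsub (Ico_subset_Icc_self hτ)) ‖z τ‖ (hle τ)
      rw [add_zero]
      exact (pi_norm_le_iff_of_nonneg ((abs_nonneg _).trans (hb 0 0))).2 fun p => hb p.1 p.2)
    t (right_mem_Icc.2 ht.1)
  rw [gronwallBound_ε0] at h
  exact (hle t i j).trans h

lemma abs_mul_apply_le {A B : Matrix (Fin 3) (Fin 3) ℝ} {M N : ℝ} (hA : ∀ i j, |A i j| ≤ M)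
    (hB : ∀ i j, |B i j| ≤ N) (i j : Fin 3) : |(A * B) i j| ≤ 3 * M * N := by
  rw [Matrix.mul_apply]
  refine (Finset.abs_sum_le_sum_abs _ _).trans ?_
  have hM : 0 ≤ M := (abs_nonneg _).trans (hA 0 0)
  refine (Finset.sum_le_sum (g := fun _ => M * N) fun a _ => ?_).trans (by simp; linarith)
  rw [abs_mul]
  exact mul_le_mul (hA i a) (hB a j) (abs_nonneg _) hM

end JFormCosmology

namespace JFormCosmology

open TripleSpace

namespace FermiFlow

variable {γ : ℝ} {v : Fin 3 → ℝ} {I : Set ℝ} {E f k : ℝ → Matrix (Fin 3) (Fin 3) ℝ} {ρ : ℝ → ℝ}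
  {t t₁ : ℝ}

/-- The volume expansion decreases. -/
lemma trace_le (hF : FermiFlow γ v I E f k ρ) (hγ : 2 / 3 ≤ γ) (hI : IsOpen I)
    (hc : I.OrdConnected) (ht₁ : t₁ ∈ I) (hD : FermiData v (E t₁) (f t₁) (k t₁) (ρ t₁))
    (ht : t ∈ I) (hle : t₁ ≤ t) : (k t).trace ≤ (k t₁).trace := by
  refine antitoneOn_of_deriv_nonpos hc.convex hF.continuousOn_trace
    (fun s hs => (hF.hasDerivAt_trace (interior_subset hs)).differentiableAt.differentiableWithinAt)
    (fun s hs => ?_) ht₁ ht hle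
  have hs' := interior_subset hs
  rw [(hF.hasDerivAt_trace hs').deriv]
  have hDs := hF.fermiData hI hc ht₁ hD hs'
  have h1 := trace_mul_self_nonneg hDs.symm
  -- Inserting the constraint, the derivative is -tr k² + (1 - 3γ/2)ρ, where the second term is
  -- nonpositive for γ ≥ 2/3.
  nlinarith [hDs.hamiltonian, hDs.density_pos]

end FermiFlow

/-- The field equations for a Fermi-propagated frame have solutions up to any later time. -/
theorem exists_fermi_solution {γ : ℝ} (hγ : 2 / 3 ≤ γ) {v : Fin 3 → ℝ} {y₀ : TripleSpace}
    (hD : FermiData v (block y₀ 0) (block y₀ 1) (block y₀ 2) (scalar y₀)) {t₁ T : ℝ}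
    (hT : t₁ < T) :
    ∃ ε > 0, ∃ y : ℝ → TripleSpace, y t₁ = y₀ ∧
      ∀ t ∈ Ioo (t₁ - ε) T, HasDerivAt y (fermiField γ v (y t)) t := by
  set H : ℝ := (block y₀ 2).trace with hH
  have hHpos : 0 < H := hD.trace_pos
  refine exists_solution_of_apriori_bound (contDiff_fermiField γ v) y₀
    -- The three terms bound the frame with its coframe, the expansion, and the density. The rate 3H
    -- comes from |(E k)_ij| ≤ 3 max|E| max|k| for 3 × 3 matrices, inserted in Grönwall's
    -- inequality.
    (B := ‖y₀‖ * Real.exp (3 * H * (T - t₁)) + H + H ^ 2) hT ?_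
  rintro ε hε s hs y rfl hy t ht
  have hF := fermiFlow_of_ode hy
  have ht₁ : t₁ ∈ Ioo (t₁ - ε) s := ⟨by linarith, hs.1⟩
  have hmem : ∀ {τ}, τ ∈ Ico t₁ s → τ ∈ Ioo (t₁ - ε) s := fun h => ⟨by linarith [h.1], h.2⟩
  have hDt : ∀ τ ∈ Ico t₁ s, FermiData v (block (y τ) 0) (block (y τ) 1) (block (y τ) 2)
      (scalar (y τ)) := fun τ hτ =>
    hF.fermiData isOpen_Ioo ordConnected_Ioo ht₁ hD (hmem hτ)
  have hHt : ∀ τ ∈ Ico t₁ s, (block (y τ) 2).trace ≤ H := fun τ hτ =>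
    hF.trace_le hγ isOpen_Ioo ordConnected_Ioo ht₁ hD (hmem hτ) hτ.1
  have hk : ∀ τ ∈ Ico t₁ s, ∀ i j, |block (y τ) 2 i j| ≤ H := fun τ hτ i j =>
    ((hDt τ hτ).abs_expansion_le i j).trans (hHt τ hτ)
  have h₀ := (norm_le_iff (norm_nonneg (y t₁))).1 le_rfl
  have hexp : ‖y t₁‖ * Real.exp (3 * H * (t - t₁)) ≤ ‖y t₁‖ * Real.exp (3 * H * (T - t₁)) := by
    have h1 : t ≤ T := ht.2.le.trans hs.2
    gcongr
  have hpos : 0 ≤ ‖y t₁‖ * Real.exp (3 * H * (T - t₁)) := by positivity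
  have hE : ∀ i j, |block (y t) 0 i j| ≤ ‖y t₁‖ * Real.exp (3 * H * (t - t₁)) :=
    abs_apply_le_exp (A := fun τ => block (y τ) 0) (fun τ hτ => hF.frame τ (hmem hτ)) (h₀.1 0)
      (fun τ hτ N hN i j => by
        rw [Matrix.neg_apply, abs_neg]
        exact (abs_mul_apply_le hN (hk τ hτ) i j).trans (by linarith)) t ht
  have hf : ∀ i j, |block (y t) 1 i j| ≤ ‖y t₁‖ * Real.exp (3 * H * (t - t₁)) :=
    abs_apply_le_exp (A := fun τ => block (y τ) 1) (fun τ hτ => hF.coframe τ (hmem hτ)) (h₀.1 1)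
      (fun τ hτ N hN i j => abs_mul_apply_le (hk τ hτ) hN i j) t ht
  have hH2 : 0 ≤ H ^ 2 := sq_nonneg H
  rw [TripleSpace.norm_le_iff (by linarith)]
  refine ⟨fun m i j => ?_, ?_⟩
  · fin_cases m
    · exact (hE i j).trans (by linarith)
    · exact (hf i j).trans (by linarith)
    · exact (hk t ht i j).trans (by linarith)
  · have h1 := (hDt t ht).density_le
    have h2 : (block (y t) 2).trace ^ 2 ≤ H ^ 2 :=
      pow_le_pow_left₀ (hDt t ht).trace_pos.le (hHt t ht) 2
    rw [abs_of_pos (hDt t ht).density_pos]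
    linarith

/-! ### From Fermi-propagated frames to type I solutions. -/

section Evolution

variable {γ : ℝ} {v : Fin 3 → ℝ} {I : Set ℝ} {y : ℝ → TripleSpace} {t t₁ : ℝ}

/-- The spatial metric with coframe `f`. -/
def coframeMetric (f : ℝ → Matrix (Fin 3) (Fin 3) ℝ) : SpatialMetric := fun t => (f t)ᵀ * f t

lemma hasMatDerivAt_coframeMetric {f k : ℝ → Matrix (Fin 3) (Fin 3) ℝ} (hk : (k t)ᵀ = k t)
    (hf : HasMatDerivAt f (k t * f t) t) :
    HasMatDerivAt (coframeMetric f) ((2 : ℝ) • ((f t)ᵀ * k t * f t)) t := by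
  refine (hf.transpose.mul hf).congr_deriv ?_
  rw [Matrix.transpose_mul, hk, two_smul, Matrix.mul_assoc]

lemma expansion_eq_of_hasMatDerivAt {h : SpatialMetric} {A : Matrix (Fin 3) (Fin 3) ℝ}
    (hh : HasMatDerivAt h ((2 : ℝ) • A) t) : expansion h t = A := by
  ext i j
  simp only [expansion, metricDot, Matrix.smul_apply, Matrix.of_apply, (hh i j).deriv, smul_eq_mul]
  ring

/-- A solution in a Fermi-propagated frame gives a type I solution. -/
theorem evolutionAt_of_fermi (hI : IsOpen I) (hc : I.OrdConnected)
    (hy : ∀ t ∈ I, HasDerivAt y (fermiField γ v (y t)) t) (ht₁ : t₁ ∈ I)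
    (hD : FermiData v (block (y t₁) 0) (block (y t₁) 1) (block (y t₁) 2) (scalar (y t₁)))
    (ht : t ∈ I) :
    EvolutionAt γ (coframeMetric fun s => block (y s) 1) (fun _ => Fin.cons 0 v)
      (fun s => scalar (y s)) t := by
  have hF := fermiFlow_of_ode hy
  have hDt := fun s (hs : s ∈ I) => hF.fermiData hI hc ht₁ hD hs
  have hC2 : ContDiffAt ℝ 2 y t :=
    (contDiffOn_two_of_ode (contDiff_fermiField γ v) hI hy).contDiffAt (hI.mem_nhds ht)
  have hfC : ∀ i j, ContDiffAt ℝ 2 (fun s => block (y s) 1 i j) t := fun i j =>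
    (contDiff_block 1 i j).contDiffAt.comp t hC2
  have hexp : ∀ s ∈ I, expansion (coframeMetric fun s => block (y s) 1) s =
      (block (y s) 1)ᵀ * block (y s) 2 * block (y s) 1 := fun s hs =>
    expansion_eq_of_hasMatDerivAt (hasMatDerivAt_coframeMetric (f := fun s => block (y s) 1)
      (k := fun s => block (y s) 2) (hDt s hs).symm (hF.coframe s hs))
  set E := block (y t) 0 with hE
  set f := block (y t) 1 with hf
  set k := block (y t) 2 with hk
  have hd : FermiData v E f k (scalar (y t)) := hDt t ht
  have hEf := hd.dual
  have hfE := hd.dual'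
  have hEf' : fᵀ * Eᵀ = 1 := by rw [← Matrix.transpose_mul, hEf, Matrix.transpose_one]
  have hfE' : Eᵀ * fᵀ = 1 := by rw [← Matrix.transpose_mul, hfE, Matrix.transpose_one]
  have hinv : (coframeMetric (fun s => block (y s) 1) t)⁻¹ = E * Eᵀ := by
    refine Matrix.inv_eq_right_inv ?_
    change fᵀ * f * (E * Eᵀ) = 1
    rw [Matrix.mul_assoc, ← Matrix.mul_assoc f, hfE, Matrix.one_mul, hEf']
  have hmix : mixedExpansion (coframeMetric fun s => block (y s) 1) t = E * k * f := by
    rw [mixedExpansion, hinv, hexp t ht]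
    change E * Eᵀ * (fᵀ * k * f) = _
    rw [Matrix.mul_assoc, ← Matrix.mul_assoc Eᵀ, ← Matrix.mul_assoc Eᵀ, hfE', Matrix.one_mul,
      ← Matrix.mul_assoc]
  have htr : (mixedExpansion (coframeMetric fun s => block (y s) 1) t).trace = k.trace := by
    rw [hmix, Matrix.trace_mul_comm, ← Matrix.mul_assoc, hfE, Matrix.one_mul]
  have hsp : spatialPart (Fin.cons 0 v : Fin 4 → ℝ) = v := by ext i; simp [spatialPart]
  have hWE : fᵀ * (Eᵀ * vecMulVec v v * E) * f = vecMulVec v v := by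
    rw [Matrix.mul_assoc Eᵀ, ← Matrix.mul_assoc, hEf', Matrix.one_mul, Matrix.mul_assoc, hEf,
      Matrix.mul_one]
  constructor
  · refine (Matrix.PosDef.conjTranspose_mul_self f ?_ :)
    refine Function.LeftInverse.injective (g := E.mulVec) fun x => ?_
    rw [Matrix.mulVec_mulVec, hEf, Matrix.one_mulVec]
  · intro i j
    simp only [coframeMetric, Matrix.mul_apply, Matrix.transpose_apply]
    exact ContDiffAt.sum fun a _ => (hfC a i).mul (hfC a j)
  · exact fun μ => contDiffAt_const
  · exact (contDiff_scalar.contDiffAt.comp t hC2).of_le one_le_two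
  · exact hd.density_pos.le
  · rw [htr, hmix, hinv, hsp]
    have h1 : (E * k * f * (E * k * f)).trace = (k * k).trace := by
      rw [Matrix.mul_assoc (E * k), ← Matrix.mul_assoc f, ← Matrix.mul_assoc f, hfE,
        Matrix.one_mul, Matrix.mul_assoc, Matrix.trace_mul_comm, Matrix.mul_assoc, Matrix.mul_assoc,
        hfE, Matrix.mul_one]
    rw [h1, hd.hamiltonian]
    have h2 : (Eᵀ * vecMulVec v v * E).trace = v ⬝ᵥ ((E * Eᵀ) *ᵥ v) := by
      rw [Matrix.trace_mul_comm, ← Matrix.mul_assoc, trace_inv_mul_vecMulVec]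
    rw [h2]
    simp
  · intro i
    simp
  · rw [htr, hexp t ht, hmix, hsp]
    have hder := (((hF.coframe t ht).transpose.mul (hF.expansion t ht)).mul (hF.coframe t ht))
    have hev : expansion (coframeMetric fun s => block (y s) 1) =ᶠ[𝓝 t]
        fun s => (block (y s) 1)ᵀ * block (y s) 2 * block (y s) 1 := by
      filter_upwards [hI.mem_nhds ht] with s hs using hexp s hs
    have hder' : HasMatDerivAt (expansion (coframeMetric fun s => block (y s) 1)) _ t :=
      fun i j => (hder i j).congr_of_eventuallyEq (hev.mono fun s hs => by
        simp only [hs])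
    refine hder'.congr_deriv ?_
    change ((k * f)ᵀ * k + fᵀ * (-(k.trace • k) + Eᵀ * vecMulVec v v * E
      + ((2 - γ) / 2 * scalar (y t)) • 1)) * f + fᵀ * k * (k * f) =
      (2 : ℝ) • (fᵀ * k * f * (E * k * f)) - k.trace • (fᵀ * k * f) + vecMulVec v v
        + ((2 - γ) / 2 * scalar (y t)) • (fᵀ * f)
    have h3 : fᵀ * k * f * (E * k * f) = fᵀ * k * (k * f) := by
      rw [Matrix.mul_assoc (fᵀ * k), ← Matrix.mul_assoc f, ← Matrix.mul_assoc f, hfE, Matrix.one_mul]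
    rw [h3, Matrix.transpose_mul, hd.symm, Matrix.mul_add, Matrix.mul_add, Matrix.add_mul,
      Matrix.add_mul, Matrix.add_mul, hWE, Matrix.mul_neg, Matrix.mul_smul, Matrix.mul_smul,
      Matrix.mul_one, Matrix.neg_mul, Matrix.smul_mul, Matrix.smul_mul, two_smul]
    rw [Matrix.mul_assoc (fᵀ * k) k f]
    abel
  · intro i
    simpa using hasDerivAt_const t (v i)
  · simpa using hasDerivAt_const t (0 : ℝ)
  · rw [htr]
    exact hF.density t ht

end Evolution

end JFormCosmology

namespace JFormCosmology

open TripleSpace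

/-! ### Uniqueness and extension of type I solutions -/

/-- The right-hand side of the field equations for the metric, the expansion tensor, the inverse
metric and the density. -/
noncomputable def metricField (γ : ℝ) (v : Fin 3 → ℝ) (z : TripleSpace) : TripleSpace :=
  pack ![(2 : ℝ) • block z 1,
      (2 : ℝ) • (block z 1 * (block z 2 * block z 1))
        - (block z 2 * block z 1).trace • block z 1 + vecMulVec v v
        + ((2 - γ) / 2 * scalar z) • block z 0,
      -((2 : ℝ) • (block z 2 * block z 1 * block z 2))]
    (-(γ * (block z 2 * block z 1).trace * scalar z))

lemma contDiff_metricField (γ : ℝ) (v : Fin 3 → ℝ) {n : ℕ∞ω} :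
    ContDiff ℝ n (metricField γ v) := by
  have hm : ∀ i j, ContDiff ℝ n fun z : TripleSpace => (block z 2 * block z 1) i j :=
    contDiff_matrix_mul (contDiff_block 2) (contDiff_block 1)
  have ht : ContDiff ℝ n fun z : TripleSpace => (block z 2 * block z 1).trace :=
    contDiff_matrix_trace hm
  refine contDiff_pack (fun m i j => ?_) ((contDiff_const.mul ht).mul contDiff_scalar).neg
  fin_cases m
  · exact contDiff_const.mul (contDiff_block 1 i j)
  · have h1 : ContDiff ℝ n fun z : TripleSpace =>
        2 * (block z 1 * (block z 2 * block z 1)) i j :=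
      contDiff_const.mul (contDiff_matrix_mul (contDiff_block 1) hm i j)
    have h2 : ContDiff ℝ n fun z : TripleSpace =>
        (block z 2 * block z 1).trace * block z 1 i j := ht.mul (contDiff_block 1 i j)
    have h3 : ContDiff ℝ n fun z : TripleSpace =>
        (2 - γ) / 2 * scalar z * block z 0 i j :=
      (contDiff_const.mul contDiff_scalar).mul (contDiff_block 0 i j)
    exact ((h1.sub h2).add contDiff_const).add h3
  · exact (contDiff_const.mul (contDiff_matrix_mul hm (contDiff_block 2) i j)).neg

/-- Carrying the inverse metric as a further unknown makes the field polynomial, hence smooth on the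
whole space, as forward uniqueness requires. No frame enters, so any two solutions can be compared.
-/
lemma EvolutionAt.hasDerivAt_metricField {γ : ℝ} {v : Fin 3 → ℝ} {h : SpatialMetric}
    {ρ : ℝ → ℝ} {t : ℝ} (hE : EvolutionAt γ h (fun _ => Fin.cons 0 v) ρ t) :
    HasDerivAt (fun s => pack ![h s, expansion h s, (h s)⁻¹] (ρ s))
      (metricField γ v (pack ![h t, expansion h t, (h t)⁻¹] (ρ t))) t := by
  refine hasDerivAt_iff.2 ⟨fun m => ?_, hE.density⟩
  have hsp : spatialPart (Fin.cons 0 v : Fin 4 → ℝ) = v := by ext i; simp [spatialPart]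
  fin_cases m
  · exact hasMatDerivAt_metric hE.h_smooth
  · have := hE.evolution
    rw [hsp] at this
    exact this
  · exact hasMatDerivAt_inv_metric hE.posDef hE.h_smooth

theorem EvolutionAt.unique {γ : ℝ} {v : Fin 3 → ℝ} {h h' : SpatialMetric} {ρ ρ' : ℝ → ℝ}
    {t₁ T : ℝ} (hE : ∀ t ∈ Icc t₁ T, EvolutionAt γ h (fun _ => Fin.cons 0 v) ρ t)
    (hE' : ∀ t ∈ Icc t₁ T, EvolutionAt γ h' (fun _ => Fin.cons 0 v) ρ' t)
    (hh : h t₁ = h' t₁) (hθ : expansion h t₁ = expansion h' t₁) (hρ : ρ t₁ = ρ' t₁) :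
    ∀ t ∈ Icc t₁ T, h t = h' t ∧ ρ t = ρ' t := by
  intro t ht
  have h := solution_unique_forward (contDiff_metricField γ v)
    (fun s hs => (hE s hs).hasDerivAt_metricField) (fun s hs => (hE' s hs).hasDerivAt_metricField)
    (by rw [hh, hθ, hρ]) ht
  exact ⟨congrArg (fun z => block z 0) h, congrArg scalar h⟩

/-- Two solutions that agree initially agree. -/
lemma EvolutionAt.unique_of_eqOn {γ : ℝ} {v : Fin 3 → ℝ} {h h' : SpatialMetric} {ρ ρ' : ℝ → ℝ}
    {a b T : ℝ} (hab : a < b) (hE : ∀ t ∈ Ioo a T, EvolutionAt γ h (fun _ => Fin.cons 0 v) ρ t)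
    (hE' : ∀ t ∈ Ioo a T, EvolutionAt γ h' (fun _ => Fin.cons 0 v) ρ' t)
    (heq : ∀ t ∈ Ioo a b, h t = h' t ∧ ρ t = ρ' t) :
    ∀ t ∈ Ioo a T, h t = h' t ∧ ρ t = ρ' t := by
  intro t ht
  rcases lt_or_ge t b with htb | htb
  · exact heq t ⟨ht.1, htb⟩
  obtain ⟨t₁, ht₁⟩ := exists_between hab
  have hsub : Icc t₁ t ⊆ Ioo a T := fun s hs => ⟨ht₁.1.trans_le hs.1, hs.2.trans_lt ht.2⟩
  refine EvolutionAt.unique (fun s hs => hE s (hsub hs)) (fun s hs => hE' s (hsub hs))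
    (heq t₁ ht₁).1 (expansion_congr ?_) (heq t₁ ht₁).2 t ⟨by linarith [ht₁.2], le_rfl⟩
  filter_upwards [isOpen_Ioo.mem_nhds ht₁] with s hs using (heq s hs).1

/-- The data of an expanding solution in an orthonormal frame. -/
lemma fermiData_of_evolution {γ : ℝ} {v : Fin 3 → ℝ} {h : SpatialMetric} {ρ : ℝ → ℝ} {t : ℝ}
    (hE : EvolutionAt γ h (fun _ => Fin.cons 0 v) ρ t) (hp : ∀ᶠ s in 𝓝 t, (h s).PosDef)
    (hH : 0 < hubble h t) (hρ : 0 < ρ t) {F : Matrix (Fin 3) (Fin 3) ℝ}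
    (hF : IsOrthonormalFrame h t F) : FermiData v F F⁻¹ (frameExpansion h t F) (ρ t) where
  dual := Matrix.mul_nonsing_inv _ ((Matrix.isUnit_iff_isUnit_det _).1 hF.isUnit)
  symm := frameExpansion_transpose (expansion_transpose hp)
  trace_pos := by
    rw [← trace_mixed_frame hF, trace_mixedExpansion]
    linarith
  density_pos := hρ
  hamiltonian := by
    have hsp : spatialPart (Fin.cons 0 v : Fin 4 → ℝ) = v := by ext i; simp [spatialPart]
    rw [← trace_mixed_frame hF, ← trace_mixed_sq_frame hF, hE.hamiltonian, hF.inv_metric, hsp,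
      Matrix.trace_mul_comm, ← Matrix.mul_assoc, trace_inv_mul_vecMulVec]
    simp

/-- An expanding solution with a fluid extends to any later time. -/
theorem exists_extension_Ioo {γ : ℝ} (hγ : 2 / 3 ≤ γ) {v : Fin 3 → ℝ} {h : SpatialMetric}
    {ρ : ℝ → ℝ} {a b T : ℝ} (hab : a < b) (hbT : b < T)
    (hE : ∀ t ∈ Ioo a b, EvolutionAt γ h (fun _ => Fin.cons 0 v) ρ t)
    (hH : ∀ t ∈ Ioo a b, 0 < hubble h t) (hρ : ∀ t ∈ Ioo a b, 0 < ρ t) :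
    ∃ h' ρ', (∀ t ∈ Ioo a T, EvolutionAt γ h' (fun _ => Fin.cons 0 v) ρ' t) ∧
      ∀ t ∈ Ioo a b, h' t = h t ∧ ρ' t = ρ t := by
  obtain ⟨t₁, ht₁⟩ := exists_between hab
  obtain ⟨t₂, ht₂⟩ := exists_between ht₁.2
  obtain ⟨F, hF⟩ := exists_frame (hE t₁ ht₁).posDef
  have hF' : IsOrthonormalFrame h t₁ F := hF
  have hdet := (Matrix.isUnit_iff_isUnit_det _).1 hF'.isUnit
  have hdet' : IsUnit Fᵀ.det := by rwa [Matrix.det_transpose]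
  have hD := fermiData_of_evolution (hE t₁ ht₁) (eventually_posDef isOpen_Ioo hE ht₁) (hH t₁ ht₁)
    (hρ t₁ ht₁) hF'
  obtain ⟨ε, hε, y, hy₁, hy⟩ := exists_fermi_solution hγ (T := T) (t₁ := t₁)
    (y₀ := pack ![F, F⁻¹, frameExpansion h t₁ F] (ρ t₁)) hD (ht₁.2.trans hbT)
  have ht₁' : t₁ ∈ Ioo (t₁ - ε) T := ⟨by linarith, ht₁.2.trans hbT⟩
  have hD' : FermiData v (block (y t₁) 0) (block (y t₁) 1) (block (y t₁) 2)
      (TripleSpace.scalar (y t₁)) := by rw [hy₁]; exact hD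
  set hn : SpatialMetric := coframeMetric fun s => block (y s) 1 with hhn
  set ρn : ℝ → ℝ := fun s => TripleSpace.scalar (y s) with hρn
  have hEn : ∀ t ∈ Ioo (t₁ - ε) T, EvolutionAt γ hn (fun _ => Fin.cons 0 v) ρn t := fun t ht =>
    evolutionAt_of_fermi isOpen_Ioo ordConnected_Ioo hy ht₁' hD' ht
  have hback : ∀ A : Matrix (Fin 3) (Fin 3) ℝ, (F⁻¹)ᵀ * (Fᵀ * A * F) * F⁻¹ = A := by
    intro A
    rw [Matrix.transpose_nonsing_inv, Matrix.mul_assoc, Matrix.mul_assoc, Matrix.mul_assoc,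
      Matrix.mul_nonsing_inv _ hdet, Matrix.mul_one, ← Matrix.mul_assoc,
      Matrix.nonsing_inv_mul _ hdet', Matrix.one_mul]
  have hh₁ : h t₁ = hn t₁ := by
    have h1 : hn t₁ = (F⁻¹)ᵀ * F⁻¹ := by
      simp only [hhn, coframeMetric, hy₁]
      rfl
    rw [h1, ← hback (h t₁), hF, Matrix.mul_one]
  have hθ₁ : expansion h t₁ = expansion hn t₁ := by
    have h1 := expansion_eq_of_hasMatDerivAt (hasMatDerivAt_coframeMetric
      (f := fun s => block (y s) 1) (k := fun s => block (y s) 2) hD'.symm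
      ((fermiFlow_of_ode hy).coframe t₁ ht₁'))
    rw [hy₁] at h1
    rw [hhn, h1]
    exact (hback (expansion h t₁)).symm
  have hρ₁ : ρ t₁ = ρn t₁ := by
    simp only [hρn, hy₁]
    rfl
  have hagree : ∀ t ∈ Ico t₁ b, h t = hn t ∧ ρ t = ρn t := by
    intro t ht
    refine EvolutionAt.unique (T := t) (fun s hs => hE s ⟨ht₁.1.trans_le hs.1, hs.2.trans_lt ht.2⟩)
      (fun s hs => hEn s ⟨by linarith [hs.1], hs.2.trans_lt (ht.2.trans hbT)⟩) hh₁ hθ₁ hρ₁ t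
      ⟨ht.1, le_rfl⟩
  -- Uniqueness is available only forward from t₁, so the switch takes place at the later time t₂,
  -- around which the two solutions agree; the glued one thus satisfies the equations there as well.
  refine ⟨fun t => if t < t₂ then h t else hn t, fun t => if t < t₂ then ρ t else ρn t,
    fun t ht => ?_, fun t ht => ?_⟩
  · rcases lt_or_ge t t₂ with htt | htt
    · refine (hE t ⟨ht.1, htt.trans ht₂.2⟩).congr ?_ EventuallyEq.rfl ?_ <;>
        filter_upwards [isOpen_Iio.mem_nhds htt] with s hs using if_pos hs
    · have ht' : t ∈ Ioo t₁ T := ⟨ht₂.1.trans_le htt, ht.2⟩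
      refine (hEn t ⟨by linarith [ht'.1], ht.2⟩).congr ?_ EventuallyEq.rfl ?_
      · filter_upwards [isOpen_Ioi.mem_nhds ht'.1] with s hs
        split_ifs with hst
        · exact (hagree s ⟨le_of_lt hs, hst.trans ht₂.2⟩).1
        · rfl
      · filter_upwards [isOpen_Ioi.mem_nhds ht'.1] with s hs
        split_ifs with hst
        · exact (hagree s ⟨le_of_lt hs, hst.trans ht₂.2⟩).2
        · rfl
  · dsimp only
    split_ifs with hst
    · exact ⟨rfl, rfl⟩
    · have := hagree t ⟨ht₂.1.le.trans (not_lt.1 hst), ht.2⟩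
      exact ⟨this.1.symm, this.2.symm⟩

/-- An expanding solution with a fluid extends to all later times. -/
theorem exists_extension_Ioi {γ : ℝ} (hγ : 2 / 3 ≤ γ) {v : Fin 3 → ℝ} {h : SpatialMetric}
    {ρ : ℝ → ℝ} {a b : ℝ} (hab : a < b)
    (hE : ∀ t ∈ Ioo a b, EvolutionAt γ h (fun _ => Fin.cons 0 v) ρ t)
    (hH : ∀ t ∈ Ioo a b, 0 < hubble h t) (hρ : ∀ t ∈ Ioo a b, 0 < ρ t) :
    ∃ h' ρ', (∀ t ∈ Ioi a, EvolutionAt γ h' (fun _ => Fin.cons 0 v) ρ' t) ∧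
      ∀ t ∈ Ioo a b, h' t = h t ∧ ρ' t = ρ t := by
  choose hs ρs hEs heq using fun n : ℕ =>
    exists_extension_Ioo hγ (T := |b| + n + 1) hab
      (by linarith [le_abs_self b, n.cast_nonneg (α := ℝ)]) hE hH hρ
  have hcoh : ∀ m n : ℕ, m ≤ n → ∀ t ∈ Ioo a (|b| + m + 1), hs m t = hs n t ∧ ρs m t = ρs n t := by
    intro m n hmn
    have hmn' : (m : ℝ) ≤ n := by exact_mod_cast hmn
    refine EvolutionAt.unique_of_eqOn hab (hEs m) (fun t ht => hEs n t ⟨ht.1, by linarith [ht.2]⟩)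
      fun t ht => ?_
    rw [(heq m t ht).1, (heq m t ht).2, (heq n t ht).1, (heq n t ht).2]
    exact ⟨rfl, rfl⟩
  -- The value at t is taken from the extension with index ⌈|t|⌉₊, whose domain contains t. Near t
  -- the indices are at most one larger than this, so a single extension represents all of them.
  have hlt : ∀ t : ℝ, t < |b| + ⌈|t|⌉₊ + 1 := fun t => by
    linarith [le_abs_self t, Nat.le_ceil |t|, abs_nonneg b]
  refine ⟨fun t => hs ⌈|t|⌉₊ t, fun t => ρs ⌈|t|⌉₊ t, fun t ht => ?_, fun t ht => heq _ t ht⟩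
  have hev : ∀ᶠ s in 𝓝 t, hs ⌈|s|⌉₊ s = hs (⌈|t|⌉₊ + 1) s ∧ ρs ⌈|s|⌉₊ s = ρs (⌈|t|⌉₊ + 1) s := by
    have hnear : ∀ᶠ s in 𝓝 t, |s| < |t| + 1 :=
      continuous_abs.continuousAt.eventually_lt continuousAt_const (lt_add_one |t|)
    filter_upwards [hnear, isOpen_Ioi.mem_nhds ht] with s hst has
    refine hcoh _ _ ?_ s ⟨has, hlt s⟩
    rw [Nat.ceil_le]
    push_cast
    linarith [Nat.le_ceil |t|]
  refine (hEs (⌈|t|⌉₊ + 1) t ⟨ht, ?_⟩).congr (hev.mono fun s hs => hs.1) EventuallyEq.rfl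
    (hev.mono fun s hs => hs.2)
  push_cast
  linarith [hlt t]

/-- A rotating solution has J_0 = 0 and constant J_i, so only the metric and the density have to be
continued. The extension is rotating because the original solution provides a rotating state at one
time. -/
theorem IsRotatingSolution.exists_extension {γ : ℝ} (hγ : 2 / 3 ≤ γ) {a b : ℝ} {h : SpatialMetric}
    {J : ℝ → Fin 4 → ℝ} {ρ : ℝ → ℝ} (hr : IsRotatingSolution γ (Ioo a b) h J ρ) :
    ∃ h' J' ρ', IsRotatingSolution γ (Ioi a) h' J' ρ' ∧
      ∀ t ∈ Ioo a b, h' t = h t ∧ J' t = J t ∧ ρ' t = ρ t := by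
  have hR := hr.rotatingOn isOpen_Ioo ordConnected_Ioo
  obtain ⟨t₁, ht₁, hH₁, E, hE, hrot⟩ := hr.rotating
  have hab : a < b := ht₁.1.trans ht₁.2
  set v := spatialPart (J t₁) with hv
  have hJ : ∀ t ∈ Ioo a b, J t = Fin.cons 0 v := by
    intro t ht
    ext μ
    refine Fin.cases ?_ (fun i => ?_) μ
    · simpa using hR.temporal t ht
    · simpa [hv, spatialPart] using eq_of_hasDerivAt_zero isOpen_Ioo ordConnected_Ioo
        (fun s hs => (hR.evolution s hs).J_space i) ht₁ ht
  obtain ⟨h', ρ', hE', heq⟩ := exists_extension_Ioi hγ (v := v) hab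
    (fun t ht => (hR.evolution t ht).congr EventuallyEq.rfl
      (by filter_upwards [isOpen_Ioo.mem_nhds ht] with s hs using (hJ s hs).symm) EventuallyEq.rfl)
    hR.hubble_pos hR.density_pos
  have hev : h' =ᶠ[𝓝 t₁] h := by
    filter_upwards [isOpen_Ioo.mem_nhds ht₁] with s hs using (heq s hs).1
  refine ⟨h', fun _ => Fin.cons 0 v, ρ', ⟨(isTypeISolution_iff isOpen_Ioi).2 hE', t₁, ht₁.1, ?_,
    E, ?_, ?_⟩, fun t ht => ⟨(heq t ht).1, (hJ t ht).symm, (heq t ht).2⟩⟩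
  · rwa [hubble_congr hev]
  · rw [IsOrthonormalFrame, (heq t₁ ht₁).1]
    exact hE
  · rwa [hState_congr hev (hJ t₁ ht₁).symm (heq t₁ ht₁).2]

end JFormCosmology

/-! ### The theorem. -/

theorem mainTheorem4 :
    -- range of existence
    (∀ γ ∈ Icc (0 : ℝ) 2,
      (∃ (a b : ℝ) (h : SpatialMetric) (J : ℝ → Fin 4 → ℝ) (ρ : ℝ → ℝ) (s : HState),
        a < b ∧ IsTypeISolution γ (Ioo a b) h J ρ ∧ IsEquilibrium (Ioo a b) h J ρ s ∧
          IsRotating s) ↔ γ ∈ Ioo (6 / 5 : ℝ) (4 / 3)) ∧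
    -- the Rope and its properties
    (∀ γ ∈ Ioo (6 / 5 : ℝ) (4 / 3),
      IsTypeISolution γ (Ioi 0) (ropeMetric γ) (ropeForm γ) (ropeDensity γ) ∧
      IsSelfSimilar (slab (Ioi 0)) (typeIMetric (ropeMetric γ)) ∧
      (∀ p ∈ slab (Ioi 0), ¬ IsLRSAt (typeIMetric (ropeMetric γ)) comoving p) ∧
      (∀ t > 0, deceleration (ropeMetric γ) t = 3 * γ / 2 - 1) ∧
      ∃ s ∈ spatialStates, IsRotating s ∧
        IsEquilibrium (Ioi 0) (ropeMetric γ) (ropeForm γ) (ropeDensity γ) s ∧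
        AttractsRotating γ s ∧ IsStableState γ s) ∧
    -- the attracted states are generic in the state space
    IsOpen {s : HState | IsRotating s} ∧
    spatialStates ⊆ closure (spatialStates ∩ {s | IsRotating s}) ∧
    -- Wonderland in the limit `γ → 6/5`
    IsTypeISolution (6 / 5) (Ioi 0) (wonderlandMetric (6 / 5)) (wonderlandForm (6 / 5))
      (wonderlandDensity (6 / 5)) ∧
    (∀ t > 0,
      Tendsto (fun γ => ropeMetric γ t) (𝓝[>] (6 / 5)) (𝓝 (wonderlandMetric (6 / 5) t)) ∧
      Tendsto (fun γ => ropeForm γ t) (𝓝[>] (6 / 5)) (𝓝 (wonderlandForm (6 / 5) t)) ∧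
      Tendsto (fun γ => ropeDensity γ t) (𝓝[>] (6 / 5)) (𝓝 (wonderlandDensity (6 / 5) t))) ∧
    -- the Edge in the limit `γ → 4/3`
    IsTypeISolution (4 / 3) (Ioi 0) edgeMetric edgeForm (fun _ => 0) ∧
    (∀ t > 0,
      Tendsto (fun γ => ropeMetric γ t) (𝓝[<] (4 / 3)) (𝓝 (edgeMetric t)) ∧
      Tendsto (fun γ => ropeForm γ t) (𝓝[<] (4 / 3)) (𝓝 (edgeForm t)) ∧
      Tendsto (fun γ => ropeDensity γ t) (𝓝[<] (4 / 3)) (𝓝 0)) := by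
  refine ⟨fun γ hγ => ⟨?_, fun hγ' => ?_⟩, fun γ hγ => ?_, isOpen_isRotating,
    spatialStates_subset_closure, ?_, fun t ht => ⟨?_, ?_, ?_⟩, ?_, fun t ht => ⟨?_, ?_, ?_⟩⟩
  · rintro ⟨a, b, h, J, ρ, s, hab, hsol, heq, hs⟩
    exact gamma_mem_of_equilibrium hγ.2 hab hsol heq hs
  · have hQ : 3 * γ / 2 - 1 ∈ Ioo (4 / 5 : ℝ) 1 :=
      ⟨by linarith [hγ'.1], by linarith [hγ'.2]⟩
    have hsub : Ioo (1 : ℝ) 2 ⊆ Ioi 0 := fun t ht => one_pos.trans ht.1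
    exact ⟨1, 2, ropeMetric γ, ropeForm γ, ropeDensity γ, ropeState (3 * γ / 2 - 1), one_lt_two,
      (isTypeISolution_iff isOpen_Ioo).2 fun t ht =>
        evolutionAt_rope (Ioo_subset_Icc_self hγ') (hsub ht),
      fun t ht => isEquilibrium_rope hγ' t (hsub ht), isRotating_ropeState hQ⟩
  · have hγ0 : 0 < γ := by linarith [hγ.1]
    have hQ : 3 * γ / 2 - 1 ∈ Ioo (4 / 5 : ℝ) 1 := ⟨by linarith [hγ.1], by linarith [hγ.2]⟩
    have hγQ : γ = 2 * (3 * γ / 2 - 1 + 1) / 3 := by ring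
    refine ⟨isTypeISolution_rope (Ioo_subset_Icc_self hγ), isSelfSimilar_rope hγ0,
      fun p hp => not_isLRSAt_rope hγ hp, fun t ht => deceleration_rope hγ0 ht,
      ropeState (3 * γ / 2 - 1), ropeState_mem_spatialStates hQ, isRotating_ropeState hQ,
      isEquilibrium_rope hγ, ⟨fun a b h J ρ hr => hr.exists_extension (by linarith [hγ.1]),
        fun a h J ρ hr => exists_frames_tendsto_ropeState hQ (hγQ ▸ hr)⟩, ?_⟩
    have := isStableState_ropeState hQ
    rwa [← hγQ] at this
  · refine (isTypeISolution_rope (γ := 6 / 5) (by norm_num)).congr isOpen_Ioi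
      (fun t _ => (ropeMetric_wonderland t).symm) (fun t _ => (ropeForm_wonderland t).symm)
      fun t _ => (ropeDensity_wonderland t).symm
  · rw [← ropeMetric_wonderland]
    exact tendsto_ropeMetric (by norm_num) ht _
  · rw [← ropeForm_wonderland]
    exact tendsto_ropeForm (by norm_num) t _
  · rw [← ropeDensity_wonderland]
    exact tendsto_ropeDensity (by norm_num) ht _
  · refine (isTypeISolution_rope (γ := 4 / 3) (by norm_num)).congr isOpen_Ioi
      (fun t _ => (ropeMetric_edge t).symm) (fun t _ => (ropeForm_edge t).symm)
      fun t _ => (ropeDensity_edge t).symm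
  · rw [← ropeMetric_edge]
    exact tendsto_ropeMetric (by norm_num) ht _
  · rw [← ropeForm_edge]
    exact tendsto_ropeForm (by norm_num) t _
  · rw [← ropeDensity_edge t]
    exact tendsto_ropeDensity (by norm_num) ht _
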